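/- Throughout, a topological groupoid $\mathcal{H}$ with unit space $\mathcal{H}^{(0)}$, range map $r$ and source map $s$ is called Cartan if every unit has a neighbourhood $U$ in $\mathcal{H}^{(0)}$ such that $\{\gamma\in\mathcal{H}: r(\gamma)\in U,\ s(\gamma)\in U\}$ is relatively compact in $\mathcal{H}$. A Haar system on a locally compact Hausdorff groupoid $\mathcal{H}$ is a family of Radon measures $\{\mu^u\}_{u\in\mathcal{H}^{(0)}}$ on $\mathcal{H}$ with $\operatorname{supp}\mu^u=r^{-1}(u)$, such that $u\mapsto\int f\,d\mu^u$ is continuous for all $f\in C_c(\mathcal{H})$ and $\int f(\gamma\eta)\,d\mu^{s(\gamma)}(\eta)=\int f(\eta)\,d\mu^{r(\gamma)}(\eta)$ for all $f\in C_c(\mathcal{H})$, $\gamma\in\mathcal{H}$. With respect to a Haar system $\mu$, $\mathcal{H}$ is integrable if $\sup_{x\in N}\mu^x(s^{-1}(N))<\infty$ for every compact $N\subseteq\mathcal{H}^{(0)}$. Let $\mathcal{G}$ be a second-countable, locally compact, Hausdorff groupoid whose isotropy groups $A_u=\{\gamma: r(\gamma)=u=s(\gamma)\}$ are abelian, let $\mathcal{A}=\{\gamma\in\mathcal{G}:r(\gamma)=s(\gamma)\}$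 be the isotropy groupoid, and suppose that $\mathcal{A}$ has a Haar system $\beta$. Let $\mathcal{R}=\mathcal{G}/\mathcal{A}$ be the quotient groupoid, with the quotient topology; write $\dot\gamma$ for the class of $\gamma$. Let $\hat{\mathcal{A}}=\{(\chi,u):u\in\mathcal{G}^{(0)},\ \chi\in\hat A_u\}$ be the spectrum of $C^*(\mathcal{A},\beta)$, where $(\chi,u)$ is the character determined by $(\chi,u)(f)=\int_{A_u}\chi(a)f(a)\,d\beta^u(a)$ for $f\in C_c(\mathcal{A})$; its topology is that of pointwise convergence on $C_c(\mathcal{A})$. The groupoid $\mathcal{R}$ acts on the right of $\hat{\mathcal{A}}$ by $(\chi,u)\cdot\dot\gamma=(\chi\cdot\gamma,s(\gamma))$ for $r(\gamma)=u$, where $(\chi\cdot\gamma)(a)=\chi(\gamma a\gamma^{-1})$ for $a\in A_{s(\gamma)}$. Let $\hat{\mathcal{A}}\rtimes\mathcal{R}=\{((\chi,u),\dot\gamma)\in\hat{\mathcal{A}}\times\mathcal{R}:u=r(\gamma)\}$, with the topology it has as a subspace of the product, be the corresponding groupoid: its unit space is $\hat{\mathcal{A}}$, $r(\xi,\dot\gamma)=\xi$,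 $s(\xi,\dot\gamma)=\xi\cdot\dot\gamma$, $(\xi,\dot\gamma)(\xi\cdot\dot\gamma,\dot\eta)=(\xi,\dot\gamma\dot\eta)$ and $(\xi,\dot\gamma)^{-1}=(\xi\cdot\dot\gamma,\dot\gamma^{-1})$. Then $\mathcal{R}$ and $\hat{\mathcal{A}}\rtimes\mathcal{R}$ are locally compact Hausdorff groupoids, and the following hold. (1) If $\mathcal{G}$ has a Haar system, then $\mathcal{R}$ has a Haar system; for every Haar system $\alpha$ on $\mathcal{R}$, the measures $(\delta\times\alpha)^{(\chi,u)}:=\delta_{(\chi,u)}\times\alpha^u$ (with $\delta_{(\chi,u)}$ the point mass at $(\chi,u)$) form a Haar system on $\hat{\mathcal{A}}\rtimes\mathcal{R}$; and with respect to these Haar systems, $\mathcal{R}$ is integrable if and only if $\hat{\mathcal{A}}\rtimes\mathcal{R}$ is integrable. (2) $\mathcal{R}$ is Cartan if and only if $\hat{\mathcal{A}}\rtimes\mathcal{R}$ is Cartan. -/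

import Mathlib

open MeasureTheory Topology
open scoped CompactlySupported

noncomputable section

/-- A groupoid with space of arrows `G` and unit space `X`; the embedding `unit : X → G` identifies
`X` with the set of units. The product `γη` is defined exactly when `s γ = r η`. -/
structure GroupoidOn (X G : Type*) where
  r : G → X
  s : G → X
  unit : X → G
  inv : G → G
  mul : ∀ γ η : G, s γ = r η → G
  r_unit : ∀ x, r (unit x) = x
  s_unit : ∀ x, s (unit x) = x
  r_inv : ∀ γ, r (inv γ) = s γ
  s_inv : ∀ γ, s (inv γ) = r γ
  r_mul : ∀ γ η h, r (mul γ η h) = r γ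
  s_mul : ∀ γ η h, s (mul γ η h) = s η
  mul_assoc : ∀ γ η ζ (h : s γ = r η) (h' : s η = r ζ),
    mul (mul γ η h) ζ ((s_mul γ η h).trans h') = mul γ (mul η ζ h') (h.trans (r_mul η ζ h').symm)
  unit_mul : ∀ γ, mul (unit (r γ)) γ (s_unit (r γ)) = γ
  mul_unit : ∀ γ, mul γ (unit (s γ)) (r_unit (s γ)).symm = γ
  mul_inv : ∀ γ, mul γ (inv γ) (r_inv γ).symm = unit (r γ)
  inv_mul : ∀ γ, mul (inv γ) γ (s_inv γ) = unit (s γ)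

namespace GroupoidOn

/-! ### Topological groupoids, Haar systems, integrable and Cartan groupoids -/

section General

variable {X G : Type*} [TopologicalSpace X] [TopologicalSpace G]

/-- The structure maps of the groupoid are continuous. Since `r ∘ unit = id`, the topology of `X`
is the one it has as a subspace of `G`. -/
class IsTopological (𝓗 : GroupoidOn X G) : Prop where
  continuous_r : Continuous 𝓗.r
  continuous_s : Continuous 𝓗.s
  continuous_unit : Continuous 𝓗.unit
  continuous_inv : Continuous 𝓗.inv
  continuous_mul : Continuous fun p : {p : G × G // 𝓗.s p.1 = 𝓗.r p.2} => 𝓗.mul p.1.1 p.1.2 p.2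

/-- A locally compact Hausdorff (topological) groupoid. -/
structure IsLocallyCompactHausdorff (𝓗 : GroupoidOn X G) : Prop where
  isTopological : 𝓗.IsTopological
  locallyCompactSpace : LocallyCompactSpace G
  t2Space : T2Space G

/-- A (left) Haar system: Radon measures `μ^u`, `u ∈ X`, on `G` with support `r⁻¹(u)`, such that
`u ↦ ∫ f dμ^u` is continuous for `f ∈ C_c(G)`, and
`∫ f(γη) dμ^{s(γ)}(η) = ∫ f(η) dμ^{r(γ)}(η)`. -/
structure IsHaarSystem (𝓗 : GroupoidOn X G) [MeasurableSpace G] [BorelSpace G]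
    (μ : X → Measure G) : Prop where
  regular : ∀ u, (μ u).Regular
  support_eq : ∀ u, (μ u).support = {γ | 𝓗.r γ = u}
  continuous_integral : ∀ f : C_c(G, ℂ), Continuous fun u => ∫ γ, f γ ∂(μ u)
  left_invariant : ∀ (f : C_c(G, ℂ)) (γ : G),
    (∫ η, (open Classical in if h : 𝓗.s γ = 𝓗.r η then f (𝓗.mul γ η h) else 0) ∂(μ (𝓗.s γ)))
      = ∫ η, f η ∂(μ (𝓗.r γ))

/-- Integrability with respect to a Haar system: `sup_{x ∈ N} μ^x(s⁻¹(N)) < ∞` for every compact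
set `N` of units. -/
def IsIntegrable (𝓗 : GroupoidOn X G) [MeasurableSpace G] (μ : X → Measure G) : Prop :=
  ∀ N : Set X, IsCompact N → ⨆ x ∈ N, μ x (𝓗.s ⁻¹' N) < ⊤

/-- A set `U` of units is wandering if `{γ | r γ ∈ U, s γ ∈ U}` is relatively compact. -/
def IsWandering (𝓗 : GroupoidOn X G) (U : Set X) : Prop :=
  IsCompact (closure {γ | 𝓗.r γ ∈ U ∧ 𝓗.s γ ∈ U})

/-- Every unit has a wandering neighbourhood. -/
def IsCartan (𝓗 : GroupoidOn X G) : Prop :=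
  ∀ x : X, ∃ U ∈ 𝓝 x, 𝓗.IsWandering U

end General

variable {X G : Type*} (𝓖 : GroupoidOn X G)

section Algebra

variable {𝓖}

theorem mul_congr {γ γ' η η' : G} (h : 𝓖.s γ = 𝓖.r η) (e : γ = γ') (e' : η = η') :
    𝓖.mul γ η h = 𝓖.mul γ' η' (e ▸ e' ▸ h) := by
  subst e e'; rfl

theorem unit_mul' {γ : G} {x : X} (h : 𝓖.s (𝓖.unit x) = 𝓖.r γ) : 𝓖.mul (𝓖.unit x) γ h = γ := by
  obtain rfl : x = 𝓖.r γ := (𝓖.s_unit x).symm.trans h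
  exact 𝓖.unit_mul γ

theorem mul_unit' {γ : G} {x : X} (h : 𝓖.s γ = 𝓖.r (𝓖.unit x)) : 𝓖.mul γ (𝓖.unit x) h = γ := by
  obtain rfl : 𝓖.s γ = x := h.trans (𝓖.r_unit x)
  exact 𝓖.mul_unit γ

theorem inv_mul_cancel_left {γ η : G} (h : 𝓖.s γ = 𝓖.r η)
    (h' : 𝓖.s (𝓖.inv γ) = 𝓖.r (𝓖.mul γ η h)) : 𝓖.mul (𝓖.inv γ) (𝓖.mul γ η h) h' = η := by
  rw [← 𝓖.mul_assoc (𝓖.inv γ) γ η (𝓖.s_inv γ) h, mul_congr _ (𝓖.inv_mul γ) rfl]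
  exact unit_mul' _

theorem mul_inv_cancel_left {γ η : G} (h : 𝓖.s (𝓖.inv γ) = 𝓖.r η)
    (h' : 𝓖.s γ = 𝓖.r (𝓖.mul (𝓖.inv γ) η h)) : 𝓖.mul γ (𝓖.mul (𝓖.inv γ) η h) h' = η := by
  rw [← 𝓖.mul_assoc γ (𝓖.inv γ) η (𝓖.r_inv γ).symm h, mul_congr _ (𝓖.mul_inv γ) rfl]
  exact unit_mul' _

theorem mul_left_cancel {γ η ζ : G} (h : 𝓖.s γ = 𝓖.r η) (h' : 𝓖.s γ = 𝓖.r ζ)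
    (e : 𝓖.mul γ η h = 𝓖.mul γ ζ h') : η = ζ := by
  have h₁ : 𝓖.s (𝓖.inv γ) = 𝓖.r (𝓖.mul γ η h) := (𝓖.s_inv γ).trans (𝓖.r_mul _ _ _).symm
  rw [← inv_mul_cancel_left h h₁, mul_congr h₁ rfl e]
  exact inv_mul_cancel_left _ _

theorem mul_inv_cancel_right {γ η : G} (h : 𝓖.s γ = 𝓖.r η)
    (h' : 𝓖.s (𝓖.mul γ η h) = 𝓖.r (𝓖.inv η)) : 𝓖.mul (𝓖.mul γ η h) (𝓖.inv η) h' = γ := by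
  rw [𝓖.mul_assoc γ η (𝓖.inv η) h (𝓖.r_inv η).symm, mul_congr _ rfl (𝓖.mul_inv η)]
  exact mul_unit' _

end Algebra

/-! ### Isotropy -/

/-- The isotropy group `A_u = {γ | r γ = u = s γ}`. -/
def IsoGroup (u : X) : Type _ := {γ : G // 𝓖.r γ = u ∧ 𝓖.s γ = u}

instance (u : X) : Group (𝓖.IsoGroup u) where
  mul a b := ⟨𝓖.mul a.1 b.1 (a.2.2.trans b.2.1.symm),
    (𝓖.r_mul _ _ _).trans a.2.1, (𝓖.s_mul _ _ _).trans b.2.2⟩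
  one := ⟨𝓖.unit u, 𝓖.r_unit u, 𝓖.s_unit u⟩
  inv a := ⟨𝓖.inv a.1, (𝓖.r_inv _).trans a.2.2, (𝓖.s_inv _).trans a.2.1⟩
  mul_assoc _ _ _ := Subtype.ext (𝓖.mul_assoc _ _ _ _ _)
  one_mul _ := Subtype.ext (unit_mul' _)
  mul_one _ := Subtype.ext (mul_unit' _)
  inv_mul_cancel a := Subtype.ext ((𝓖.inv_mul a.1).trans (congrArg 𝓖.unit a.2.2))

instance [TopologicalSpace G] (u : X) : TopologicalSpace (𝓖.IsoGroup u) :=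
  inferInstanceAs (TopologicalSpace {γ : G // 𝓖.r γ = u ∧ 𝓖.s γ = u})

/-- All isotropy groups are abelian. -/
def HasAbelianIsotropy : Prop := ∀ (u : X) (a b : 𝓖.IsoGroup u), a * b = b * a

/-- The space `𝓐 = {γ | r γ = s γ}` of arrows of the isotropy groupoid. -/
def Iso : Type _ := {γ : G // 𝓖.r γ = 𝓖.s γ}

instance [TopologicalSpace G] : TopologicalSpace 𝓖.Iso :=
  inferInstanceAs (TopologicalSpace {γ : G // 𝓖.r γ = 𝓖.s γ})

instance [TopologicalSpace G] : MeasurableSpace 𝓖.Iso := borel _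

instance [TopologicalSpace G] : BorelSpace 𝓖.Iso := ⟨rfl⟩

/-- The isotropy groupoid `𝓐`, a subgroupoid of `𝓖` with the same units. -/
def isotropy : GroupoidOn X 𝓖.Iso where
  r a := 𝓖.r a.1
  s a := 𝓖.s a.1
  unit x := ⟨𝓖.unit x, (𝓖.r_unit x).trans (𝓖.s_unit x).symm⟩
  inv a := ⟨𝓖.inv a.1, (𝓖.r_inv _).trans (a.2.symm.trans (𝓖.s_inv _).symm)⟩
  mul a b h := ⟨𝓖.mul a.1 b.1 h,
    (𝓖.r_mul _ _ _).trans ((a.2.trans (h.trans b.2)).trans (𝓖.s_mul _ _ _).symm)⟩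
  r_unit _ := 𝓖.r_unit _
  s_unit _ := 𝓖.s_unit _
  r_inv _ := 𝓖.r_inv _
  s_inv _ := 𝓖.s_inv _
  r_mul _ _ _ := 𝓖.r_mul _ _ _
  s_mul _ _ _ := 𝓖.s_mul _ _ _
  mul_assoc _ _ _ _ _ := Subtype.ext (𝓖.mul_assoc _ _ _ _ _)
  unit_mul _ := Subtype.ext (𝓖.unit_mul _)
  mul_unit _ := Subtype.ext (𝓖.mul_unit _)
  mul_inv _ := Subtype.ext (𝓖.mul_inv _)
  inv_mul _ := Subtype.ext (𝓖.inv_mul _)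

/-! ### The quotient groupoid `𝓡 = 𝓖/𝓐` -/

/-- `η` lies in the orbit `γ𝓐`. -/
def OrbitRel (γ η : G) : Prop :=
  ∃ (a : 𝓖.Iso) (h : 𝓖.s γ = 𝓖.r a.1), 𝓖.mul γ a.1 h = η

theorem orbitRel_iff {γ η : G} : 𝓖.OrbitRel γ η ↔ 𝓖.r γ = 𝓖.r η ∧ 𝓖.s γ = 𝓖.s η := by
  constructor
  · rintro ⟨a, h, rfl⟩
    exact ⟨(𝓖.r_mul _ _ _).symm, (h.trans a.2).trans (𝓖.s_mul _ _ _).symm⟩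
  · rintro ⟨hr, hs⟩
    have h₁ : 𝓖.s (𝓖.inv γ) = 𝓖.r η := (𝓖.s_inv γ).trans hr
    refine ⟨⟨𝓖.mul (𝓖.inv γ) η h₁, ?_⟩, ?_, mul_inv_cancel_left _ _⟩
    · rw [𝓖.r_mul, 𝓖.s_mul, 𝓖.r_inv, hs]
    · rw [𝓖.r_mul, 𝓖.r_inv]

/-- The orbit equivalence relation of the right action of `𝓐` on `𝓖`. -/
def orbitSetoid : Setoid G where
  r := 𝓖.OrbitRel
  iseqv :=
    { refl := fun _ => 𝓖.orbitRel_iff.2 ⟨rfl, rfl⟩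
      symm := fun h => 𝓖.orbitRel_iff.2
        ⟨(𝓖.orbitRel_iff.1 h).1.symm, (𝓖.orbitRel_iff.1 h).2.symm⟩
      trans := fun h h' => 𝓖.orbitRel_iff.2
        ⟨(𝓖.orbitRel_iff.1 h).1.trans (𝓖.orbitRel_iff.1 h').1,
          (𝓖.orbitRel_iff.1 h).2.trans (𝓖.orbitRel_iff.1 h').2⟩ }

/-- The space of arrows of `𝓡 = 𝓖/𝓐`, with the quotient topology and its Borel sets. -/
def IsoQuotient : Type _ := Quotient 𝓖.orbitSetoid

instance [TopologicalSpace G] : TopologicalSpace 𝓖.IsoQuotient :=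
  inferInstanceAs (TopologicalSpace (Quotient 𝓖.orbitSetoid))

instance [TopologicalSpace G] : MeasurableSpace 𝓖.IsoQuotient := borel _

instance [TopologicalSpace G] : BorelSpace 𝓖.IsoQuotient := ⟨rfl⟩

namespace IsoQuotient

variable {𝓖}

/-- The quotient map `γ ↦ γ̇`. -/
def mk (γ : G) : 𝓖.IsoQuotient := Quotient.mk 𝓖.orbitSetoid γ

/-- A representative of a class. -/
def out (ρ : 𝓖.IsoQuotient) : G := Quotient.out (s := 𝓖.orbitSetoid) ρ

/-- The range map of `𝓡`. -/
def r (ρ : 𝓖.IsoQuotient) : X :=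
  Quotient.lift (s := 𝓖.orbitSetoid) 𝓖.r (fun _ _ h => (𝓖.orbitRel_iff.1 h).1) ρ

/-- The source map of `𝓡`. -/
def s (ρ : 𝓖.IsoQuotient) : X :=
  Quotient.lift (s := 𝓖.orbitSetoid) 𝓖.s (fun _ _ h => (𝓖.orbitRel_iff.1 h).2) ρ

@[simp] theorem r_mk (γ : G) : r (mk γ : 𝓖.IsoQuotient) = 𝓖.r γ := rfl

@[simp] theorem s_mk (γ : G) : s (mk γ : 𝓖.IsoQuotient) = 𝓖.s γ := rfl

theorem mk_out (ρ : 𝓖.IsoQuotient) : mk ρ.out = ρ := Quotient.out_eq (s := 𝓖.orbitSetoid) ρ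

theorem r_out (ρ : 𝓖.IsoQuotient) : 𝓖.r ρ.out = r ρ := by rw [← r_mk, mk_out]

theorem s_out (ρ : 𝓖.IsoQuotient) : 𝓖.s ρ.out = s ρ := by rw [← s_mk, mk_out]

/-- `𝓡` is principal. -/
theorem ext {ρ σ : 𝓖.IsoQuotient} (hr : r ρ = r σ) (hs : s ρ = s σ) : ρ = σ := by
  rw [← mk_out ρ, ← mk_out σ]
  refine Quotient.sound (s := 𝓖.orbitSetoid) (𝓖.orbitRel_iff.2 ⟨?_, ?_⟩)
  · rw [r_out, r_out, hr]
  · rw [s_out, s_out, hs]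

end IsoQuotient

/-- The groupoid `𝓡 = 𝓖/𝓐`; by `quotient_mul_mk` and `quotient_inv_mk` its operations are the ones
induced from `𝓖`. -/
def quotient : GroupoidOn X 𝓖.IsoQuotient where
  r := IsoQuotient.r
  s := IsoQuotient.s
  unit x := .mk (𝓖.unit x)
  inv ρ := .mk (𝓖.inv ρ.out)
  mul ρ σ h := .mk (𝓖.mul ρ.out σ.out (ρ.s_out.trans (h.trans σ.r_out.symm)))
  r_unit _ := 𝓖.r_unit _
  s_unit _ := 𝓖.s_unit _
  r_inv ρ := (𝓖.r_inv _).trans ρ.s_out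
  s_inv ρ := (𝓖.s_inv _).trans ρ.r_out
  r_mul ρ _ _ := (𝓖.r_mul _ _ _).trans ρ.r_out
  s_mul _ σ _ := (𝓖.s_mul _ _ _).trans σ.s_out
  mul_assoc _ _ _ _ _ := by
    apply IsoQuotient.ext <;> simp [𝓖.r_mul, 𝓖.s_mul, IsoQuotient.r_out, IsoQuotient.s_out]
  unit_mul _ := by
    apply IsoQuotient.ext <;>
      simp [𝓖.r_mul, 𝓖.s_mul, IsoQuotient.r_out, IsoQuotient.s_out, 𝓖.r_unit]
  mul_unit _ := by
    apply IsoQuotient.ext <;>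
      simp [𝓖.r_mul, 𝓖.s_mul, IsoQuotient.r_out, IsoQuotient.s_out, 𝓖.s_unit]
  mul_inv _ := by
    apply IsoQuotient.ext <;>
      simp [𝓖.r_mul, 𝓖.s_mul, IsoQuotient.r_out, IsoQuotient.s_out, 𝓖.r_unit, 𝓖.s_unit, 𝓖.s_inv]
  inv_mul _ := by
    apply IsoQuotient.ext <;>
      simp [𝓖.r_mul, 𝓖.s_mul, IsoQuotient.r_out, IsoQuotient.s_out, 𝓖.r_unit, 𝓖.s_unit, 𝓖.r_inv]

theorem r_quotient_mul (ρ σ : 𝓖.IsoQuotient) (h : ρ.s = σ.r) :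
    IsoQuotient.r (𝓖.quotient.mul ρ σ h) = ρ.r := 𝓖.quotient.r_mul ρ σ h

theorem quotient_mul_mk (γ η : G) (h : 𝓖.s γ = 𝓖.r η) :
    𝓖.quotient.mul (.mk γ) (.mk η) h = .mk (𝓖.mul γ η h) := by
  apply IsoQuotient.ext
  · exact (𝓖.quotient.r_mul (.mk γ) (.mk η) h).trans (𝓖.r_mul γ η h).symm
  · exact (𝓖.quotient.s_mul (.mk γ) (.mk η) h).trans (𝓖.s_mul γ η h).symm

theorem quotient_inv_mk (γ : G) : 𝓖.quotient.inv (.mk γ) = .mk (𝓖.inv γ) := by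
  apply IsoQuotient.ext
  · exact (𝓖.quotient.r_inv _).trans (𝓖.r_inv _).symm
  · exact (𝓖.quotient.s_inv _).trans (𝓖.s_inv _).symm

/-! ### Conjugation and the dual bundle `𝓐^` -/

section Dual

variable [TopologicalSpace X] [TopologicalSpace G]

variable {𝓖} in
/-- For `γ` with `r γ = u` and `s γ = v`, the homomorphism `A_v → A_u`, `a ↦ γ a γ⁻¹`. -/
def conj [𝓖.IsTopological] (γ : G) {u v : X} (hr : 𝓖.r γ = u) (hs : 𝓖.s γ = v) :
    𝓖.IsoGroup v →ₜ* 𝓖.IsoGroup u where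
  toFun a := ⟨𝓖.mul (𝓖.mul γ a.1 (hs.trans a.2.1.symm)) (𝓖.inv γ)
      ((𝓖.s_mul _ _ _).trans (a.2.2.trans (hs.symm.trans (𝓖.r_inv γ).symm))),
    ((𝓖.r_mul _ _ _).trans (𝓖.r_mul _ _ _)).trans hr,
    ((𝓖.s_mul _ _ _).trans (𝓖.s_inv _)).trans hr⟩
  map_one' := by
    subst hr hs
    refine Subtype.ext ?_
    change 𝓖.mul (𝓖.mul γ (𝓖.unit _) _) (𝓖.inv γ) _ = 𝓖.unit _
    rw [mul_congr _ (𝓖.mul_unit γ) rfl, 𝓖.mul_inv]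
  map_mul' a b := by
    subst hr hs
    refine Subtype.ext ?_
    have hb : 𝓖.s γ = 𝓖.r b.1 := b.2.1.symm
    have hb' : 𝓖.s b.1 = 𝓖.r (𝓖.inv γ) := b.2.2.trans (𝓖.r_inv γ).symm
    have hab : 𝓖.s a.1 = 𝓖.r b.1 := a.2.2.trans b.2.1.symm
    have ha' : 𝓖.s a.1 = 𝓖.r (𝓖.inv γ) := a.2.2.trans (𝓖.r_inv γ).symm
    have e := 𝓖.mul_assoc γ b.1 (𝓖.inv γ) hb hb'
    have e₂ := inv_mul_cancel_left (γ := γ) (η := 𝓖.mul b.1 (𝓖.inv γ) hb')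
      (hb.trans (𝓖.r_mul _ _ _).symm) ((𝓖.s_inv γ).trans (𝓖.r_mul _ _ _).symm)
    change 𝓖.mul (𝓖.mul γ (𝓖.mul a.1 b.1 hab) _) (𝓖.inv γ) _ =
      𝓖.mul (𝓖.mul (𝓖.mul γ a.1 _) (𝓖.inv γ) _) (𝓖.mul (𝓖.mul γ b.1 hb) (𝓖.inv γ) _) _
    rw [mul_congr _ rfl e, 𝓖.mul_assoc (𝓖.mul γ a.1 a.2.1.symm) (𝓖.inv γ) _
      ((𝓖.s_mul _ _ _).trans ha') ((𝓖.s_inv γ).trans (𝓖.r_mul _ _ _).symm), mul_congr _ rfl e₂,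
      ← 𝓖.mul_assoc (𝓖.mul γ a.1 a.2.1.symm) b.1 (𝓖.inv γ) ((𝓖.s_mul _ _ _).trans hab) hb']
    exact mul_congr _ (𝓖.mul_assoc _ _ _ _ _).symm rfl
  continuous_toFun := by
    have hm := IsTopological.continuous_mul (𝓗 := 𝓖)
    have hv : Continuous fun a : 𝓖.IsoGroup v => a.1 := continuous_subtype_val
    have h₁ : Continuous fun a : 𝓖.IsoGroup v => 𝓖.mul γ a.1 (hs.trans a.2.1.symm) :=
      hm.comp (Continuous.subtype_mk (f := fun a : 𝓖.IsoGroup v => (γ, a.1))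
        (continuous_const.prodMk hv) fun a => hs.trans a.2.1.symm)
    have h₂ := hm.comp (Continuous.subtype_mk
      (f := fun a : 𝓖.IsoGroup v => (𝓖.mul γ a.1 (hs.trans a.2.1.symm), 𝓖.inv γ))
      (h₁.prodMk continuous_const) fun a =>
        (𝓖.s_mul _ _ _).trans (a.2.2.trans (hs.symm.trans (𝓖.r_inv γ).symm)))
    exact Continuous.subtype_mk h₂ _

variable {𝓖} in
theorem conj_mul [𝓖.IsTopological] (γ η : G) (h : 𝓖.s γ = 𝓖.r η) {u v w : X} (hr : 𝓖.r γ = u)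
    (hs : 𝓖.s γ = v) (hs' : 𝓖.s η = w) (a : 𝓖.IsoGroup w) :
    conj (𝓖.mul γ η h) ((𝓖.r_mul _ _ _).trans hr) ((𝓖.s_mul _ _ _).trans hs') a
      = conj γ hr hs (conj η (h.symm.trans hs) hs' a) := by
  subst hr hs hs'
  refine Subtype.ext ?_
  have ha : 𝓖.s η = 𝓖.r a.1 := a.2.1.symm
  have ha' : 𝓖.s a.1 = 𝓖.r (𝓖.inv η) := a.2.2.trans (𝓖.r_inv η).symm
  have hi : 𝓖.s (𝓖.inv η) = 𝓖.r (𝓖.inv γ) := (𝓖.s_inv η).trans (h.symm.trans (𝓖.r_inv γ).symm)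
  have hinv : 𝓖.inv (𝓖.mul γ η h) = 𝓖.mul (𝓖.inv η) (𝓖.inv γ) hi := by
    refine mul_left_cancel (γ := 𝓖.mul γ η h) (𝓖.r_inv _).symm
      ((𝓖.s_mul _ _ _).trans ((𝓖.r_inv η).symm.trans (𝓖.r_mul _ _ _).symm)) ?_
    rw [𝓖.mul_inv, ← 𝓖.mul_assoc (𝓖.mul γ η h) (𝓖.inv η) (𝓖.inv γ)
      ((𝓖.s_mul _ _ _).trans (𝓖.r_inv η).symm) hi,
      mul_congr _ (mul_inv_cancel_right h _) rfl, 𝓖.mul_inv, 𝓖.r_mul]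
  change 𝓖.mul (𝓖.mul (𝓖.mul γ η h) a.1 _) (𝓖.inv (𝓖.mul γ η h)) _ =
    𝓖.mul (𝓖.mul γ (𝓖.mul (𝓖.mul η a.1 _) (𝓖.inv η) _) _) (𝓖.inv γ) _
  rw [mul_congr _ rfl hinv, mul_congr _ (𝓖.mul_assoc γ η a.1 h ha) rfl,
    ← 𝓖.mul_assoc _ (𝓖.inv η) (𝓖.inv γ)
      ((𝓖.s_mul _ _ _).trans ((𝓖.s_mul _ _ _).trans ha')) hi]
  exact mul_congr _ (𝓖.mul_assoc γ (𝓖.mul η a.1 ha) (𝓖.inv η) _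
    ((𝓖.s_mul _ _ _).trans ha')) rfl

variable {𝓖} in
theorem conj_congr [𝓖.IsTopological] (hab : 𝓖.HasAbelianIsotropy) {γ η : G} {u v : X}
    (hr : 𝓖.r γ = u) (hs : 𝓖.s γ = v) (hr' : 𝓖.r η = u) (hs' : 𝓖.s η = v) (a : 𝓖.IsoGroup v) :
    conj γ hr hs a = conj η hr' hs' a := by
  obtain ⟨b, h, rfl⟩ := 𝓖.orbitRel_iff.2 ⟨hr.trans hr'.symm, hs.trans hs'.symm⟩
  have hb : 𝓖.r b.1 = v := h.symm.trans hs
  rw [conj_mul γ b.1 h hr hs (b.2.symm.trans hb)]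
  congr 1
  let b' : 𝓖.IsoGroup v := ⟨b.1, hb, b.2.symm.trans hb⟩
  have key : conj b.1 hb (b.2.symm.trans hb) a = b' * a * b'⁻¹ := rfl
  rw [key, hab v b' a, mul_inv_cancel_right_aux]
where
  mul_inv_cancel_right_aux {v : X} {a b : 𝓖.IsoGroup v} : a * b * b⁻¹ = a := by group

variable {𝓖} in
theorem conj_unit [𝓖.IsTopological] {u : X} (a : 𝓖.IsoGroup u) :
    conj (𝓖.unit u) (𝓖.r_unit u) (𝓖.s_unit u) a = a :=
  show (1 : 𝓖.IsoGroup u) * a * (1 : 𝓖.IsoGroup u)⁻¹ = a by group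

/-- The set `𝓐^ = {(χ, u) | u ∈ X, χ a continuous character of A_u}`. The family of measures `β` on
`𝓐` enters through the topology below. -/
@[ext]
structure Dual (β : X → Measure 𝓖.Iso) where
  base : X
  char : 𝓖.IsoGroup base →ₜ* Circle

namespace Dual

variable {𝓖} {β : X → Measure 𝓖.Iso}

/-- `(χ, u)` as a functional on `C_c(𝓐)`: `(χ, u)(f) = ∫_{A_u} χ(a) f(a) dβ^u(a)`. -/
def eval (ξ : 𝓖.Dual β) (f : C_c(𝓖.Iso, ℂ)) : ℂ :=
  ∫ a, (open Classical in if h : 𝓖.r a.1 = ξ.base then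
    (ξ.char ⟨a.1, h, a.2.symm.trans h⟩ : ℂ) * f a else 0) ∂(β ξ.base)

/-- The topology of the spectrum of `C*(𝓐, β)`: pointwise convergence of the functionals `(χ, u)`
on the dense subalgebra `C_c(𝓐)`. -/
instance : TopologicalSpace (𝓖.Dual β) :=
  TopologicalSpace.induced (fun ξ => (ξ.eval : C_c(𝓖.Iso, ℂ) → ℂ)) inferInstance

instance : MeasurableSpace (𝓖.Dual β) := borel _

instance : BorelSpace (𝓖.Dual β) := ⟨rfl⟩

variable [𝓖.IsTopological]

/-- For `γ` with `r γ = u`: `(χ, u)·γ = (χ·γ, s γ)`, where `(χ·γ)(a) = χ(γ a γ⁻¹)`. -/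
def actArrow (ξ : 𝓖.Dual β) (γ : G) (h : ξ.base = 𝓖.r γ) : 𝓖.Dual β :=
  ⟨𝓖.s γ, ξ.char.comp (conj γ h.symm rfl)⟩

/-- The right action `(χ, u)·γ̇` of `𝓡` on `𝓐^`; see `act_mk`. -/
def act (ξ : 𝓖.Dual β) (ρ : 𝓖.IsoQuotient) (h : ξ.base = ρ.r) : 𝓖.Dual β :=
  ξ.actArrow ρ.out (h.trans ρ.r_out.symm)

theorem base_act (ξ : 𝓖.Dual β) (ρ : 𝓖.IsoQuotient) (h : ξ.base = ρ.r) :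
    (ξ.act ρ h).base = ρ.s := ρ.s_out

theorem actArrow_congr (hab : 𝓖.HasAbelianIsotropy) (ξ : 𝓖.Dual β) {γ η : G}
    (h : ξ.base = 𝓖.r γ) (h' : ξ.base = 𝓖.r η) (hs : 𝓖.s γ = 𝓖.s η) :
    ξ.actArrow γ h = ξ.actArrow η h' := by
  have key : ∀ (v : X) (e : 𝓖.s γ = v) (e' : 𝓖.s η = v),
      ξ.char.comp (conj γ h.symm e) = ξ.char.comp (conj η h'.symm e') := fun v e e' =>
    DFunLike.ext _ _ fun a => congrArg ξ.char (conj_congr hab h.symm e h'.symm e' a)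
  have : ∀ (v : X) (e : 𝓖.s γ = v),
      ξ.actArrow γ h = ⟨v, ξ.char.comp (conj γ h.symm e)⟩ := by
    rintro v rfl; rfl
  rw [this _ hs, key _ hs rfl]
  rfl

theorem act_mk (hab : 𝓖.HasAbelianIsotropy) (ξ : 𝓖.Dual β) (γ : G) (h : ξ.base = 𝓖.r γ) :
    ξ.act (.mk γ) h = ξ.actArrow γ h :=
  actArrow_congr hab ξ _ _ (IsoQuotient.s_out _)

theorem actArrow_unit (ξ : 𝓖.Dual β) {x : X} (h : ξ.base = 𝓖.r (𝓖.unit x)) :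
    ξ.actArrow (𝓖.unit x) h = ξ := by
  obtain ⟨u, χ⟩ := ξ
  obtain rfl : u = x := h.trans (𝓖.r_unit x)
  have : ∀ (v : X) (e : 𝓖.s (𝓖.unit u) = v),
      actArrow (β := β) ⟨u, χ⟩ (𝓖.unit u) h = ⟨v, χ.comp (conj (𝓖.unit u) h.symm e)⟩ := by
    rintro v rfl; rfl
  rw [this u (𝓖.s_unit u)]
  congr 1
  exact DFunLike.ext _ _ fun a => congrArg χ (conj_unit a)

theorem actArrow_mul (ξ : 𝓖.Dual β) (γ η : G) (h : ξ.base = 𝓖.r γ) (h' : 𝓖.s γ = 𝓖.r η) :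
    ξ.actArrow (𝓖.mul γ η h') (h.trans (𝓖.r_mul _ _ _).symm) = (ξ.actArrow γ h).actArrow η h' := by
  have : ∀ (v : X) (e : 𝓖.s (𝓖.mul γ η h') = v),
      ξ.actArrow (𝓖.mul γ η h') (h.trans (𝓖.r_mul _ _ _).symm) =
        ⟨v, ξ.char.comp (conj (𝓖.mul γ η h') ((𝓖.r_mul _ _ _).trans h.symm) e)⟩ := by
    rintro v rfl; rfl
  rw [this _ (𝓖.s_mul _ _ _)]
  refine congrArg (Dual.mk (β := β) (𝓖.s η)) ?_
  exact DFunLike.ext _ _ fun a => congrArg ξ.char (conj_mul γ η h' h.symm rfl rfl a)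

theorem act_unit (hab : 𝓖.HasAbelianIsotropy) (ξ : 𝓖.Dual β) (x : X)
    (h : ξ.base = IsoQuotient.r (𝓖.quotient.unit x)) : ξ.act (𝓖.quotient.unit x) h = ξ :=
  (act_mk hab ξ _ h).trans (actArrow_unit ξ h)

theorem act_mul (hab : 𝓖.HasAbelianIsotropy) (ξ : 𝓖.Dual β) (ρ σ : 𝓖.IsoQuotient)
    (h : ξ.base = ρ.r) (h' : ρ.s = σ.r) (h₁ : ξ.base = IsoQuotient.r (𝓖.quotient.mul ρ σ h'))
    (h₂ : (ξ.act ρ h).base = σ.r) :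
    ξ.act (𝓖.quotient.mul ρ σ h') h₁ = (ξ.act ρ h).act σ h₂ :=
  (act_mk hab ξ _ h₁).trans (actArrow_mul ξ ρ.out σ.out (h.trans ρ.r_out.symm) _)

end Dual

/-! ### The groupoid `𝓐^ ⋊ 𝓡` -/

/-- The space of arrows `{(χ, r γ, γ̇)} ⊆ 𝓐^ × 𝓡` of `𝓐^ ⋊ 𝓡`, with the topology it has as a
subspace of the product, and its Borel sets. -/
def Semidirect (β : X → Measure 𝓖.Iso) : Type _ :=
  {p : 𝓖.Dual β × 𝓖.IsoQuotient // p.1.base = p.2.r}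

instance (β : X → Measure 𝓖.Iso) : TopologicalSpace (𝓖.Semidirect β) :=
  inferInstanceAs (TopologicalSpace {p : 𝓖.Dual β × 𝓖.IsoQuotient // p.1.base = p.2.r})

instance (β : X → Measure 𝓖.Iso) : MeasurableSpace (𝓖.Semidirect β) := borel _

instance (β : X → Measure 𝓖.Iso) : BorelSpace (𝓖.Semidirect β) := ⟨rfl⟩

variable {𝓖} in
theorem Semidirect.composable [𝓖.IsTopological] {β : X → Measure 𝓖.Iso} {p q : 𝓖.Semidirect β}
    (h : p.1.1.act p.1.2 p.2 = q.1.1) : p.1.2.s = q.1.2.r :=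
  (p.1.1.base_act _ p.2).symm.trans ((congrArg Dual.base h).trans q.2)

/-- The groupoid `𝓐^ ⋊ 𝓡` with unit space `𝓐^`: `r (χ, γ̇) = χ`, `s (χ, γ̇) = χ·γ̇`,
`(χ, γ̇)(χ·γ̇, α̇) = (χ, γ̇α̇)` and `(χ, γ̇)⁻¹ = (χ·γ̇, γ̇⁻¹)`. -/
def semidirect [𝓖.IsTopological] (hab : 𝓖.HasAbelianIsotropy) (β : X → Measure 𝓖.Iso) :
    GroupoidOn (𝓖.Dual β) (𝓖.Semidirect β) where
  r p := p.1.1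
  s p := p.1.1.act p.1.2 p.2
  unit ξ := ⟨(ξ, 𝓖.quotient.unit ξ.base), (𝓖.quotient.r_unit _).symm⟩
  inv p := ⟨(p.1.1.act p.1.2 p.2, 𝓖.quotient.inv p.1.2),
    (p.1.1.base_act _ p.2).trans (𝓖.quotient.r_inv _).symm⟩
  mul p q h := ⟨(p.1.1, 𝓖.quotient.mul p.1.2 q.1.2 (Semidirect.composable h)),
    p.2.trans (𝓖.r_quotient_mul p.1.2 q.1.2 (Semidirect.composable h)).symm⟩
  r_unit _ := rfl
  s_unit ξ := ξ.act_unit hab _ _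
  r_inv _ := rfl
  s_inv p := by
    have h : p.1.2.s = IsoQuotient.r (𝓖.quotient.inv p.1.2) := (𝓖.quotient.r_inv p.1.2).symm
    change (p.1.1.act p.1.2 p.2).act (𝓖.quotient.inv p.1.2) _ = p.1.1
    rw [← Dual.act_mul hab p.1.1 p.1.2 (𝓖.quotient.inv p.1.2) p.2 h
      (p.2.trans (𝓖.r_quotient_mul p.1.2 _ h).symm)]
    have e : 𝓖.quotient.mul p.1.2 (𝓖.quotient.inv p.1.2) h = 𝓖.quotient.unit p.1.2.r :=
      𝓖.quotient.mul_inv p.1.2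
    simp only [e]
    exact Dual.act_unit hab _ _ _
  r_mul _ _ _ := rfl
  s_mul p q h := by
    have h' : p.1.2.s = q.1.2.r := Semidirect.composable h
    change p.1.1.act (𝓖.quotient.mul p.1.2 q.1.2 h') _ = q.1.1.act q.1.2 q.2
    rw [Dual.act_mul hab p.1.1 p.1.2 q.1.2 p.2 h'
      (p.2.trans (𝓖.r_quotient_mul p.1.2 q.1.2 h').symm) ((p.1.1.base_act _ p.2).trans h')]
    simp only [h]
  mul_assoc p q t h h' := Subtype.ext (Prod.ext rfl (𝓖.quotient.mul_assoc p.1.2 q.1.2 t.1.2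
    (Semidirect.composable h) (Semidirect.composable h')))
  unit_mul p := Subtype.ext (Prod.ext rfl (unit_mul' (𝓖 := 𝓖.quotient)
    ((𝓖.quotient.s_unit _).trans p.2)))
  mul_unit p := Subtype.ext (Prod.ext rfl (mul_unit' (𝓖 := 𝓖.quotient)
    ((p.1.1.base_act _ p.2).symm.trans (𝓖.quotient.r_unit _).symm)))
  mul_inv p := Subtype.ext (Prod.ext rfl
    ((𝓖.quotient.mul_inv p.1.2).trans (congrArg 𝓖.quotient.unit p.2.symm)))
  inv_mul p := Subtype.ext (Prod.ext rfl
    ((𝓖.quotient.inv_mul p.1.2).trans (congrArg 𝓖.quotient.unit (p.1.1.base_act _ p.2).symm)))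

variable {𝓖} in
/-- The system of measures `δ × α`: the measure at `(χ, u)` is the product
`δ_{(χ, u)} × α^u` of the point mass and `α^u`, regarded as a measure on `𝓐^ ⋊ 𝓡 ⊆ 𝓐^ × 𝓡`. -/
def deltaProd (β : X → Measure 𝓖.Iso) (α : X → Measure 𝓖.IsoQuotient) (ξ : 𝓖.Dual β) :
    Measure (𝓖.Semidirect β) :=
  ((Measure.dirac ξ).prod (α ξ.base)).comap Subtype.val

end Dual

end GroupoidOn

end

/-! ### Integration over the fibres of a continuous system of measures -/

open MeasureTheory Topology
open scoped CompactlySupported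
open Filter Set

set_option linter.unusedSectionVars false

/-! The base map `𝓐^ → X` and the section `u ↦ (1, u)` of trivial characters reduce the comparison
of `𝓡` with `𝓐^ ⋊ 𝓡` to formalities. Both are continuous and compatible with the action: `(χ, u)·ρ`
lies over `s ρ`, and a trivial character is carried to a trivial character. Compact sets of units
can therefore be pushed down along the base map and lifted along the section, and this transfers the
Cartan property (`isCartan_quotient_iff`) and integrability (`isIntegrable_quotient_iff`). The
measure `δ_ξ × α^u` is the image of `α^u` under `ρ ↦ (ξ, ρ)` (`deltaProd_eq_map`), so its Haar
properties come from those of `α`. The real work lies in the topology of `𝓐^` and in the Haar system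
of `𝓡`.

Topology. A Haar system on `𝓐` makes `r` open on `𝓐`, hence `𝓖 → 𝓡` is open; `𝓡` is Hausdorff
because `(r, s)` is injective on it. For `𝓐^` the key is `χ(a) · ξ(f) = ∫ χ(b) f(a⁻¹b) dβ^u(b)` with
`ξ = (χ, u)`, which is left invariance plus multiplicativity (`integral_chi_translate`). Where `ξ(f)
≠ 0` it recovers `χ(a)` from values of the functional, so pointwise convergence of functionals to a
nonzero limit amounts to continuous convergence of characters: `χ_i(a_i) → χ(a)` whenever `a_i → a`
with `a_i` over the base of `ξ_i` (`exists_tendsto_chi`, `tendsto_of_tendsto_chi`). This yields the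
Hausdorff property, continuity of the action and, since such limits are again characters,
compactness of `{|ξ(f)| ≥ δ}` and so local compactness.

Haar system of `𝓡`. Choose a Borel weight `w` on `𝓖` with `∫ w(γa) dβ^{s(γ)}(a) = 1` for all `γ`
(`exists_weight`), and let `α^v` be the image of `w·λ^v`, where `λ` is the Haar system of `𝓖`.
Independence of `w`, left invariance and continuity all follow once right averaging over `𝓐` is
symmetric for `λ^v` (`lintegral_mul_rightAvg`). Left averaging is symmetric, because `λ` is left
invariant and the abelian groups `A_u` are unimodular. Left and right averages at `γ` are both
invariant integrals over the coset `γA_{s(γ)} = A_{r(γ)}γ`, so they differ by a factor in `(0, ∞)`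
depending only on the class of `γ` (`rightAvg_mul_leftAvg`), and such a factor can be absorbed into
an invariant density. -/

/-- A continuous family of locally finite measures `μ u` carried by the fibres `π⁻¹(u)`. -/
structure IsContinuousSystem {X E : Type*} [TopologicalSpace X] [TopologicalSpace E]
    [MeasurableSpace E] (π : E → X) (μ : X → Measure E) : Prop where
  continuous_proj : Continuous π
  finite_compacts : ∀ u, IsFiniteMeasureOnCompacts (μ u)
  ae_proj_eq : ∀ u, ∀ᵐ e ∂(μ u), π e = u
  continuous_integral : ∀ f : C_c(E, ℂ), Continuous fun u => ∫ e, f e ∂(μ u)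

/-- A compact subset of an open set carries a compactly supported bump function. -/
theorem exists_bump {E : Type*} [TopologicalSpace E] [LocallyCompactSpace E] [T2Space E]
    {K U : Set E} (hK : IsCompact K) (hU : IsOpen U) (hKU : K ⊆ U) :
    ∃ φ : C(E, ℝ), HasCompactSupport φ ∧ EqOn φ 1 K ∧ (∀ x, x ∉ U → φ x = 0) ∧
      ∀ x, φ x ∈ Icc (0 : ℝ) 1 := by
  obtain ⟨φ, h1, h0, hc, hr⟩ := exists_continuous_one_zero_of_isCompact hK hU.isClosed_compl
    (disjoint_compl_right_iff_subset.2 hKU)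
  exact ⟨φ, hc, h1, fun x hx => h0 hx, hr⟩

/-- A real compactly supported function, regarded as a complex one. -/
noncomputable def complexBump {E : Type*} [TopologicalSpace E] (φ : C(E, ℝ)) (h : HasCompactSupport φ) :
    C_c(E, ℂ) :=
  ⟨⟨fun x => (φ x : ℂ), by fun_prop⟩, h.comp_left (g := fun t : ℝ => (t : ℂ)) rfl⟩

@[simp] theorem complexBump_apply {E : Type*} [TopologicalSpace E] (φ : C(E, ℝ))
    (h : HasCompactSupport φ) (x : E) : complexBump φ h x = (φ x : ℂ) := rfl

/-- The extension theorem of Tietze for compactly supported functions. -/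
theorem exists_compactlySupported_extension {E : Type*} [TopologicalSpace E]
    [LocallyCompactSpace E] [T2Space E] [SecondCountableTopology E] {S K : Set E}
    (hS : IsClosed S) (hK : IsCompact K) {f : E → ℂ} (hf : ContinuousOn f S)
    (h0 : ∀ x ∈ S, x ∉ K → f x = 0) : ∃ g : C_c(E, ℂ), EqOn g f S := by
  obtain ⟨φ, hc, h1, -, hr⟩ := exists_bump hK isOpen_univ (subset_univ K)
  obtain ⟨g, hg⟩ := ContinuousMap.exists_restrict_eq hS
    ⟨S.domRestrict f, continuousOn_iff_continuous_domRestrict.1 hf⟩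
  have hg' : ∀ x ∈ S, g x = f x := fun x hx => DFunLike.congr_fun hg ⟨x, hx⟩
  refine ⟨⟨⟨fun x => (φ x : ℂ) * g x, by fun_prop⟩, ?_⟩, fun x hx => ?_⟩
  · exact (hc.comp_left (g := fun t : ℝ => (t : ℂ)) rfl).mul_right
  · change (φ x : ℂ) * g x = f x
    by_cases hxK : x ∈ K
    · rw [h1 hxK, hg' x hx]; simp
    · rw [hg' x hx, h0 x hx hxK, mul_zero]

namespace IsContinuousSystem

variable {X E : Type*} [TopologicalSpace X] [T2Space X] [TopologicalSpace E]
  [LocallyCompactSpace E] [T2Space E] [SecondCountableTopology E] [MeasurableSpace E]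
  [BorelSpace E] {π : E → X} {μ : X → Measure E}

theorem continuous_integral_real (h : IsContinuousSystem π μ) (φ : C(E, ℝ))
    (hφ : HasCompactSupport φ) : Continuous fun u => ∫ e, φ e ∂(μ u) := by
  have := Complex.continuous_re.comp (h.continuous_integral (complexBump φ hφ))
  refine this.congr fun u => ?_
  simp only [Function.comp, complexBump_apply]
  rw [integral_complex_ofReal, Complex.ofReal_re]

/-- A bump function equal to one on `K` dominates its indicator, and the integral of the bump is
continuous in the base point. -/
theorem exists_bound (h : IsContinuousSystem π μ) {K : Set E} (hK : IsCompact K) (x₀ : X) :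
    ∃ C : ℝ, 0 < C ∧ ∀ᶠ x in 𝓝 x₀, μ x K ≤ ENNReal.ofReal C := by
  obtain ⟨φ, hc, h1, -, hr⟩ := exists_bump hK isOpen_univ (subset_univ K)
  have hint : ∀ x, Integrable φ (μ x) := fun x =>
    have := h.finite_compacts x
    φ.continuous.integrable_of_hasCompactSupport hc
  refine ⟨(∫ e, φ e ∂(μ x₀)) + 1, ?_, ?_⟩
  · have : 0 ≤ ∫ e, φ e ∂(μ x₀) := integral_nonneg fun e => (hr e).1
    linarith
  · filter_upwards [(h.continuous_integral_real φ hc).continuousAt.eventually_lt_const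
      (lt_add_one (∫ e, φ e ∂(μ x₀)))] with x hx
    refine le_trans ?_ (ENNReal.ofReal_le_ofReal hx.le)
    rw [ofReal_integral_eq_lintegral_ofReal (hint x) (ae_of_all _ fun e => (hr e).1)]
    calc μ x K = ∫⁻ e, K.indicator 1 e ∂(μ x) := (lintegral_indicator_one hK.measurableSet).symm
      _ ≤ _ := lintegral_mono fun e => by
          by_cases he : e ∈ K
          · simp [he, h1 he]
          · simp [he]

/-- If functions `F i` on the fibres over `u i` converge continuously to `g`, with supports in a
common compact set, then they converge in mean. -/
theorem tendsto_lintegral_sub (h : IsContinuousSystem π μ) {I : Type*} {l : Filter I} {u : I → X}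
    {x₀ : X} (hu : Tendsto u l (𝓝 x₀)) {F : I → E → ℂ} {g : C_c(E, ℂ)}
    (hF : ∀ b, π b = x₀ → Tendsto (fun p : I × E => F p.1 p.2)
      ((l ×ˢ 𝓝 b) ⊓ 𝓟 {p | π p.2 = u p.1}) (𝓝 (g b)))
    {K : Set E} (hK : IsCompact K) (hFK : ∀ᶠ i in l, ∀ b, π b = u i → b ∉ K → F i b = 0) :
    Tendsto (fun i => ∫⁻ b, ‖F i b - g b‖ₑ ∂(μ (u i))) l (𝓝 0) := by
  set K' : Set E := K ∪ tsupport g with hK'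
  have hK'c : IsCompact K' := hK.union g.hasCompactSupport
  obtain ⟨C, hC, hCb⟩ := h.exists_bound hK'c x₀
  -- Uniform closeness on `K'` follows from closeness near each of its points. Over `x₀` that is the
  -- continuous convergence `hF`; near any other point the fibres over `u i` are eventually absent,
  -- as `X` is Hausdorff.
  have key : ∀ ε : ℝ, 0 < ε → ∀ᶠ i in l, ∀ b ∈ K', π b = u i → ‖F i b - g b‖ ≤ ε := by
    intro ε hε
    have h1 : ∀ b ∈ K', {p : I × E | π p.2 = u p.1 → ‖F p.1 p.2 - g p.2‖ ≤ ε} ∈ l ×ˢ 𝓝 b := by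
      intro b _
      by_cases hb : π b = x₀
      · have hg : Tendsto (fun p : I × E => g p.2) ((l ×ˢ 𝓝 b) ⊓ 𝓟 {p | π p.2 = u p.1})
            (𝓝 (g b)) :=
          (g.continuous.tendsto b).comp (tendsto_snd.mono_left inf_le_left)
        have h2 := ((hF b hb).sub hg).norm
        rw [sub_self, norm_zero] at h2
        have h3 := h2.eventually (ge_mem_nhds hε)
        rw [eventually_inf_principal] at h3
        exact h3
      · obtain ⟨V, W, hV, hW, hbV, hxW, hVW⟩ := t2_separation hb
        have hv : ∀ᶠ b' in 𝓝 b, π b' ∈ V :=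
          h.continuous_proj.continuousAt.eventually (hV.mem_nhds hbV)
        filter_upwards [prod_mem_prod (hu (hW.mem_nhds hxW)) hv] with p hp hpu
        exact absurd (hpu ▸ hp.1) (Set.disjoint_left.1 hVW hp.2)
    have h4 := hK'c.mem_prod_nhdsSet_of_forall h1
    obtain ⟨A, hA, B, hB, hAB⟩ := mem_prod_iff.1 h4
    filter_upwards [hA] with i hi b hb
    exact hAB (Set.mk_mem_prod hi (subset_of_mem_nhdsSet hB hb))
  rw [ENNReal.tendsto_nhds_zero]
  intro ε hε
  -- The integral will be at most `δ · μ(K') ≤ δ · C`.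
  obtain ⟨δ, hδ, hδε⟩ : ∃ δ : ℝ, 0 < δ ∧ ENNReal.ofReal δ * ENNReal.ofReal C ≤ ε := by
    by_cases ht : ε = ⊤
    · exact ⟨1, one_pos, ht ▸ le_top⟩
    · refine ⟨ε.toReal / C, div_pos (ENNReal.toReal_pos hε.ne' ht) hC, ?_⟩
      rw [← ENNReal.ofReal_mul (by positivity), div_mul_cancel₀ _ hC.ne', ENNReal.ofReal_toReal ht]
  filter_upwards [key δ hδ, hFK, hu.eventually hCb] with i h1 h2 h3
  have hle : ∀ᵐ b ∂(μ (u i)), ‖F i b - g b‖ₑ ≤ K'.indicator (fun _ => ENNReal.ofReal δ) b := by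
    filter_upwards [h.ae_proj_eq (u i)] with b hb
    by_cases hbK : b ∈ K'
    · rw [indicator_of_mem hbK, ← ofReal_norm]
      exact ENNReal.ofReal_le_ofReal (h1 b hbK hb)
    · rw [h2 b hb fun h => hbK (Or.inl h), image_eq_zero_of_notMem_tsupport fun h => hbK (Or.inr h)]
      simp
  calc _ ≤ ∫⁻ b, K'.indicator (fun _ => ENNReal.ofReal δ) b ∂(μ (u i)) := lintegral_mono_ae hle
    _ = ENNReal.ofReal δ * μ (u i) K' := lintegral_indicator_const hK'c.measurableSet _
    _ ≤ _ := (mul_le_mul_right h3 _).trans hδε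

theorem restrict_eq (h : IsContinuousSystem π μ) (u : X) :
    (μ u).restrict {e | π e = u} = μ u :=
  Measure.restrict_eq_self_of_ae_mem (h.ae_proj_eq u)

theorem aestronglyMeasurable (h : IsContinuousSystem π μ) {u : X} {F : E → ℂ}
    (hF : ContinuousOn F {e | π e = u}) : AEStronglyMeasurable F (μ u) := by
  have := hF.aestronglyMeasurable (μ := μ u)
    (isClosed_eq h.continuous_proj continuous_const).measurableSet
  rwa [h.restrict_eq] at this

theorem integrable_of_continuousOn (h : IsContinuousSystem π μ) {u : X} {F : E → ℂ}
    (hF : ContinuousOn F {e | π e = u}) {K : Set E} (hK : IsCompact K)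
    (h0 : ∀ b, π b = u → b ∉ K → F b = 0) : Integrable F (μ u) := by
  obtain ⟨g, hg⟩ := exists_compactlySupported_extension
    (isClosed_eq h.continuous_proj continuous_const) hK hF h0
  have := h.finite_compacts u
  refine (g.continuous.integrable_of_hasCompactSupport g.hasCompactSupport).congr ?_
  filter_upwards [h.ae_proj_eq u] with b hb using hg hb

/-- Continuity of integration over the fibres, in terms of continuous convergence. -/
theorem tendsto_integral (h : IsContinuousSystem π μ) {I : Type*} {l : Filter I} {u : I → X}
    {x₀ : X} (hu : Tendsto u l (𝓝 x₀)) {F : I → E → ℂ} {F₀ : E → ℂ}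
    (hc₀ : ContinuousOn F₀ {e | π e = x₀})
    (hc : ∀ᶠ i in l, ContinuousOn (F i) {e | π e = u i})
    (hF : ∀ b, π b = x₀ → Tendsto (fun p : I × E => F p.1 p.2)
      ((l ×ˢ 𝓝 b) ⊓ 𝓟 {p | π p.2 = u p.1}) (𝓝 (F₀ b)))
    {K : Set E} (hK : IsCompact K) (hFK : ∀ᶠ i in l, ∀ b, π b = u i → b ∉ K → F i b = 0)
    (hFK₀ : ∀ b, π b = x₀ → b ∉ K → F₀ b = 0) :
    Tendsto (fun i => ∫ b, F i b ∂(μ (u i))) l (𝓝 (∫ b, F₀ b ∂(μ x₀))) := by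
  -- Extending the limit function off its fibre gives one `g` that can be integrated over all
  -- fibres. Then `∫ F i = ∫ (F i - g) + ∫ g`, where the first term tends to zero and the second is
  -- continuous in the base point.
  obtain ⟨g, hg⟩ := exists_compactlySupported_extension
    (isClosed_eq h.continuous_proj continuous_const) hK hc₀ hFK₀
  have h1 := h.tendsto_lintegral_sub hu (g := g)
    (fun b hb => by rw [hg hb]; exact hF b hb) hK hFK
  have h2 : Tendsto (fun i => ∫ b, (F i b - g b) ∂(μ (u i))) l (𝓝 0) :=
    tendsto_zero_iff_enorm_tendsto_zero.2 (tendsto_of_tendsto_of_tendsto_of_le_of_le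
      tendsto_const_nhds h1 (fun _ => zero_le) fun i => enorm_integral_le_lintegral_enorm _)
  have h3 : Tendsto (fun i => ∫ b, g b ∂(μ (u i))) l (𝓝 (∫ b, F₀ b ∂(μ x₀))) := by
    have : ∫ b, F₀ b ∂(μ x₀) = ∫ b, g b ∂(μ x₀) := integral_congr_ae (by
      filter_upwards [h.ae_proj_eq x₀] with b hb using (hg hb).symm)
    rw [this]
    exact ((h.continuous_integral g).tendsto x₀).comp hu
  have h4 := h2.add h3
  rw [zero_add] at h4
  refine h4.congr' ?_
  filter_upwards [hc, hFK] with i hi hi'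
  have := h.finite_compacts (u i)
  have hgi : Integrable g (μ (u i)) :=
    g.continuous.integrable_of_hasCompactSupport g.hasCompactSupport
  rw [integral_sub (h.integrable_of_continuousOn hi hK hi') hgi, sub_add_cancel]

end IsContinuousSystem


noncomputable section

namespace GroupoidOn

/-! ### Left multiplication and Haar systems -/

section Lmul

variable {X G : Type*} {𝓗 : GroupoidOn X G}

open Classical in
/-- The product `γη` if it is defined, and `γ` otherwise. -/
def lmul (𝓗 : GroupoidOn X G) (γ η : G) : G := if h : 𝓗.s γ = 𝓗.r η then 𝓗.mul γ η h else γ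

theorem lmul_eq {γ η : G} (h : 𝓗.s γ = 𝓗.r η) : 𝓗.lmul γ η = 𝓗.mul γ η h := dif_pos h

-- Unconditional, because the default value of `lmul` is `γ` itself.
@[simp] theorem r_lmul (γ η : G) : 𝓗.r (𝓗.lmul γ η) = 𝓗.r γ := by
  unfold lmul
  split_ifs with h
  · exact 𝓗.r_mul _ _ _
  · rfl

theorem s_lmul {γ η : G} (h : 𝓗.s γ = 𝓗.r η) : 𝓗.s (𝓗.lmul γ η) = 𝓗.s η := by
  rw [lmul_eq h, 𝓗.s_mul]

theorem lmul_assoc {γ η ζ : G} (h : 𝓗.s γ = 𝓗.r η) (h' : 𝓗.s η = 𝓗.r ζ) :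
    𝓗.lmul (𝓗.lmul γ η) ζ = 𝓗.lmul γ (𝓗.lmul η ζ) := by
  rw [lmul_eq ((s_lmul h).trans h'), lmul_eq (h.trans (r_lmul η ζ).symm),
    mul_congr _ (lmul_eq h) rfl, 𝓗.mul_assoc γ η ζ h h']
  exact mul_congr _ rfl (lmul_eq h').symm

@[simp] theorem lmul_unit {γ : G} : 𝓗.lmul γ (𝓗.unit (𝓗.s γ)) = γ := by
  rw [lmul_eq (𝓗.r_unit _).symm, 𝓗.mul_unit]

theorem unit_lmul {γ : G} {x : X} (h : x = 𝓗.r γ) : 𝓗.lmul (𝓗.unit x) γ = γ := by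
  rw [lmul_eq ((𝓗.s_unit x).trans h)]
  exact unit_mul' _

theorem lmul_inv (γ : G) : 𝓗.lmul γ (𝓗.inv γ) = 𝓗.unit (𝓗.r γ) := by
  rw [lmul_eq (𝓗.r_inv γ).symm, 𝓗.mul_inv]

theorem inv_lmul (γ : G) : 𝓗.lmul (𝓗.inv γ) γ = 𝓗.unit (𝓗.s γ) := by
  rw [lmul_eq (𝓗.s_inv γ), 𝓗.inv_mul]

theorem inv_lmul_lmul {γ η : G} (h : 𝓗.s γ = 𝓗.r η) :
    𝓗.lmul (𝓗.inv γ) (𝓗.lmul γ η) = η := by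
  rw [← lmul_assoc (𝓗.s_inv γ) h, inv_lmul, unit_lmul h]

theorem lmul_inv_lmul {γ η : G} (h : 𝓗.r γ = 𝓗.r η) :
    𝓗.lmul γ (𝓗.lmul (𝓗.inv γ) η) = η := by
  rw [← lmul_assoc (𝓗.r_inv γ).symm ((𝓗.s_inv γ).trans h), lmul_inv, unit_lmul h]

theorem lmul_lmul_inv {γ η : G} (h : 𝓗.s γ = 𝓗.r η) :
    𝓗.lmul (𝓗.lmul γ η) (𝓗.inv η) = γ := by
  rw [lmul_assoc h (𝓗.r_inv η).symm, lmul_inv, ← h, lmul_unit]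

theorem lmul_lmul_inv' {γ η : G} (h : 𝓗.s γ = 𝓗.s η) :
    𝓗.lmul (𝓗.lmul γ (𝓗.inv η)) η = γ := by
  rw [lmul_assoc (h.trans (𝓗.r_inv η).symm) (𝓗.s_inv η), inv_lmul, ← h, lmul_unit]

variable [TopologicalSpace X] [TopologicalSpace G]

theorem t2Space_units [T2Space G] (h : 𝓗.IsTopological) : T2Space X :=
  T2Space.of_injective_continuous (f := 𝓗.unit)
    (Function.LeftInverse.injective (g := 𝓗.r) 𝓗.r_unit) h.continuous_unit

theorem continuousOn_lmul (h : 𝓗.IsTopological) :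
    ContinuousOn (fun p : G × G => 𝓗.lmul p.1 p.2) {p | 𝓗.s p.1 = 𝓗.r p.2} := by
  rw [continuousOn_iff_continuous_domRestrict]
  refine h.continuous_mul.congr fun p => ?_
  exact (lmul_eq p.2).symm

theorem tendsto_lmul (h : 𝓗.IsTopological) {I : Type*} {l : Filter I} {f g : I → G} {γ η : G}
    (hf : Tendsto f l (𝓝 γ)) (hg : Tendsto g l (𝓝 η)) (e : 𝓗.s γ = 𝓗.r η)
    (hfg : ∀ᶠ i in l, 𝓗.s (f i) = 𝓗.r (g i)) :
    Tendsto (fun i => 𝓗.lmul (f i) (g i)) l (𝓝 (𝓗.lmul γ η)) :=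
  (continuousOn_lmul h (γ, η) e).tendsto.comp
    (tendsto_nhdsWithin_iff.2 ⟨hf.prodMk_nhds hg, hfg⟩)

theorem continuousOn_lmul_left (h : 𝓗.IsTopological) (γ : G) :
    ContinuousOn (𝓗.lmul γ) {η | 𝓗.s γ = 𝓗.r η} :=
  (continuousOn_lmul h).comp (f := fun η => (γ, η)) (by fun_prop) fun _ hη => hη

theorem measurable_lmul [T2Space G] [MeasurableSpace G] [BorelSpace G] (h : 𝓗.IsTopological)
    (γ : G) : Measurable (𝓗.lmul γ) := by
  classical
  have := t2Space_units h
  have hS : IsClosed {η | 𝓗.s γ = 𝓗.r η} := isClosed_eq continuous_const h.continuous_r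
  have h1 := (continuousOn_lmul_left h γ).measurable_piecewise (g := fun _ => γ)
    continuousOn_const hS.measurableSet
  refine (congrArg Measurable (funext fun η => ?_)).mp h1
  by_cases hη : 𝓗.s γ = 𝓗.r η
  · exact Set.piecewise_eq_of_mem _ _ _ hη
  · exact (Set.piecewise_eq_of_notMem {η | 𝓗.s γ = 𝓗.r η} _ _ hη).trans
      (by unfold lmul; rw [dif_neg hη])

end Lmul

namespace IsHaarSystem

variable {X G : Type*} [TopologicalSpace X] [TopologicalSpace G] [LocallyCompactSpace G]
  [T2Space G] [SecondCountableTopology G] [MeasurableSpace G] [BorelSpace G]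
  {𝓗 : GroupoidOn X G} {μ : X → Measure G}

theorem isContinuousSystem (hμ : 𝓗.IsHaarSystem μ) (h : 𝓗.IsTopological) :
    IsContinuousSystem 𝓗.r μ where
  continuous_proj := h.continuous_r
  finite_compacts u := have := hμ.regular u; inferInstance
  ae_proj_eq u := by
    have := Measure.support_mem_ae (μ := μ u)
    rwa [hμ.support_eq u] at this
  continuous_integral := hμ.continuous_integral

theorem pos_of_isOpen (hμ : 𝓗.IsHaarSystem μ) {U : Set G} (hU : IsOpen U) {γ : G} (hγ : γ ∈ U)
    {u : X} (hu : 𝓗.r γ = u) : 0 < μ u U := by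
  have : γ ∈ (μ u).support := by rw [hμ.support_eq]; exact hu
  exact (Measure.mem_support_iff_forall γ).1 this U (hU.mem_nhds hγ)

/-- A bump function at `γ` has positive integral over the fibre of `r γ`, because the measure has
full support there. By continuity the integral stays positive for nearby units `u`, so the fibre
over `u` must meet the support of the bump. -/
theorem isOpenMap_r (hμ : 𝓗.IsHaarSystem μ) (h : 𝓗.IsTopological) : IsOpenMap 𝓗.r := by
  rw [isOpenMap_iff_nhds_le]
  intro γ V hV
  obtain ⟨U, hUV, hU, hγ⟩ := mem_nhds_iff.1 (mem_map.1 hV)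
  obtain ⟨φ, hc, h1, h0, hr⟩ := exists_bump (isCompact_singleton (x := γ)) hU
    (singleton_subset_iff.2 hγ)
  have hs := hμ.isContinuousSystem h
  have := t2Space_units h
  have := hs.finite_compacts (𝓗.r γ)
  have hpos : 0 < ∫ e, φ e ∂(μ (𝓗.r γ)) := by
    rw [integral_pos_iff_support_of_nonneg (fun e => (hr e).1)
      (φ.continuous.integrable_of_hasCompactSupport hc)]
    refine hμ.pos_of_isOpen (φ.continuous.isOpen_support) (γ := γ) ?_ rfl
    rw [Function.mem_support, h1 rfl]
    exact one_ne_zero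
  filter_upwards [(hs.continuous_integral_real φ hc).continuousAt.eventually_const_lt hpos]
    with u hu
  by_contra hcon
  refine hu.ne' (integral_eq_zero_of_ae ?_)
  filter_upwards [hs.ae_proj_eq u] with e he
  refine h0 e fun heU => hcon ?_
  have h2 : e ∈ 𝓗.r ⁻¹' V := hUV heU
  rw [← he]
  exact h2

/-- Left invariance as an equality of measures. -/
theorem map_lmul (hμ : 𝓗.IsHaarSystem μ) (h : 𝓗.IsTopological) (γ : G) :
    (μ (𝓗.s γ)).map (𝓗.lmul γ) = μ (𝓗.r γ) := by
  have hs := hμ.isContinuousSystem h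
  have := t2Space_units h
  have hm := measurable_lmul h γ
  have h1 := hs.finite_compacts (𝓗.r γ)
  have h3 := hs.finite_compacts (𝓗.s γ)
  -- Almost everywhere, the preimage of `K` under left multiplication by `γ` lies in the compact set
  -- `γ⁻¹(K ∩ r⁻¹(r γ))`.
  have h2 : IsFiniteMeasureOnCompacts ((μ (𝓗.s γ)).map (𝓗.lmul γ)) := by
    refine ⟨fun K hK => ?_⟩
    rw [Measure.map_apply hm hK.measurableSet]
    have hK' : IsCompact (K ∩ {η | 𝓗.r γ = 𝓗.r η}) :=
      hK.inter_right (isClosed_eq continuous_const h.continuous_r)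
    have hK'' : IsCompact (𝓗.lmul (𝓗.inv γ) '' (K ∩ {η | 𝓗.r γ = 𝓗.r η})) := by
      refine hK'.image_of_continuousOn ((continuousOn_lmul_left h _).mono ?_)
      rintro η ⟨-, hη⟩
      exact (𝓗.s_inv γ).trans hη
    refine lt_of_le_of_lt (measure_mono_ae ?_) hK''.measure_lt_top
    filter_upwards [hs.ae_proj_eq (𝓗.s γ)] with η hη hηK
    exact ⟨_, ⟨hηK, (r_lmul γ η).symm⟩, inv_lmul_lmul hη.symm⟩
  refine Measure.ext_of_integral_eq_on_compactlySupported fun f => ?_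
  rw [integral_map (f := fun x => f x) hm.aemeasurable f.continuous.aestronglyMeasurable]
  have h4 := hμ.left_invariant (complexBump ⟨f, f.continuous⟩ f.hasCompactSupport) γ
  have h5 : (∫ η, ((f (𝓗.lmul γ η) : ℝ) : ℂ) ∂(μ (𝓗.s γ))) = ∫ η, (f η : ℂ) ∂(μ (𝓗.r γ)) := by
    refine Eq.trans (integral_congr_ae ?_) h4
    filter_upwards [hs.ae_proj_eq (𝓗.s γ)] with η hη
    rw [dif_pos hη.symm, lmul_eq hη.symm]
    rfl
  rw [integral_complex_ofReal, integral_complex_ofReal] at h5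
  exact_mod_cast h5

end IsHaarSystem

end GroupoidOn
namespace GroupoidOn

variable {X G : Type*} [TopologicalSpace X] [TopologicalSpace G] {𝓖 : GroupoidOn X G}

/-! ### The isotropy groupoid and the quotient groupoid as topological groupoids -/

section Iso

theorem continuous_iso_val : Continuous fun a : 𝓖.Iso => a.1 := continuous_subtype_val

theorem isotropy_isTopological (h : 𝓖.IsTopological) : 𝓖.isotropy.IsTopological where
  continuous_r := h.continuous_r.comp continuous_subtype_val
  continuous_s := h.continuous_s.comp continuous_subtype_val
  continuous_unit := Continuous.subtype_mk h.continuous_unit _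
  continuous_inv := Continuous.subtype_mk (h.continuous_inv.comp continuous_subtype_val) _
  continuous_mul := by
    let P := {p : 𝓖.Iso × 𝓖.Iso // 𝓖.isotropy.s p.1 = 𝓖.isotropy.r p.2}
    have h0 : Continuous fun p : P => p.1 := continuous_subtype_val
    have h1 : Continuous fun p : P => (p.1.1.1, p.1.2.1) :=
      (continuous_iso_val.comp (continuous_fst.comp h0)).prodMk
        (continuous_iso_val.comp (continuous_snd.comp h0))
    exact Continuous.subtype_mk (h.continuous_mul.comp (h1.subtype_mk fun p => p.2)) _

theorem isClosedEmbedding_iso_val [T2Space G] (h : 𝓖.IsTopological) :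
    IsClosedEmbedding (Subtype.val : 𝓖.Iso → G) := by
  have := t2Space_units h
  exact (isClosed_eq h.continuous_r h.continuous_s).isClosedEmbedding_subtypeVal

instance [T2Space G] : T2Space 𝓖.Iso :=
  inferInstanceAs (T2Space {γ : G // 𝓖.r γ = 𝓖.s γ})

instance [SecondCountableTopology G] : SecondCountableTopology 𝓖.Iso :=
  inferInstanceAs (SecondCountableTopology ({γ | 𝓖.r γ = 𝓖.s γ} : Set G))

instance [T2Space G] [LocallyCompactSpace G] [h : 𝓖.IsTopological] :
    LocallyCompactSpace 𝓖.Iso :=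
  (isClosedEmbedding_iso_val h).locallyCompactSpace

end Iso

namespace IsoQuotient

theorem mk_eq_mk_iff {γ η : G} :
    (mk γ : 𝓖.IsoQuotient) = mk η ↔ 𝓖.r γ = 𝓖.r η ∧ 𝓖.s γ = 𝓖.s η :=
  ⟨fun h => ⟨congrArg r h, congrArg s h⟩, fun h => ext h.1 h.2⟩

theorem continuous_mk : Continuous (mk : G → 𝓖.IsoQuotient) := continuous_quot_mk

theorem mk_surjective : Function.Surjective (mk : G → 𝓖.IsoQuotient) := fun ρ => ⟨_, mk_out ρ⟩

theorem continuous_r (h : 𝓖.IsTopological) : Continuous (r : 𝓖.IsoQuotient → X) :=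
  h.continuous_r.quotient_lift _

theorem continuous_s (h : 𝓖.IsTopological) : Continuous (s : 𝓖.IsoQuotient → X) :=
  h.continuous_s.quotient_lift _

/-- If `ηb₀ = γ ∈ U` with `b₀ ∈ 𝓐`, openness of `r` on `𝓐` supplies, for each `η'` near `η`, some
`b` near `b₀` composable with it; then `η'b ∈ U`. -/
theorem isOpenMap_mk (h : 𝓖.IsTopological) (hA : IsOpenMap 𝓖.isotropy.r) :
    IsOpenMap (mk : G → 𝓖.IsoQuotient) := by
  intro U hU
  change IsOpen ((mk : G → 𝓖.IsoQuotient) ⁻¹' (mk '' U))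
  rw [isOpen_iff_mem_nhds]
  rintro η ⟨γ, hγ, e⟩
  obtain ⟨hr, hs⟩ := mk_eq_mk_iff.1 e
  have h1 : 𝓖.s (𝓖.inv η) = 𝓖.r γ := (𝓖.s_inv η).trans hr.symm
  let b₀ : 𝓖.Iso := ⟨𝓖.lmul (𝓖.inv η) γ, by rw [r_lmul, s_lmul h1, 𝓖.r_inv, hs]⟩
  have hb₀ : 𝓖.s η = 𝓖.r b₀.1 := ((r_lmul _ _).trans (𝓖.r_inv η)).symm
  have hm : 𝓖.lmul η b₀.1 = γ := lmul_inv_lmul hr.symm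
  have h2 := tendsto_lmul h (f := fun p : G × 𝓖.Iso => p.1) (g := fun p => p.2.1)
    (l := (𝓝 η ×ˢ 𝓝 b₀) ⊓ 𝓟 {p | 𝓖.s p.1 = 𝓖.r p.2.1}) (tendsto_fst.mono_left inf_le_left)
    ((continuous_subtype_val.tendsto b₀).comp (tendsto_snd.mono_left inf_le_left)) hb₀
    (mem_inf_of_right (mem_principal_self _))
  rw [hm] at h2
  have h3 := h2 (hU.mem_nhds hγ)
  rw [mem_map, mem_inf_principal] at h3
  obtain ⟨V, hV, W, hW, hVW⟩ := mem_prod_iff.1 h3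
  have h4 : 𝓖.isotropy.r '' W ∈ 𝓝 (𝓖.s η) := by
    rw [hb₀]; exact hA.image_mem_nhds hW
  filter_upwards [hV, h.continuous_s.continuousAt h4] with η' hη' hη''
  obtain ⟨b, hbW, hb⟩ := hη''
  have hb' : 𝓖.s η' = 𝓖.r b.1 := Eq.symm hb
  refine ⟨𝓖.lmul η' b.1, hVW (mk_mem_prod hη' hbW) hb', ?_⟩
  exact mk_eq_mk_iff.2 ⟨r_lmul _ _, by rw [s_lmul hb', hb', b.2]⟩

theorem isOpenQuotientMap_mk (h : 𝓖.IsTopological) (hA : IsOpenMap 𝓖.isotropy.r) :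
    IsOpenQuotientMap (mk : G → 𝓖.IsoQuotient) :=
  ⟨mk_surjective, continuous_mk, isOpenMap_mk h hA⟩

/-- `𝓡` is principal, so `(r, s)` is a continuous injection into the Hausdorff space `X × X`. -/
theorem t2Space [T2Space G] (h : 𝓖.IsTopological) : T2Space 𝓖.IsoQuotient := by
  have := t2Space_units h
  exact T2Space.of_injective_continuous (f := fun ρ : 𝓖.IsoQuotient => (r ρ, s ρ))
    (fun ρ σ e => ext (congrArg Prod.fst e) (congrArg Prod.snd e))
    ((continuous_r h).prodMk (continuous_s h))

theorem secondCountableTopology [SecondCountableTopology G] (h : 𝓖.IsTopological)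
    (hA : IsOpenMap 𝓖.isotropy.r) : SecondCountableTopology 𝓖.IsoQuotient :=
  (isOpenQuotientMap_mk h hA).isQuotientMap.secondCountableTopology (isOpenMap_mk h hA)

end IsoQuotient

theorem quotient_isTopological (h : 𝓖.IsTopological) (hA : IsOpenMap 𝓖.isotropy.r) :
    𝓖.quotient.IsTopological where
  continuous_r := IsoQuotient.continuous_r h
  continuous_s := IsoQuotient.continuous_s h
  continuous_unit := IsoQuotient.continuous_mk.comp h.continuous_unit
  continuous_inv := by
    rw [← (IsoQuotient.isOpenQuotientMap_mk h hA).continuous_comp_iff]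
    exact (IsoQuotient.continuous_mk.comp h.continuous_inv).congr fun γ =>
      (𝓖.quotient_inv_mk γ).symm
  continuous_mul := by
    have hq := IsoQuotient.isOpenQuotientMap_mk h hA
    -- The product of open quotient maps, restricted to a full preimage, is again a quotient map;
    -- continuity can thus be tested on composable pairs of `𝓖`.
    have h2 := (hq.prodMap hq).restrictPreimage
      {p : 𝓖.IsoQuotient × 𝓖.IsoQuotient | 𝓖.quotient.s p.1 = 𝓖.quotient.r p.2}
    refine h2.continuous_comp_iff.1 ?_
    exact (IsoQuotient.continuous_mk.comp h.continuous_mul).congr fun p =>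
      (𝓖.quotient_mul_mk p.1.1 p.1.2 p.2).symm

theorem quotient_isLocallyCompactHausdorff [T2Space G] [LocallyCompactSpace G]
    (h : 𝓖.IsTopological) (hA : IsOpenMap 𝓖.isotropy.r) :
    𝓖.quotient.IsLocallyCompactHausdorff where
  isTopological := quotient_isTopological h hA
  locallyCompactSpace := (IsoQuotient.isOpenQuotientMap_mk h hA).locallyCompactSpace
  t2Space := IsoQuotient.t2Space h

end GroupoidOn
namespace GroupoidOn

/-! ### The topology of the dual bundle -/

namespace Dual

variable {X G : Type*} [TopologicalSpace X] [TopologicalSpace G] {𝓖 : GroupoidOn X G}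
  {β : X → Measure 𝓖.Iso}

open Classical in
/-- The character `χ` of `ξ = (χ, u)`, extended by zero to all of `𝓐`. -/
def chi (ξ : 𝓖.Dual β) (a : 𝓖.Iso) : ℂ :=
  if h : 𝓖.r a.1 = ξ.base then (ξ.char ⟨a.1, h, a.2.symm.trans h⟩ : ℂ) else 0

theorem chi_of_eq (ξ : 𝓖.Dual β) {a : 𝓖.Iso} (h : 𝓖.r a.1 = ξ.base) :
    ξ.chi a = (ξ.char ⟨a.1, h, a.2.symm.trans h⟩ : ℂ) := dif_pos h

theorem eval_eq (ξ : 𝓖.Dual β) (f : C_c(𝓖.Iso, ℂ)) :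
    ξ.eval f = ∫ a, ξ.chi a * f a ∂(β ξ.base) := by
  refine integral_congr_ae (ae_of_all _ fun a => ?_)
  dsimp only [chi]
  split_ifs with h
  · rfl
  · rw [zero_mul]

theorem norm_chi (ξ : 𝓖.Dual β) {a : 𝓖.Iso} (h : 𝓖.r a.1 = ξ.base) : ‖ξ.chi a‖ = 1 := by
  rw [chi_of_eq ξ h, Circle.norm_coe]

theorem norm_chi_le (ξ : 𝓖.Dual β) (a : 𝓖.Iso) : ‖ξ.chi a‖ ≤ 1 := by
  by_cases h : 𝓖.r a.1 = ξ.base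
  · exact (ξ.norm_chi h).le
  · rw [chi, dif_neg h, norm_zero]; exact zero_le_one

theorem chi_lmul (ξ : 𝓖.Dual β) {a b : 𝓖.Iso} (ha : 𝓖.r a.1 = ξ.base) (hb : 𝓖.r b.1 = ξ.base) :
    ξ.chi (𝓖.isotropy.lmul a b) = ξ.chi a * ξ.chi b := by
  have h : 𝓖.isotropy.s a = 𝓖.isotropy.r b := a.2.symm.trans (ha.trans hb.symm)
  have hab : 𝓖.r (𝓖.isotropy.mul a b h).1 = ξ.base := (𝓖.r_mul _ _ _).trans ha
  rw [lmul_eq h, chi_of_eq ξ hab, chi_of_eq ξ ha, chi_of_eq ξ hb, ← Circle.coe_mul]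
  exact congrArg (fun z : Circle => (z : ℂ)) (map_mul ξ.char
    ⟨a.1, ha, a.2.symm.trans ha⟩ ⟨b.1, hb, b.2.symm.trans hb⟩)

theorem continuousOn_chi_fibre (ξ : 𝓖.Dual β) :
    ContinuousOn ξ.chi {a | 𝓖.isotropy.r a = ξ.base} := by
  rw [continuousOn_iff_continuous_domRestrict]
  have h1 : Continuous fun a : {a : 𝓖.Iso | 𝓖.isotropy.r a = ξ.base} => a.1.1 :=
    continuous_iso_val.comp continuous_subtype_val
  have h2 : Continuous fun a : {a : 𝓖.Iso | 𝓖.isotropy.r a = ξ.base} =>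
      (⟨a.1.1, a.2, a.1.2.symm.trans a.2⟩ : 𝓖.IsoGroup ξ.base) := h1.subtype_mk _
  have h3 : Continuous fun z : Circle => (z : ℂ) := by fun_prop
  exact (h3.comp (ξ.char.continuous_toFun.comp h2)).congr fun a =>
    (chi_of_eq ξ a.2).symm

theorem ext_chi {ξ η : 𝓖.Dual β} (hb : ξ.base = η.base)
    (h : ∀ a : 𝓖.Iso, 𝓖.r a.1 = ξ.base → ξ.chi a = η.chi a) : ξ = η := by
  obtain ⟨u, χ⟩ := ξ
  obtain ⟨v, ψ⟩ := η
  obtain rfl : u = v := hb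
  congr 1
  refine DFunLike.ext _ _ fun a => ?_
  have ha : 𝓖.r a.1 = u := a.2.1
  let a' : 𝓖.Iso := ⟨a.1, ha.trans a.2.2.symm⟩
  have h1 := (chi_of_eq (⟨u, χ⟩ : 𝓖.Dual β) (a := a') ha).symm.trans
    ((h a' ha).trans (chi_of_eq (⟨u, ψ⟩ : 𝓖.Dual β) (a := a') ha))
  exact Circle.coe_injective h1

theorem continuous_eval (f : C_c(𝓖.Iso, ℂ)) : Continuous fun ξ : 𝓖.Dual β => ξ.eval f :=
  have h : Continuous fun ξ : 𝓖.Dual β => (ξ.eval : C_c(𝓖.Iso, ℂ) → ℂ) := continuous_induced_dom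
  (continuous_apply f).comp h

section Haar

variable [SecondCountableTopology G] [LocallyCompactSpace G] [T2Space G] [h𝓖 : 𝓖.IsTopological]
  (hβ : 𝓖.isotropy.IsHaarSystem β)
include hβ

theorem continuousSystem : IsContinuousSystem 𝓖.isotropy.r β :=
  hβ.isContinuousSystem (isotropy_isTopological h𝓖)

/-- Substituting `b ↦ ab` turns the integrand into `χ(a) χ(b) f(b)`. This identity recovers a
character from its functional. -/
theorem integral_chi_translate (ξ : 𝓖.Dual β) {a : 𝓖.Iso} (ha : 𝓖.r a.1 = ξ.base)
    (f : C_c(𝓖.Iso, ℂ)) :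
    ∫ b, ξ.chi b * f (𝓖.isotropy.lmul (𝓖.isotropy.inv a) b) ∂(β ξ.base) = ξ.chi a * ξ.eval f := by
  have hH := isotropy_isTopological h𝓖
  have hs := continuousSystem hβ
  have := t2Space_units h𝓖
  have hsa : 𝓖.isotropy.s a = ξ.base := a.2.symm.trans ha
  have hra : 𝓖.isotropy.r a = ξ.base := ha
  have hm := hβ.map_lmul hH a
  rw [hsa, hra] at hm
  have hc : ContinuousOn (fun b => ξ.chi b * f (𝓖.isotropy.lmul (𝓖.isotropy.inv a) b))
      {b | 𝓖.isotropy.r b = ξ.base} := by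
    refine ξ.continuousOn_chi_fibre.mul (f.continuous.comp_continuousOn
      ((continuousOn_lmul_left hH _).mono fun b hb => ?_))
    exact (𝓖.isotropy.s_inv a).trans (hra.trans (Eq.symm hb))
  conv_lhs => rw [← hm]
  rw [integral_map (measurable_lmul hH a).aemeasurable (by
    rw [hm]; exact hs.aestronglyMeasurable hc), eval_eq, ← integral_const_mul]
  refine integral_congr_ae ?_
  filter_upwards [hs.ae_proj_eq ξ.base] with b hb
  rw [ξ.chi_lmul ha hb, inv_lmul_lmul (hsa.trans hb.symm), _root_.mul_assoc]

/-- For a bump `φ` at the unit and `g = φ · conj χ` on the fibre, the product `φ · g` evaluates to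
`∫ φ² > 0`. The second factor `φ` confines the support to `U`, since the extension `g` is
uncontrolled off the fibre. -/
theorem exists_eval_ne_zero (ξ : 𝓖.Dual β) {U : Set 𝓖.Iso} (hU : IsOpen U)
    (hξ : 𝓖.isotropy.unit ξ.base ∈ U) :
    ∃ f : C_c(𝓖.Iso, ℂ), (∀ a, a ∉ U → f a = 0) ∧ ξ.eval f ≠ 0 := by
  have hs := continuousSystem hβ
  have := t2Space_units h𝓖
  have := hs.finite_compacts ξ.base
  obtain ⟨φ, hc, h1, h0, hr⟩ := exists_bump (isCompact_singleton (x := 𝓖.isotropy.unit ξ.base)) hU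
    (singleton_subset_iff.2 hξ)
  obtain ⟨g, hg⟩ := exists_compactlySupported_extension
    (isClosed_eq hs.continuous_proj (continuous_const (y := ξ.base))) hc.isCompact
    (f := fun a => (φ a : ℂ) * star (ξ.chi a))
    (((Complex.continuous_ofReal.comp φ.continuous).continuousOn).mul
      ξ.continuousOn_chi_fibre.star)
    (fun a _ ha => by rw [image_eq_zero_of_notMem_tsupport ha]; simp)
  refine ⟨⟨⟨fun a => (φ a : ℂ) * g a, by fun_prop⟩, g.hasCompactSupport.mul_left⟩,
    fun a ha => ?_, ?_⟩
  · change (φ a : ℂ) * g a = 0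
    rw [h0 a ha]; simp
  · rw [eval_eq]
    change ∫ a, ξ.chi a * ((φ a : ℂ) * g a) ∂(β ξ.base) ≠ 0
    have h2 : ∫ a, ξ.chi a * ((φ a : ℂ) * g a) ∂(β ξ.base)
        = ∫ a, ((φ a * φ a : ℝ) : ℂ) ∂(β ξ.base) := by
      refine integral_congr_ae ?_
      filter_upwards [hs.ae_proj_eq ξ.base] with a ha
      rw [hg ha]
      have h3 : ξ.chi a * star (ξ.chi a) = 1 := by
        have := Complex.mul_conj' (ξ.chi a)
        rw [ξ.norm_chi ha] at this
        simpa using this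
      push_cast
      linear_combination ((φ a : ℂ) * (φ a : ℂ)) * h3
    rw [h2, integral_complex_ofReal, Complex.ofReal_ne_zero]
    refine ne_of_gt ?_
    have hφ : Continuous fun a => φ a * φ a := by fun_prop
    rw [integral_pos_iff_support_of_nonneg (fun a => mul_self_nonneg _)
      (hφ.integrable_of_hasCompactSupport hc.mul_left)]
    refine hβ.pos_of_isOpen hφ.isOpen_support (γ := 𝓖.isotropy.unit ξ.base) ?_
      (𝓖.isotropy.r_unit _)
    rw [Function.mem_support, h1 rfl]
    norm_num

/-- A function supported over `V` on which `ξ` does not vanish detects the base point: functionals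
near `ξ` do not vanish on it either, so they lie over `V`. -/
theorem continuous_base : Continuous (base : 𝓖.Dual β → X) := by
  have hs := continuousSystem hβ
  rw [continuous_iff_continuousAt]
  intro ξ W hW
  obtain ⟨V, hVW, hV, hξ⟩ := mem_nhds_iff.1 hW
  obtain ⟨f, hf, hne⟩ := exists_eval_ne_zero hβ ξ (hV.preimage hs.continuous_proj)
    (show 𝓖.isotropy.r _ ∈ V by rwa [𝓖.isotropy.r_unit])
  rw [mem_map]
  filter_upwards [(continuous_eval f).continuousAt.eventually_ne hne] with η hη
  by_contra hcon
  refine hη ?_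
  rw [eval_eq]
  refine integral_eq_zero_of_ae ?_
  filter_upwards [hs.ae_proj_eq η.base] with a ha
  rw [hf a fun h => hcon (hVW (by rw [← ha]; exact h)), mul_zero]
  rfl

/-- Translates of `f` by arrows near `a` are supported in a common compact set. -/
theorem exists_compact_translate (f : C_c(𝓖.Iso, ℂ)) (a : 𝓖.Iso) :
    ∃ K : Set 𝓖.Iso, IsCompact K ∧ ∀ᶠ a' in 𝓝 a, ∀ b, 𝓖.r b.1 = 𝓖.r a'.1 → b ∉ K →
      f (𝓖.isotropy.lmul (𝓖.isotropy.inv a') b) = 0 := by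
  have hH := isotropy_isTopological h𝓖
  have := t2Space_units h𝓖
  obtain ⟨N, hN, hNa⟩ := exists_compact_mem_nhds a
  refine ⟨(fun p : 𝓖.Iso × 𝓖.Iso => 𝓖.isotropy.lmul p.1 p.2) ''
    (N ×ˢ tsupport f ∩ {p | 𝓖.isotropy.s p.1 = 𝓖.isotropy.r p.2}), ?_, ?_⟩
  · refine ((hN.prod f.hasCompactSupport).inter_right (isClosed_eq ?_ ?_)).image_of_continuousOn
      ((continuousOn_lmul hH).mono inter_subset_right)
    · exact hH.continuous_s.comp continuous_fst
    · exact hH.continuous_r.comp continuous_snd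
  · filter_upwards [hNa] with a' ha' b hb hbK
    by_contra hne
    refine hbK ⟨(a', 𝓖.isotropy.lmul (𝓖.isotropy.inv a') b), ⟨⟨ha', ?_⟩, ?_⟩, ?_⟩
    · exact subset_tsupport _ hne
    · exact ((r_lmul _ _).trans (𝓖.isotropy.r_inv a')).symm
    · exact lmul_inv_lmul (Eq.symm hb)

/-- If the functionals `ξ i` converge pointwise to a nonzero limit, then the characters converge
continuously. -/
theorem exists_tendsto_chi {I : Type*} {l : Filter I} {ξ : I → 𝓖.Dual β}
    (hL : ∀ g, ∃ z, Tendsto (fun i => (ξ i).eval g) l (𝓝 z))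
    {f : C_c(𝓖.Iso, ℂ)} {c : ℂ} (hc : c ≠ 0) (hf : Tendsto (fun i => (ξ i).eval f) l (𝓝 c))
    (a : 𝓖.Iso) :
    ∃ z, Tendsto (fun p : I × 𝓖.Iso => (ξ p.1).chi p.2)
      ((l ×ˢ 𝓝 a) ⊓ 𝓟 {p | 𝓖.r p.2.1 = (ξ p.1).base}) (𝓝 z) := by
  have hH := isotropy_isTopological h𝓖
  have hs := continuousSystem hβ
  have := t2Space_units h𝓖
  obtain ⟨K, hK, hKa⟩ := exists_compact_translate hβ f a
  have hcont : ∀ a' : 𝓖.Iso, ContinuousOn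
      (fun b => f (𝓖.isotropy.lmul (𝓖.isotropy.inv a') b)) {b | 𝓖.isotropy.r b = 𝓖.r a'.1} :=
    fun a' => f.continuous.comp_continuousOn ((continuousOn_lmul_left hH _).mono fun b hb =>
      (𝓖.isotropy.s_inv a').trans (Eq.symm hb))
  -- `g` extends `b ↦ f(a⁻¹b)` from the fibre over `r a`, so that the limit of the functionals on
  -- `g` is available.
  obtain ⟨g, hg⟩ := exists_compactlySupported_extension
    (isClosed_eq hs.continuous_proj (continuous_const (y := 𝓖.r a.1))) hK (hcont a)
    (fun b hb hbK => hKa.self_of_nhds b hb hbK)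
  obtain ⟨z, hz⟩ := hL g
  refine ⟨z / c, ?_⟩
  set l' := (l ×ˢ 𝓝 a) ⊓ 𝓟 {p : I × 𝓖.Iso | 𝓖.r p.2.1 = (ξ p.1).base} with hl'
  have hl1 : Tendsto (fun p : I × 𝓖.Iso => p.1) l' l := tendsto_fst.mono_left inf_le_left
  have hl2 : Tendsto (fun p : I × 𝓖.Iso => p.2) l' (𝓝 a) := tendsto_snd.mono_left inf_le_left
  have hl3 : ∀ᶠ p in l', 𝓖.r p.2.1 = (ξ p.1).base := mem_inf_of_right (mem_principal_self _)
  have h1 : Tendsto (fun p : I × 𝓖.Iso =>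
      ∫⁻ b, ‖f (𝓖.isotropy.lmul (𝓖.isotropy.inv p.2) b) - g b‖ₑ ∂(β (𝓖.isotropy.r p.2)))
      l' (𝓝 0) := by
    refine hs.tendsto_lintegral_sub
      (F := fun (p : I × 𝓖.Iso) b => f (𝓖.isotropy.lmul (𝓖.isotropy.inv p.2) b))
      (u := fun p : I × 𝓖.Iso => 𝓖.isotropy.r p.2) (x₀ := 𝓖.r a.1)
      ((hs.continuous_proj.tendsto a).comp hl2) ?_ hK (hl2.eventually hKa)
    intro b hb
    rw [hg hb]
    refine (f.continuous.tendsto _).comp (tendsto_lmul hH ?_ ?_ ?_ ?_)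
    · exact (hH.continuous_inv.tendsto a).comp (hl2.comp (tendsto_fst.mono_left inf_le_left))
    · exact tendsto_snd.mono_left inf_le_left
    · exact (𝓖.isotropy.s_inv a).trans (Eq.symm hb)
    · refine eventually_inf_principal.2 (Eventually.of_forall fun p hp => ?_)
      exact (𝓖.isotropy.s_inv _).trans (Eq.symm hp)
  -- By the translation identity the difference is the integral of `χ(b) (f(a'⁻¹b) - g(b))`, bounded
  -- by the mean distance in `h1` because `|χ| ≤ 1`.
  have h2 : Tendsto (fun p : I × 𝓖.Iso => (ξ p.1).chi p.2 * (ξ p.1).eval f - (ξ p.1).eval g)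
      l' (𝓝 0) := by
    rw [tendsto_zero_iff_enorm_tendsto_zero]
    refine tendsto_of_tendsto_of_tendsto_of_le_of_le' tendsto_const_nhds h1
      (Eventually.of_forall fun _ => zero_le) ?_
    filter_upwards [hl3, hl2.eventually hKa] with p hp hpK
    have hpr : 𝓖.isotropy.r p.2 = (ξ p.1).base := hp
    rw [← integral_chi_translate hβ (ξ p.1) hp f, eval_eq, ← integral_sub, hpr]
    · refine (enorm_integral_le_lintegral_enorm _).trans (lintegral_mono fun b => ?_)
      rw [← mul_sub, enorm_mul]
      refine mul_le_of_le_one_left zero_le ?_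
      rw [← ofReal_norm]
      exact ENNReal.ofReal_le_one.2 (norm_chi_le _ _)
    · refine hs.integrable_of_continuousOn ((ξ p.1).continuousOn_chi_fibre.mul ?_) hK
        fun b hb hbK => ?_
      · have := hcont p.2
        rwa [hp] at this
      · rw [hpK b (Eq.trans hb hp.symm) hbK, mul_zero]
    · refine hs.integrable_of_continuousOn ((ξ p.1).continuousOn_chi_fibre.mul
        g.continuous.continuousOn) g.hasCompactSupport fun b hb hbK => ?_
      rw [image_eq_zero_of_notMem_tsupport hbK, mul_zero]
  have h3 := (h2.add (hz.comp hl1)).div (hf.comp hl1) hc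
  rw [zero_add] at h3
  refine h3.congr' ?_
  filter_upwards [(hf.comp hl1).eventually_ne hc] with p hp
  simp only [Function.comp, Pi.div_apply] at hp ⊢
  rw [sub_add_cancel, mul_div_cancel_right₀ _ hp]

/-- Joint continuity of `(ξ, a) ↦ χ(a)`. -/
theorem continuousOn_chi :
    ContinuousOn (fun p : 𝓖.Dual β × 𝓖.Iso => p.1.chi p.2) {p | 𝓖.r p.2.1 = p.1.base} := by
  rintro ⟨ξ, a⟩ ha
  obtain ⟨f, -, hf⟩ := exists_eval_ne_zero hβ ξ isOpen_univ (mem_univ _)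
  obtain ⟨z, hz⟩ := exists_tendsto_chi hβ (ξ := fun ξ => ξ)
    (fun g => ⟨_, (continuous_eval g).tendsto ξ⟩) hf ((continuous_eval f).tendsto ξ) a
  rw [ContinuousWithinAt, nhdsWithin, nhds_prod_eq]
  -- The point itself belongs to the filter's range, which forces the limit `z` to be `χ(a)`.
  have hp : pure (ξ, a) ≤ (𝓝 ξ ×ˢ 𝓝 a) ⊓ 𝓟 {p : 𝓖.Dual β × 𝓖.Iso | 𝓖.r p.2.1 = p.1.base} := by
    rw [← nhds_prod_eq]
    exact le_inf (pure_le_nhds _) (le_principal_iff.2 ha)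
  have : z = ξ.chi a := tendsto_nhds_unique (hz.mono_left hp)
    (tendsto_pure_nhds (fun p : 𝓖.Dual β × 𝓖.Iso => p.1.chi p.2) (ξ, a))
  rw [this] at hz
  exact hz

/-- Convergence in the dual bundle follows from continuous convergence of the characters. -/
theorem tendsto_of_tendsto_chi {I : Type*} {l : Filter I} {ξ : I → 𝓖.Dual β} {ξ₀ : 𝓖.Dual β}
    (hu : Tendsto (fun i => (ξ i).base) l (𝓝 ξ₀.base))
    (h : ∀ a : 𝓖.Iso, 𝓖.r a.1 = ξ₀.base → Tendsto (fun p : I × 𝓖.Iso => (ξ p.1).chi p.2)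
      ((l ×ˢ 𝓝 a) ⊓ 𝓟 {p | 𝓖.r p.2.1 = (ξ p.1).base}) (𝓝 (ξ₀.chi a))) :
    Tendsto ξ l (𝓝 ξ₀) := by
  have hs := continuousSystem hβ
  have := t2Space_units h𝓖
  rw [nhds_induced, tendsto_comap_iff, tendsto_pi_nhds]
  intro f
  simp only [Function.comp, eval_eq]
  refine hs.tendsto_integral hu (F := fun i a => (ξ i).chi a * f a) (F₀ := fun a => ξ₀.chi a * f a)
    (ξ₀.continuousOn_chi_fibre.mul f.continuous.continuousOn)
    (Eventually.of_forall fun i => (ξ i).continuousOn_chi_fibre.mul f.continuous.continuousOn)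
    (fun a ha => (h a ha).mul ?_) f.hasCompactSupport ?_ ?_
  · exact (f.continuous.tendsto a).comp (tendsto_snd.mono_left inf_le_left)
  · exact Eventually.of_forall fun i a _ ha => by
      rw [image_eq_zero_of_notMem_tsupport ha, mul_zero]
  · exact fun a _ ha => by rw [image_eq_zero_of_notMem_tsupport ha, mul_zero]

/-- Only injectivity of `ξ ↦ ξ.eval` is at stake. Equal functionals are topologically inseparable,
and the continuous maps to the base and to the values `χ(a)` cannot separate such points. -/
theorem t2Space : T2Space (𝓖.Dual β) := by
  have := t2Space_units h𝓖
  refine T2Space.of_injective_continuous (f := fun ξ : 𝓖.Dual β => ξ.eval) (fun ξ η e => ?_)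
    continuous_induced_dom
  have hin : Inseparable ξ η := (IsInducing.mk rfl).inseparable_iff.1 (Inseparable.of_eq e)
  have hb : ξ.base = η.base := (hin.map (continuous_base hβ)).eq
  refine ext_chi hb fun a ha => ?_
  have h1 := continuousOn_iff_continuous_domRestrict.1 (continuousOn_chi hβ)
  have h2 : Inseparable (⟨(ξ, a), ha⟩ : {p : 𝓖.Dual β × 𝓖.Iso | 𝓖.r p.2.1 = p.1.base})
      ⟨(η, a), ha.trans hb⟩ :=
    IsInducing.subtypeVal.inseparable_iff.1 (hin.prod (Inseparable.refl a))
  exact (h2.map h1).eq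

end Haar

end Dual

end GroupoidOn
namespace GroupoidOn

/-! ### Local compactness of the dual bundle -/

namespace Dual

variable {X G : Type*} [TopologicalSpace X] [TopologicalSpace G] {𝓖 : GroupoidOn X G}
  {β : X → Measure 𝓖.Iso}

section Haar

variable [SecondCountableTopology G] [LocallyCompactSpace G] [T2Space G] [h𝓖 : 𝓖.IsTopological]
  (hβ : 𝓖.isotropy.IsHaarSystem β)
include hβ

/-- The functionals `ξ ↦ ξ(g)` are bounded over a neighbourhood of every unit. -/
theorem exists_norm_eval_le (g : C_c(𝓖.Iso, ℂ)) (u : X) :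
    ∃ C : ℝ, ∀ᶠ v in 𝓝 u, ∀ ξ : 𝓖.Dual β, ξ.base = v → ‖ξ.eval g‖ ≤ C := by
  have hs := continuousSystem hβ
  have := t2Space_units h𝓖
  obtain ⟨C, hC, hCb⟩ := hs.exists_bound g.hasCompactSupport u
  obtain ⟨M, hM⟩ := g.hasCompactSupport.exists_bound_of_continuous g.continuous
  refine ⟨M * C, ?_⟩
  filter_upwards [hCb] with v hv ξ hξ
  have hM0 : 0 ≤ M := (norm_nonneg _).trans (hM (𝓖.isotropy.unit v))
  have h1 : ‖ξ.eval g‖ₑ ≤ ENNReal.ofReal M * ENNReal.ofReal C := by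
    rw [eval_eq]
    refine (enorm_integral_le_lintegral_enorm _).trans ?_
    calc _ ≤ ∫⁻ a, (tsupport g).indicator (fun _ => ENNReal.ofReal M) a ∂(β ξ.base) := by
          refine lintegral_mono fun a => ?_
          by_cases ha : a ∈ tsupport g
          · rw [indicator_of_mem ha, ← ofReal_norm, norm_mul]
            exact ENNReal.ofReal_le_ofReal ((mul_le_of_le_one_left (norm_nonneg _)
              (norm_chi_le _ _)).trans (hM a))
          · rw [image_eq_zero_of_notMem_tsupport ha]; simp
      _ = ENNReal.ofReal M * β ξ.base (tsupport g) :=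
          lintegral_indicator_const g.hasCompactSupport.measurableSet _
      _ ≤ _ := by rw [hξ]; exact mul_le_mul_right hv _
  rw [← ENNReal.ofReal_mul hM0, ← ofReal_norm] at h1
  exact (ENNReal.ofReal_le_ofReal_iff (by positivity)).1 h1

/-- Openness of `r` on `𝓐` provides arrows near `a` and `b` over the same unit `u i`. Without it,
limits along these filters would not be unique. -/
theorem neBot_inf_principal {I : Type*} {l : Filter I} [l.NeBot] {u : I → X} {a b : 𝓖.Iso}
    (hu : Tendsto u l (𝓝 (𝓖.r a.1))) (hab : 𝓖.r a.1 = 𝓖.r b.1) :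
    ((l ×ˢ (𝓝 a ×ˢ 𝓝 b)) ⊓ 𝓟 {p : I × (𝓖.Iso × 𝓖.Iso) |
      𝓖.r p.2.1.1 = u p.1 ∧ 𝓖.r p.2.2.1 = u p.1}).NeBot := by
  have hr : IsOpenMap 𝓖.isotropy.r := hβ.isOpenMap_r (isotropy_isTopological h𝓖)
  rw [inf_principal_neBot_iff]
  intro U hU
  obtain ⟨V, hV, W, hW, hVW⟩ := mem_prod_iff.1 hU
  obtain ⟨A, hA, B, hB, hAB⟩ := mem_prod_iff.1 hW
  have h1 : 𝓖.isotropy.r '' A ∈ 𝓝 (𝓖.r a.1) := hr.image_mem_nhds hA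
  have h2 : 𝓖.isotropy.r '' B ∈ 𝓝 (𝓖.r a.1) := by rw [hab]; exact hr.image_mem_nhds hB
  obtain ⟨i, hiV, ⟨a', ha', e⟩, ⟨b', hb', e'⟩⟩ :=
    (Filter.nonempty_of_mem (inter_mem hV (inter_mem (hu h1) (hu h2))))
  exact ⟨(i, (a', b')), hVW (mk_mem_prod hiV (hAB (mk_mem_prod ha' hb'))), e, e'⟩

/-- A continuous-convergence limit of characters is a character. -/
theorem exists_tendsto {I : Type*} {l : Filter I} [l.NeBot] {ξ : I → 𝓖.Dual β} {u₀ : X}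
    (hu : Tendsto (fun i => (ξ i).base) l (𝓝 u₀))
    (h : ∀ a : 𝓖.Iso, ∃ z, Tendsto (fun p : I × 𝓖.Iso => (ξ p.1).chi p.2)
      ((l ×ˢ 𝓝 a) ⊓ 𝓟 {p | 𝓖.r p.2.1 = (ξ p.1).base}) (𝓝 z)) :
    ∃ ξ₀ : 𝓖.Dual β, Tendsto ξ l (𝓝 ξ₀) := by
  have hH := isotropy_isTopological h𝓖
  choose z hz using h
  have hne : ∀ a : 𝓖.Iso, 𝓖.r a.1 = u₀ →
      ((l ×ˢ 𝓝 a) ⊓ 𝓟 {p : I × 𝓖.Iso | 𝓖.r p.2.1 = (ξ p.1).base}).NeBot := by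
    intro a ha
    have h1 := neBot_inf_principal hβ (a := a) (b := a) (ha.symm ▸ hu) rfl
    have h2 : Tendsto (fun p : I × (𝓖.Iso × 𝓖.Iso) => (p.1, p.2.1))
        ((l ×ˢ (𝓝 a ×ˢ 𝓝 a)) ⊓ 𝓟 {p : I × (𝓖.Iso × 𝓖.Iso) |
          𝓖.r p.2.1.1 = (ξ p.1).base ∧ 𝓖.r p.2.2.1 = (ξ p.1).base})
        ((l ×ˢ 𝓝 a) ⊓ 𝓟 {p : I × 𝓖.Iso | 𝓖.r p.2.1 = (ξ p.1).base}) := by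
      refine tendsto_inf.2 ⟨Tendsto.mono_left ?_ inf_le_left, tendsto_principal.2 ?_⟩
      · exact tendsto_fst.prodMk (tendsto_fst.comp tendsto_snd)
      · exact eventually_inf_principal.2 (Eventually.of_forall fun p hp => hp.1)
    exact h2.neBot
  have hnorm : ∀ a : 𝓖.Iso, 𝓖.r a.1 = u₀ → ‖z a‖ = 1 := by
    intro a ha
    have := hne a ha
    refine tendsto_nhds_unique (hz a).norm (tendsto_const_nhds.congr' ?_)
    exact eventually_inf_principal.2 (Eventually.of_forall fun p hp => ((ξ p.1).norm_chi hp).symm)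
  have hmul : ∀ a b : 𝓖.Iso, 𝓖.r a.1 = u₀ → 𝓖.r b.1 = u₀ →
      z (𝓖.isotropy.lmul a b) = z a * z b := by
    intro a b ha hb
    have hab : 𝓖.isotropy.s a = 𝓖.isotropy.r b := a.2.symm.trans (ha.trans hb.symm)
    have := neBot_inf_principal hβ (a := a) (b := b) (ha.symm ▸ hu) (ha.trans hb.symm)
    set m := (l ×ˢ (𝓝 a ×ˢ 𝓝 b)) ⊓ 𝓟 {p : I × (𝓖.Iso × 𝓖.Iso) |
      𝓖.r p.2.1.1 = (ξ p.1).base ∧ 𝓖.r p.2.2.1 = (ξ p.1).base} with hm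
    have m1 : Tendsto (fun p : I × (𝓖.Iso × 𝓖.Iso) => p.1) m l :=
      tendsto_fst.mono_left inf_le_left
    have m2 : Tendsto (fun p : I × (𝓖.Iso × 𝓖.Iso) => p.2.1) m (𝓝 a) :=
      (tendsto_fst.comp tendsto_snd).mono_left inf_le_left
    have m3 : Tendsto (fun p : I × (𝓖.Iso × 𝓖.Iso) => p.2.2) m (𝓝 b) :=
      (tendsto_snd.comp tendsto_snd).mono_left inf_le_left
    have m4 : ∀ᶠ p in m, 𝓖.r p.2.1.1 = (ξ p.1).base ∧ 𝓖.r p.2.2.1 = (ξ p.1).base :=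
      mem_inf_of_right (mem_principal_self _)
    have e1 : Tendsto (fun p : I × (𝓖.Iso × 𝓖.Iso) => (ξ p.1).chi p.2.1) m (𝓝 (z a)) :=
      (hz a).comp (f := fun p : I × (𝓖.Iso × 𝓖.Iso) => (p.1, p.2.1))
        (tendsto_inf.2 ⟨m1.prodMk m2, tendsto_principal.2 (m4.mono fun p hp => hp.1)⟩)
    have e2 : Tendsto (fun p : I × (𝓖.Iso × 𝓖.Iso) => (ξ p.1).chi p.2.2) m (𝓝 (z b)) :=
      (hz b).comp (f := fun p : I × (𝓖.Iso × 𝓖.Iso) => (p.1, p.2.2))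
        (tendsto_inf.2 ⟨m1.prodMk m3, tendsto_principal.2 (m4.mono fun p hp => hp.2)⟩)
    have e3 : Tendsto (fun p : I × (𝓖.Iso × 𝓖.Iso) => (ξ p.1).chi (𝓖.isotropy.lmul p.2.1 p.2.2)) m
        (𝓝 (z (𝓖.isotropy.lmul a b))) := by
      refine (hz _).comp (f := fun p : I × (𝓖.Iso × 𝓖.Iso) =>
        (p.1, 𝓖.isotropy.lmul p.2.1 p.2.2)) (tendsto_inf.2 ⟨m1.prodMk ?_, tendsto_principal.2
          (m4.mono fun p hp => (r_lmul (𝓗 := 𝓖.isotropy) p.2.1 p.2.2).trans hp.1)⟩)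
      exact tendsto_lmul hH m2 m3 hab (m4.mono fun p hp => p.2.1.2.symm.trans (hp.1.trans hp.2.symm))
    exact tendsto_nhds_unique e3 ((e1.mul e2).congr' (m4.mono fun p hp =>
      ((ξ p.1).chi_lmul hp.1 hp.2).symm))
  have hcont : ContinuousOn z {a | 𝓖.r a.1 = u₀} := by
    -- Closed neighbourhoods pass to the limit: if nearby values of the approximating characters lie
    -- in a closed `V`, so does `z a'` for `a'` near `a` in the fibre.
    intro a ha
    rw [ContinuousWithinAt, (closed_nhds_basis (z a)).tendsto_right_iff]
    rintro V ⟨hV, hVc⟩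
    have h1 := (hz a) hV
    rw [mem_map, mem_inf_principal] at h1
    obtain ⟨A, hA, B, hB, hAB⟩ := mem_prod_iff.1 h1
    rw [eventually_nhdsWithin_iff]
    filter_upwards [eventually_mem_nhds_iff.2 hB] with a' ha' ha'u
    have := hne a' ha'u
    refine hVc.mem_of_tendsto (hz a') (eventually_inf_principal.2 ?_)
    filter_upwards [prod_mem_prod hA ha'] with p hp hpr using hAB hp hpr
  let toIso : 𝓖.IsoGroup u₀ → 𝓖.Iso := fun x => ⟨x.1, x.2.1.trans x.2.2.symm⟩
  have hiso : Continuous toIso := Continuous.subtype_mk continuous_subtype_val _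
  have hr : ∀ x, 𝓖.r (toIso x).1 = u₀ := fun x => x.2.1
  let c : 𝓖.IsoGroup u₀ → Circle := fun x => ⟨z (toIso x), mem_sphere_zero_iff_norm.2 (hnorm _ (hr x))⟩
  have hcc : Continuous c := Continuous.subtype_mk (hcont.comp_continuous hiso hr) _
  have hcm : ∀ x y, c (x * y) = c x * c y := by
    intro x y
    refine Circle.coe_injective ?_
    have e : toIso (x * y) = 𝓖.isotropy.lmul (toIso x) (toIso y) :=
      (lmul_eq (𝓗 := 𝓖.isotropy) (γ := toIso x) (η := toIso y) (x.2.2.trans y.2.1.symm)).symm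
    exact (congrArg z e).trans (hmul _ _ (hr x) (hr y))
  refine ⟨⟨u₀, ⟨MonoidHom.mk' c hcm, hcc⟩⟩, tendsto_of_tendsto_chi hβ hu fun a ha => ?_⟩
  have e : chi (β := β) ⟨u₀, ⟨MonoidHom.mk' c hcm, hcc⟩⟩ a = z a := chi_of_eq _ ha
  rw [e]
  exact hz a

/-- Along an ultrafilter on this set the base points converge, as they stay in the compact set
`r(supp f)`, and every `ξ(g)` converges, being bounded. The lower bound `δ` keeps the limit of
`ξ(f)` away from zero, so the characters converge continuously and their limit is a character. -/
theorem isCompact_le_norm_eval (f : C_c(𝓖.Iso, ℂ)) {δ : ℝ} (hδ : 0 < δ) :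
    IsCompact {ξ : 𝓖.Dual β | δ ≤ ‖ξ.eval f‖} := by
  have hs := continuousSystem hβ
  have := t2Space_units h𝓖
  rw [isCompact_iff_ultrafilter_le_nhds]
  intro l hl
  have hmem : {ξ : 𝓖.Dual β | δ ≤ ‖ξ.eval f‖} ∈ (l : Filter (𝓖.Dual β)) := le_principal_iff.1 hl
  have hb : ∀ ξ : 𝓖.Dual β, δ ≤ ‖ξ.eval f‖ → ξ.base ∈ 𝓖.isotropy.r '' tsupport f := by
    intro ξ hξ
    by_contra hcon
    have : ξ.eval f = 0 := by
      rw [eval_eq]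
      refine integral_eq_zero_of_ae ?_
      filter_upwards [hs.ae_proj_eq ξ.base] with a ha
      rw [image_eq_zero_of_notMem_tsupport fun h => hcon ⟨a, h, ha⟩, mul_zero]
      rfl
    rw [this, norm_zero] at hξ
    exact absurd hδ hξ.not_gt
  obtain ⟨u₀, -, hu₀⟩ := (f.hasCompactSupport.isCompact.image
    hs.continuous_proj).ultrafilter_le_nhds (l.map base) (le_principal_iff.2 (mem_map.2
      (mem_of_superset hmem hb)))
  have hu : Tendsto (base : 𝓖.Dual β → X) l (𝓝 u₀) := hu₀
  have hL : ∀ g : C_c(𝓖.Iso, ℂ), ∃ z, Tendsto (fun ξ : 𝓖.Dual β => ξ.eval g) l (𝓝 z) := by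
    intro g
    obtain ⟨C, hC⟩ := exists_norm_eval_le hβ g u₀
    have hgC : ∀ᶠ ξ : 𝓖.Dual β in l, ξ.eval g ∈ Metric.closedBall (0 : ℂ) C := by
      filter_upwards [hu.eventually hC] with ξ hξ
      exact mem_closedBall_zero_iff.2 (hξ ξ rfl)
    obtain ⟨z, -, hz⟩ := (isCompact_closedBall (0 : ℂ) C).ultrafilter_le_nhds
      (l.map fun ξ : 𝓖.Dual β => ξ.eval g) (le_principal_iff.2 hgC)
    exact ⟨z, hz⟩
  obtain ⟨c, hc⟩ := hL f
  have hcδ : δ ≤ ‖c‖ := ge_of_tendsto hc.norm hmem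
  have hc0 : c ≠ 0 := fun h => absurd hδ (by rw [h, norm_zero] at hcδ; exact hcδ.not_gt)
  obtain ⟨ξ₀, hξ₀⟩ := exists_tendsto hβ (l := (l : Filter (𝓖.Dual β))) (ξ := fun ξ => ξ) hu
    (exists_tendsto_chi hβ hL hc0 hc)
  refine ⟨ξ₀, ?_, hξ₀⟩
  have : ξ₀.eval f = c := tendsto_nhds_unique (((continuous_eval f).tendsto ξ₀).comp hξ₀) hc
  rw [mem_ofPred_eq, this]
  exact hcδ

theorem locallyCompactSpace : LocallyCompactSpace (𝓖.Dual β) := by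
  have := t2Space hβ
  have : WeaklyLocallyCompactSpace (𝓖.Dual β) := by
    refine ⟨fun ξ => ?_⟩
    obtain ⟨f, -, hf⟩ := exists_eval_ne_zero hβ ξ isOpen_univ (mem_univ _)
    have hpos : 0 < ‖ξ.eval f‖ := norm_pos_iff.2 hf
    refine ⟨_, isCompact_le_norm_eval hβ f (half_pos hpos), ?_⟩
    filter_upwards [(continuous_eval f).norm.continuousAt.eventually_const_lt
      (half_lt_self hpos)] with η hη using hη.le
  infer_instance

/-! ### The trivial characters -/

end Haar

/-- The trivial character of `A_u`. -/
def trivial (β : X → Measure 𝓖.Iso) (u : X) : 𝓖.Dual β := ⟨u, 1⟩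

theorem chi_trivial {u : X} {a : 𝓖.Iso} (h : 𝓖.r a.1 = u) : (trivial β u).chi a = 1 :=
  (chi_of_eq (trivial β u) h).trans Circle.coe_one

theorem trivial_act [𝓖.IsTopological] {u : X} (ρ : 𝓖.IsoQuotient) (h : u = ρ.r) :
    (trivial β u).act ρ h = trivial β ρ.s := by
  have e : ∀ v (e : 𝓖.s ρ.out = v), (trivial β u).act ρ h = ⟨v, 1⟩ := by
    rintro v rfl
    rfl
  exact e _ ρ.s_out

theorem continuous_trivial [SecondCountableTopology G] [LocallyCompactSpace G] [T2Space G]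
    [h𝓖 : 𝓖.IsTopological] (hβ : 𝓖.isotropy.IsHaarSystem β) :
    Continuous (trivial β : X → 𝓖.Dual β) := by
  rw [continuous_iff_continuousAt]
  intro u
  refine tendsto_of_tendsto_chi hβ tendsto_id fun a ha => ?_
  rw [chi_trivial (β := β) (u := u) (a := a) ha]
  refine tendsto_const_nhds.congr' (eventually_inf_principal.2 (Eventually.of_forall fun p hp => ?_))
  exact (chi_trivial hp).symm

end Dual

end GroupoidOn
namespace GroupoidOn

variable {X G : Type*} [TopologicalSpace X] [TopologicalSpace G] {𝓖 : GroupoidOn X G}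
  {β : X → Measure 𝓖.Iso}

/-! ### The groupoid `𝓐^ ⋊ 𝓡` as a topological groupoid -/

open Classical in
/-- The conjugate `γ a γ⁻¹`, if it is defined. -/
def conjIso (γ : G) (a : 𝓖.Iso) : 𝓖.Iso :=
  if h : 𝓖.s γ = 𝓖.r a.1 then
    ⟨𝓖.lmul (𝓖.lmul γ a.1) (𝓖.inv γ), by
      rw [r_lmul, r_lmul, s_lmul, 𝓖.s_inv]
      rw [s_lmul h, 𝓖.r_inv, h, a.2]⟩
  else a

theorem coe_conjIso {γ : G} {a : 𝓖.Iso} (h : 𝓖.s γ = 𝓖.r a.1) :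
    (conjIso γ a).1 = 𝓖.lmul (𝓖.lmul γ a.1) (𝓖.inv γ) := by
  have e : conjIso γ a = ⟨𝓖.lmul (𝓖.lmul γ a.1) (𝓖.inv γ), _⟩ := dif_pos h
  rw [e]

theorem r_conjIso {γ : G} {a : 𝓖.Iso} (h : 𝓖.s γ = 𝓖.r a.1) :
    𝓖.r (conjIso γ a).1 = 𝓖.r γ := by
  rw [coe_conjIso h, r_lmul, r_lmul]

theorem tendsto_conjIso (h𝓖 : 𝓖.IsTopological) {I : Type*} {l : Filter I} {f : I → G}
    {g : I → 𝓖.Iso} {γ : G} {a : 𝓖.Iso} (hf : Tendsto f l (𝓝 γ)) (hg : Tendsto g l (𝓝 a))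
    (h : 𝓖.s γ = 𝓖.r a.1) (hfg : ∀ᶠ i in l, 𝓖.s (f i) = 𝓖.r (g i).1) :
    Tendsto (fun i => conjIso (f i) (g i)) l (𝓝 (conjIso γ a)) := by
  refine (IsInducing.subtypeVal.tendsto_nhds_iff (f := fun i => conjIso (f i) (g i))
    (y := conjIso γ a)).2 ?_
  have hg' : Tendsto (fun i => (g i).1) l (𝓝 a.1) := (continuous_iso_val.tendsto a).comp hg
  have h1 := tendsto_lmul h𝓖 (tendsto_lmul h𝓖 hf hg' h hfg)
    ((h𝓖.continuous_inv.tendsto γ).comp hf) (by rw [s_lmul h, 𝓖.r_inv, h, a.2]) (by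
      filter_upwards [hfg] with i hi
      rw [s_lmul hi, Function.comp, 𝓖.r_inv, hi, (g i).2])
  refine Tendsto.congr' ?_ (by rw [coe_conjIso h]; exact h1)
  filter_upwards [hfg] with i hi
  exact (coe_conjIso hi).symm

theorem isClosedEmbedding_semidirect_val [T2Space X] (hb : Continuous (Dual.base : 𝓖.Dual β → X))
    (h𝓖 : 𝓖.IsTopological) :
    IsClosedEmbedding (Subtype.val : 𝓖.Semidirect β → 𝓖.Dual β × 𝓖.IsoQuotient) :=
  (isClosed_eq (hb.comp continuous_fst)
    ((IsoQuotient.continuous_r h𝓖).comp continuous_snd)).isClosedEmbedding_subtypeVal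

theorem Semidirect.continuous_fst : Continuous fun p : 𝓖.Semidirect β => p.1.1 :=
  _root_.continuous_fst.comp continuous_subtype_val

theorem Semidirect.continuous_snd : Continuous fun p : 𝓖.Semidirect β => p.1.2 :=
  _root_.continuous_snd.comp continuous_subtype_val

theorem Semidirect.continuous_mk {Z : Type*} [TopologicalSpace Z] {f : Z → 𝓖.Dual β}
    {g : Z → 𝓖.IsoQuotient} (hf : Continuous f) (hg : Continuous g)
    (h : ∀ z, (f z).base = (g z).r) :
    Continuous fun z => (⟨(f z, g z), h z⟩ : 𝓖.Semidirect β) :=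
  Continuous.subtype_mk (hf.prodMk hg) _

namespace Dual

theorem chi_actArrow [𝓖.IsTopological] (ξ : 𝓖.Dual β) {γ : G} (h : ξ.base = 𝓖.r γ) {a : 𝓖.Iso}
    (ha : 𝓖.s γ = 𝓖.r a.1) : (ξ.actArrow γ h).chi a = ξ.chi (conjIso γ a) := by
  rw [chi_of_eq (ξ.actArrow γ h) (show 𝓖.r a.1 = (ξ.actArrow γ h).base from ha.symm),
    chi_of_eq ξ ((r_conjIso ha).trans h.symm)]
  change ((ξ.char (conj γ h.symm rfl _) : Circle) : ℂ) = _
  congr 2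
  refine Subtype.ext (Eq.trans ?_ (coe_conjIso ha).symm)
  have h2 : 𝓖.s (𝓖.lmul γ a.1) = 𝓖.r (𝓖.inv γ) := by rw [s_lmul ha, 𝓖.r_inv, ha, a.2]
  rw [lmul_eq h2]
  exact mul_congr _ (lmul_eq ha).symm rfl

variable [SecondCountableTopology G] [LocallyCompactSpace G] [T2Space G] [h𝓖 : 𝓖.IsTopological]
  (hβ : 𝓖.isotropy.IsHaarSystem β)
include hβ

theorem continuous_actArrow :
    Continuous fun p : {p : 𝓖.Dual β × G // p.1.base = 𝓖.r p.2} => p.1.1.actArrow p.1.2 p.2 := by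
  rw [continuous_iff_continuousAt]
  intro p₀
  have c1 : Continuous fun p : {p : 𝓖.Dual β × G // p.1.base = 𝓖.r p.2} => p.1.1 := by fun_prop
  have c2 : Continuous fun p : {p : 𝓖.Dual β × G // p.1.base = 𝓖.r p.2} => p.1.2 := by fun_prop
  refine tendsto_of_tendsto_chi hβ (ξ := fun p : {p : 𝓖.Dual β × G // p.1.base = 𝓖.r p.2} =>
    p.1.1.actArrow p.1.2 p.2) ((h𝓖.continuous_s.comp c2).tendsto p₀) fun a ha => ?_
  have ha' : 𝓖.s p₀.1.2 = 𝓖.r a.1 := Eq.symm ha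
  set l := (𝓝 p₀ ×ˢ 𝓝 a) ⊓ 𝓟 {p : {p : 𝓖.Dual β × G // p.1.base = 𝓖.r p.2} × 𝓖.Iso |
    𝓖.r p.2.1 = (p.1.1.1.actArrow p.1.1.2 p.1.2).base} with hl
  have l1 : Tendsto (fun p : {p : 𝓖.Dual β × G // p.1.base = 𝓖.r p.2} × 𝓖.Iso => p.1) l (𝓝 p₀) :=
    tendsto_fst.mono_left inf_le_left
  have l2 : Tendsto (fun p : {p : 𝓖.Dual β × G // p.1.base = 𝓖.r p.2} × 𝓖.Iso => p.2) l (𝓝 a) :=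
    tendsto_snd.mono_left inf_le_left
  have l3 : ∀ᶠ p in l, 𝓖.s p.1.1.2 = 𝓖.r p.2.1 :=
    eventually_inf_principal.2 (Eventually.of_forall fun p hp => Eq.symm hp)
  -- The acted character at `a` is `χ(γaγ⁻¹)`; joint continuity of `(ξ, a) ↦ χ(a)` and of
  -- conjugation finishes.
  rw [chi_actArrow p₀.1.1 p₀.2 ha']
  have h1 : Tendsto (fun p : {p : 𝓖.Dual β × G // p.1.base = 𝓖.r p.2} × 𝓖.Iso =>
      (p.1.1.1, conjIso p.1.1.2 p.2)) l (𝓝[{q | 𝓖.r q.2.1 = q.1.base}]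
        (p₀.1.1, conjIso p₀.1.2 a)) := by
    refine tendsto_nhdsWithin_iff.2 ⟨((c1.tendsto p₀).comp l1).prodMk_nhds
      (tendsto_conjIso h𝓖 ((c2.tendsto p₀).comp l1) l2 ha' l3), ?_⟩
    filter_upwards [l3] with p hp
    exact (r_conjIso hp).trans p.1.2.symm
  refine ((continuousOn_chi hβ (p₀.1.1, conjIso p₀.1.2 a)
    ((r_conjIso ha').trans p₀.2.symm)).tendsto.comp h1).congr' ?_
  filter_upwards [l3] with p hp
  exact (chi_actArrow p.1.1.1 p.1.2 hp).symm

/-- The action uses a chosen representative, but for abelian isotropy it equals `actArrow` on any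
representative, and so its continuity descends along the open quotient map `𝓖 → 𝓡`. -/
theorem continuous_act (hab : 𝓖.HasAbelianIsotropy) :
    Continuous fun p : 𝓖.Semidirect β => p.1.1.act p.1.2 p.2 := by
  have hq := IsoQuotient.isOpenQuotientMap_mk h𝓖 (hβ.isOpenMap_r (isotropy_isTopological h𝓖))
  have h2 := ((IsOpenQuotientMap.id (X := 𝓖.Dual β)).prodMap hq).restrictPreimage
    {p : 𝓖.Dual β × 𝓖.IsoQuotient | p.1.base = p.2.r}
  refine h2.continuous_comp_iff.1 ?_
  exact (continuous_actArrow hβ).congr fun p => (act_mk hab p.1.1 p.1.2 p.2).symm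

end Dual

variable [SecondCountableTopology G] [LocallyCompactSpace G] [T2Space G] [h𝓖 : 𝓖.IsTopological]

theorem semidirect_isTopological (hab : 𝓖.HasAbelianIsotropy) (hβ : 𝓖.isotropy.IsHaarSystem β) :
    (𝓖.semidirect hab β).IsTopological := by
  have hQ : 𝓖.quotient.IsTopological :=
    quotient_isTopological h𝓖 (hβ.isOpenMap_r (isotropy_isTopological h𝓖))
  refine ⟨Semidirect.continuous_fst, Dual.continuous_act hβ hab, ?_, ?_, ?_⟩
  · exact Semidirect.continuous_mk continuous_id
      (hQ.continuous_unit.comp (Dual.continuous_base hβ)) _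
  · exact Semidirect.continuous_mk (Dual.continuous_act hβ hab)
      (hQ.continuous_inv.comp Semidirect.continuous_snd) _
  · let P := {p : 𝓖.Semidirect β × 𝓖.Semidirect β //
      (𝓖.semidirect hab β).s p.1 = (𝓖.semidirect hab β).r p.2}
    have h0 : Continuous fun p : P => p.1 := continuous_subtype_val
    have h1 : Continuous fun p : P => (p.1.1.1.2, p.1.2.1.2) :=
      (Semidirect.continuous_snd.comp (continuous_fst.comp h0)).prodMk
        (Semidirect.continuous_snd.comp (continuous_snd.comp h0))
    exact Semidirect.continuous_mk (Z := P)
      (Semidirect.continuous_fst.comp (continuous_fst.comp h0))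
      (hQ.continuous_mul.comp (h1.subtype_mk fun p => Semidirect.composable p.2)) _

theorem semidirect_isLocallyCompactHausdorff (hab : 𝓖.HasAbelianIsotropy)
    (hβ : 𝓖.isotropy.IsHaarSystem β) : (𝓖.semidirect hab β).IsLocallyCompactHausdorff := by
  have := t2Space_units h𝓖
  have hQ := quotient_isLocallyCompactHausdorff h𝓖 (hβ.isOpenMap_r (isotropy_isTopological h𝓖))
  have := hQ.locallyCompactSpace
  have := hQ.t2Space
  have := Dual.locallyCompactSpace hβ
  have := Dual.t2Space hβ
  have he := isClosedEmbedding_semidirect_val (Dual.continuous_base hβ) h𝓖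
  exact ⟨semidirect_isTopological hab hβ, he.locallyCompactSpace, he.isEmbedding.t2Space⟩

/-! ### Cartan groupoids -/

/-- Downwards, arrows whose ends lie in a compact `K` over a wandering `U` sit in `K` times a
compact subset of `𝓡`. Upwards, the trivial characters embed `𝓡` in `𝓐^ ⋊ 𝓡` with both ends trivial,
and the second projection carries compact sets back. -/
theorem isCartan_quotient_iff (hab : 𝓖.HasAbelianIsotropy) (hβ : 𝓖.isotropy.IsHaarSystem β) :
    𝓖.quotient.IsCartan ↔ (𝓖.semidirect hab β).IsCartan := by
  have := t2Space_units h𝓖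
  have hQ := quotient_isLocallyCompactHausdorff h𝓖 (hβ.isOpenMap_r (isotropy_isTopological h𝓖))
  have := hQ.t2Space
  have := Dual.locallyCompactSpace hβ
  have := Dual.t2Space hβ
  have hb := Dual.continuous_base hβ
  have he := isClosedEmbedding_semidirect_val hb h𝓖
  have : T2Space (𝓖.Semidirect β) := he.isEmbedding.t2Space
  constructor
  · intro h ξ
    obtain ⟨U, hU, hUw⟩ := h ξ.base
    obtain ⟨K, hK, hKξ⟩ := exists_compact_mem_nhds ξ
    refine ⟨K ∩ Dual.base ⁻¹' U, inter_mem hKξ (hb.continuousAt hU), ?_⟩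
    refine (he.isCompact_preimage (hK.prod hUw)).closure_of_subset ?_
    rintro p ⟨⟨h1, h2⟩, -, h3⟩
    refine ⟨h1, subset_closure ⟨?_, ?_⟩⟩
    · exact Eq.subst (motive := (· ∈ U)) p.2 h2
    · exact Eq.subst (motive := (· ∈ U)) (p.1.1.base_act _ p.2) h3
  · intro h u
    obtain ⟨V, hV, hVw⟩ := h (Dual.trivial β u)
    refine ⟨Dual.trivial β ⁻¹' V, (Dual.continuous_trivial hβ).continuousAt hV, ?_⟩
    refine (hVw.image Semidirect.continuous_snd).closure_of_subset ?_
    rintro ρ ⟨h1, h2⟩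
    refine ⟨⟨(Dual.trivial β ρ.r, ρ), rfl⟩, subset_closure ⟨h1, ?_⟩, rfl⟩
    exact Eq.subst (motive := (· ∈ V)) (Dual.trivial_act (β := β) ρ rfl).symm h2

end GroupoidOn
namespace GroupoidOn

variable {X G : Type*} [TopologicalSpace X] [TopologicalSpace G] {𝓖 : GroupoidOn X G}
  {β : X → Measure 𝓖.Iso}

/-! ### The Haar system `δ × α` -/

open Classical in
/-- The arrow `(ξ, ρ)` of `𝓐^ ⋊ 𝓡`, if it exists. -/
def Semidirect.pair (ξ : 𝓖.Dual β) (ρ : 𝓖.IsoQuotient) : 𝓖.Semidirect β :=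
  if h : ξ.base = ρ.r then ⟨(ξ, ρ), h⟩ else
    ⟨(ξ, 𝓖.quotient.unit ξ.base), (𝓖.quotient.r_unit _).symm⟩

namespace Semidirect

theorem pair_eq {ξ : 𝓖.Dual β} {ρ : 𝓖.IsoQuotient} (h : ξ.base = ρ.r) :
    pair ξ ρ = ⟨(ξ, ρ), h⟩ := dif_pos h

theorem pair_of_ne {ξ : 𝓖.Dual β} {ρ : 𝓖.IsoQuotient} (h : ¬ξ.base = ρ.r) :
    pair ξ ρ = ⟨(ξ, 𝓖.quotient.unit ξ.base), (𝓖.quotient.r_unit _).symm⟩ := dif_neg h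

/-- The default arrow of `pair` is the unit at `ξ`, so the first component is `ξ` in either case. -/
theorem fst_pair (ξ : 𝓖.Dual β) (ρ : 𝓖.IsoQuotient) : (pair ξ ρ).1.1 = ξ := by
  by_cases h : ξ.base = ρ.r
  · exact congrArg (fun p : 𝓖.Semidirect β => p.1.1) (pair_eq h)
  · exact congrArg (fun p : 𝓖.Semidirect β => p.1.1) (dif_neg h)

theorem pair_fst_snd (p : 𝓖.Semidirect β) : pair p.1.1 p.1.2 = p := pair_eq p.2

theorem continuousOn_pair : ContinuousOn (fun q : 𝓖.Dual β × 𝓖.IsoQuotient => pair q.1 q.2)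
    {q | q.1.base = q.2.r} := by
  rw [continuousOn_iff_continuous_domRestrict]
  have h1 : Continuous fun q : {q : 𝓖.Dual β × 𝓖.IsoQuotient | q.1.base = q.2.r} =>
      (⟨q.1, q.2⟩ : 𝓖.Semidirect β) := Continuous.subtype_mk continuous_subtype_val _
  exact h1.congr fun q => (pair_eq q.2).symm

theorem continuousOn_pair_left (ξ : 𝓖.Dual β) :
    ContinuousOn (pair ξ) {ρ : 𝓖.IsoQuotient | ξ.base = ρ.r} :=
  continuousOn_pair.comp (f := fun ρ => (ξ, ρ)) (by fun_prop) fun _ h => h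

theorem measurable_pair [T2Space X] (h𝓖 : 𝓖.IsTopological) (ξ : 𝓖.Dual β) :
    Measurable (pair ξ) := by
  classical
  have hS : IsClosed {ρ : 𝓖.IsoQuotient | ξ.base = ρ.r} :=
    isClosed_eq continuous_const (IsoQuotient.continuous_r h𝓖)
  have h1 := (continuousOn_pair_left ξ).measurable_piecewise
    (g := fun _ => ⟨(ξ, 𝓖.quotient.unit ξ.base), (𝓖.quotient.r_unit _).symm⟩)
    continuousOn_const hS.measurableSet
  refine (congrArg Measurable (funext fun ρ => ?_)).mp h1
  by_cases hρ : ξ.base = ρ.r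
  · exact (Set.piecewise_eq_of_mem _ _ _ hρ)
  · exact (Set.piecewise_eq_of_notMem {ρ : 𝓖.IsoQuotient | ξ.base = ρ.r} _ _ hρ).trans
      (pair_of_ne hρ).symm

end Semidirect

open Semidirect

section Measure

variable [SecondCountableTopology G] [LocallyCompactSpace G] [T2Space G] [h𝓖 : 𝓖.IsTopological]
  {α : X → Measure 𝓖.IsoQuotient}

theorem quotient_continuousSystem (hβ : 𝓖.isotropy.IsHaarSystem β)
    (hα : 𝓖.quotient.IsHaarSystem α) : IsContinuousSystem 𝓖.quotient.r α := by
  have hA := hβ.isOpenMap_r (isotropy_isTopological h𝓖)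
  have hQ := quotient_isLocallyCompactHausdorff h𝓖 hA
  have := hQ.locallyCompactSpace
  have := hQ.t2Space
  have := IsoQuotient.secondCountableTopology h𝓖 hA
  exact hα.isContinuousSystem hQ.isTopological

/-- The fibre over `ξ.base` carries `α ξ.base`, and there `pair ξ` is a genuine inverse of the
projection. All properties of `δ × α` are read off from this form. -/
theorem deltaProd_eq_map (hβ : 𝓖.isotropy.IsHaarSystem β) (hα : 𝓖.quotient.IsHaarSystem α)
    (ξ : 𝓖.Dual β) : deltaProd β α ξ = (α ξ.base).map (pair ξ) := by
  have := t2Space_units h𝓖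
  have hA := hβ.isOpenMap_r (isotropy_isTopological h𝓖)
  have hQ := quotient_isLocallyCompactHausdorff h𝓖 hA
  have := hQ.locallyCompactSpace
  have := hQ.t2Space
  have := IsoQuotient.secondCountableTopology h𝓖 hA
  have hs := quotient_continuousSystem hβ hα
  have := hα.regular ξ.base
  have he : @MeasurableEmbedding (𝓖.Semidirect β) (𝓖.Dual β × 𝓖.IsoQuotient) _ _ Subtype.val :=
    IsClosedEmbedding.measurableEmbedding (α := 𝓖.Semidirect β)
      (isClosedEmbedding_semidirect_val (Dual.continuous_base hβ) h𝓖)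
  ext S hS
  have hm : Measurable (Prod.mk ξ : 𝓖.IsoQuotient → 𝓖.Dual β × 𝓖.IsoQuotient) :=
    measurable_prodMk_left
  have e1 : deltaProd β α ξ S = α ξ.base (Prod.mk ξ ⁻¹' (Subtype.val '' S)) := by
    refine Eq.trans (he.comap_apply ((Measure.dirac ξ).prod (α ξ.base)) S) ?_
    rw [Measure.dirac_prod, Measure.map_apply hm (he.measurableSet_image.2 hS)]
    rfl
  rw [e1, Measure.map_apply (measurable_pair h𝓖 ξ) hS]
  refine measure_congr ?_
  filter_upwards [hs.ae_proj_eq ξ.base] with ρ hρ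
  have hρ' : ξ.base = ρ.r := Eq.symm hρ
  refine propext ⟨?_, fun h => ?_⟩
  · rintro ⟨p, hp, e⟩
    have : pair ξ ρ = p := (pair_eq hρ').trans (Subtype.ext e.symm)
    exact Eq.subst (motive := (· ∈ S)) this.symm hp
  · exact ⟨pair ξ ρ, h, congrArg Subtype.val (pair_eq hρ')⟩

/-- Regularity is transported from `α ξ.base`; no countability of `𝓐^` enters. -/
theorem deltaProd_regular (hβ : 𝓖.isotropy.IsHaarSystem β) (hα : 𝓖.quotient.IsHaarSystem α)
    (ξ : 𝓖.Dual β) : (deltaProd β α ξ).Regular := by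
  have := t2Space_units h𝓖
  have hA := hβ.isOpenMap_r (isotropy_isTopological h𝓖)
  have hQ := quotient_isLocallyCompactHausdorff h𝓖 hA
  have := hQ.locallyCompactSpace
  have := hQ.t2Space
  have := IsoQuotient.secondCountableTopology h𝓖 hA
  have := Dual.t2Space hβ
  have he := isClosedEmbedding_semidirect_val (Dual.continuous_base hβ) h𝓖
  have : T2Space (𝓖.Semidirect β) := he.isEmbedding.t2Space
  have hs := quotient_continuousSystem hβ hα
  have := hα.regular ξ.base
  have hm := measurable_pair h𝓖 ξ
  have hap : ∀ S, MeasurableSet S → deltaProd β α ξ S = α ξ.base (pair ξ ⁻¹' S) := fun S hS => by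
    rw [deltaProd_eq_map hβ hα, Measure.map_apply hm hS]
  have hfst : Continuous fun p : 𝓖.Semidirect β => p.1.1 := Semidirect.continuous_fst
  have hsnd : Continuous fun p : 𝓖.Semidirect β => p.1.2 := Semidirect.continuous_snd
  have h1 : IsFiniteMeasureOnCompacts (deltaProd β α ξ) := by
    refine ⟨fun K hK => ?_⟩
    rw [hap K hK.measurableSet]
    refine lt_of_le_of_lt (measure_mono_ae ?_) (hK.image hsnd).measure_lt_top
    filter_upwards [hs.ae_proj_eq ξ.base] with ρ hρ hρK
    exact ⟨pair ξ ρ, hρK, congrArg (fun p : 𝓖.Semidirect β => p.1.2) (pair_eq (Eq.symm hρ))⟩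
  have h2 : (deltaProd β α ξ).OuterRegular := by
    refine ⟨fun S hS r hr => ?_⟩
    rw [hap S hS] at hr
    obtain ⟨U, hSU, hU, hUr⟩ := Set.exists_isOpen_lt_of_lt _ _ hr
    -- This set is as large as possible off the fibre of `ξ`, which is null, and equals `U` on it.
    -- It is open because points of `𝓐^` are closed.
    have hW : IsOpen {p : 𝓖.Semidirect β | p.1.1 = ξ → p.1.2 ∈ U} := by
      have : IsClosed {p : 𝓖.Semidirect β | p.1.1 = ξ ∧ p.1.2 ∈ Uᶜ} :=
        (isClosed_eq hfst continuous_const).inter (hU.isClosed_compl.preimage hsnd)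
      convert this.isOpen_compl using 1
      ext p
      simp
    refine ⟨_, ?_, hW, ?_⟩
    · intro p hp hpξ
      refine hSU ?_
      have : pair ξ p.1.2 = p := by rw [← hpξ]; exact pair_fst_snd p
      exact Eq.subst (motive := (· ∈ S)) this.symm hp
    · rw [hap _ hW.measurableSet]
      refine lt_of_le_of_lt (measure_mono_ae ?_) hUr
      filter_upwards [hs.ae_proj_eq ξ.base] with ρ hρ hρW
      have : (pair ξ ρ).1.2 = ρ :=
        congrArg (fun p : 𝓖.Semidirect β => p.1.2) (pair_eq (Eq.symm hρ))
      exact Eq.subst (motive := (· ∈ U)) this (hρW (fst_pair ξ ρ))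
  refine { h1, h2 with innerRegular := fun U hU r hr => ?_ }
  rw [hap U hU.measurableSet] at hr
  have hF : IsClosed {ρ : 𝓖.IsoQuotient | ξ.base = ρ.r} :=
    isClosed_eq continuous_const (IsoQuotient.continuous_r h𝓖)
  -- `pair ξ` is continuous only on the fibre, so the compact set must be chosen inside it for its
  -- image to be compact.
  have e : α ξ.base (pair ξ ⁻¹' U) = α ξ.base (pair ξ ⁻¹' U ∩ {ρ | ξ.base = ρ.r}) := by
    refine measure_congr ?_
    filter_upwards [hs.ae_proj_eq ξ.base] with ρ hρ
    exact propext ⟨fun h => ⟨h, Eq.symm hρ⟩, fun h => h.1⟩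
  rw [e] at hr
  obtain ⟨K, hKU, hK, hKr⟩ :=
    ((hm hU.measurableSet).inter hF.measurableSet).exists_lt_isCompact hr
  have hK' : IsCompact (pair ξ '' K) :=
    hK.image_of_continuousOn ((continuousOn_pair_left ξ).mono fun ρ hρ => (hKU hρ).2)
  refine ⟨_, image_subset_iff.2 fun ρ hρ => (hKU hρ).1, hK', hKr.trans_le ?_⟩
  rw [hap _ hK'.measurableSet]
  exact measure_mono (subset_preimage_image _ _)

theorem deltaProd_support (hβ : 𝓖.isotropy.IsHaarSystem β) (hα : 𝓖.quotient.IsHaarSystem α)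
    (ξ : 𝓖.Dual β) : (deltaProd β α ξ).support = {p | p.1.1 = ξ} := by
  have := t2Space_units h𝓖
  have hA := hβ.isOpenMap_r (isotropy_isTopological h𝓖)
  have hQ := quotient_isLocallyCompactHausdorff h𝓖 hA
  have := hQ.locallyCompactSpace
  have := hQ.t2Space
  have := IsoQuotient.secondCountableTopology h𝓖 hA
  have := Dual.t2Space hβ
  have hs := quotient_continuousSystem hβ hα
  have hm := measurable_pair h𝓖 ξ
  ext p
  rw [Measure.mem_support_iff_forall]
  constructor
  · intro h
    by_contra hp
    have hU : IsOpen {p : 𝓖.Semidirect β | p.1.1 ≠ ξ} :=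
      isOpen_ne_fun Semidirect.continuous_fst continuous_const
    refine (h _ (hU.mem_nhds hp)).ne' ?_
    rw [deltaProd_eq_map hβ hα, Measure.map_apply hm hU.measurableSet]
    convert measure_empty (μ := α ξ.base)
    ext ρ
    simp only [mem_preimage, mem_empty_iff_false, iff_false]
    exact fun hne => hne (fst_pair ξ ρ)
  · intro hp U hU
    obtain ⟨V, hVU, hV, hpV⟩ := mem_nhds_iff.1 hU
    refine lt_of_lt_of_le ?_ (measure_mono hVU)
    obtain ⟨O, hO, hOV⟩ := isOpen_induced_iff.1 hV
    rw [deltaProd_eq_map hβ hα, Measure.map_apply hm hV.measurableSet]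
    have hp' : ξ = p.1.1 := Eq.symm hp
    have hO' : IsOpen {ρ : 𝓖.IsoQuotient | (ξ, ρ) ∈ O} :=
      hO.preimage (Continuous.prodMk_right ξ)
    have hpO : p.1.2 ∈ {ρ : 𝓖.IsoQuotient | (ξ, ρ) ∈ O} := by
      have h3 : p.1 ∈ O := (Set.ext_iff.1 hOV p).2 hpV
      rw [hp']
      exact h3
    refine lt_of_lt_of_le (hα.pos_of_isOpen hO' hpO (u := ξ.base) ?_) (measure_mono_ae ?_)
    · rw [hp']; exact p.2.symm
    · filter_upwards [hs.ae_proj_eq ξ.base] with ρ hρ hρO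
      have h4 : pair ξ ρ ∈ Subtype.val ⁻¹' O :=
        Eq.subst (motive := fun q : 𝓖.Semidirect β => q.1 ∈ O) (pair_eq (Eq.symm hρ)).symm hρO
      exact (Set.ext_iff.1 hOV _).1 h4

theorem deltaProd_isHaarSystem (hab : 𝓖.HasAbelianIsotropy) (hβ : 𝓖.isotropy.IsHaarSystem β)
    (hα : 𝓖.quotient.IsHaarSystem α) : (𝓖.semidirect hab β).IsHaarSystem (deltaProd β α) := by
  have := t2Space_units h𝓖
  have hA := hβ.isOpenMap_r (isotropy_isTopological h𝓖)
  have hQ := quotient_isLocallyCompactHausdorff h𝓖 hA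
  have := hQ.locallyCompactSpace
  have := hQ.t2Space
  have := IsoQuotient.secondCountableTopology h𝓖 hA
  have hS := semidirect_isLocallyCompactHausdorff hab hβ
  have := hS.t2Space
  have := Dual.t2Space hβ
  have hs := quotient_continuousSystem hβ hα
  refine ⟨deltaProd_regular hβ hα, deltaProd_support hβ hα, fun f => ?_, fun f p => ?_⟩
  · have e : ∀ ξ : 𝓖.Dual β, ∫ p, f p ∂(deltaProd β α ξ) = ∫ ρ, f (pair ξ ρ) ∂(α ξ.base) := by
      intro ξ
      rw [deltaProd_eq_map hβ hα, integral_map (measurable_pair h𝓖 ξ).aemeasurable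
        (map_continuous f).measurable.aestronglyMeasurable]
    simp only [e]
    have hK : IsCompact ((fun p : 𝓖.Semidirect β => p.1.2) '' tsupport f) :=
      f.hasCompactSupport.isCompact.image Semidirect.continuous_snd
    have hc : ∀ ξ : 𝓖.Dual β, ContinuousOn (fun ρ => f (pair ξ ρ))
        {ρ | 𝓖.quotient.r ρ = ξ.base} := fun ξ =>
      f.continuous.comp_continuousOn ((continuousOn_pair_left ξ).mono fun ρ h => Eq.symm h)
    have h0 : ∀ ξ : 𝓖.Dual β, ∀ ρ, 𝓖.quotient.r ρ = ξ.base →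
        ρ ∉ (fun p : 𝓖.Semidirect β => p.1.2) '' tsupport f → f (pair ξ ρ) = 0 := by
      intro ξ ρ hρ hρK
      refine image_eq_zero_of_notMem_tsupport fun h => hρK ⟨_, h, ?_⟩
      exact congrArg (fun p : 𝓖.Semidirect β => p.1.2) (pair_eq (Eq.symm hρ))
    rw [continuous_iff_continuousAt]
    intro ξ₀
    refine hs.tendsto_integral ((Dual.continuous_base hβ).tendsto ξ₀)
      (F := fun ξ ρ => f (pair ξ ρ)) (hc ξ₀) (Eventually.of_forall hc) ?_ hK
      (Eventually.of_forall h0) (h0 ξ₀)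
    intro ρ hρ
    refine (f.continuous.tendsto _).comp ?_
    have h1 := continuousOn_pair (ξ₀, ρ) (Eq.symm hρ)
    rw [ContinuousWithinAt, nhdsWithin, nhds_prod_eq] at h1
    refine h1.mono_left (inf_le_inf_left _ (principal_mono.2 fun q hq => Eq.symm hq))
  · obtain ⟨⟨ξ, ρ⟩, hp⟩ := p
    set p : 𝓖.Semidirect β := ⟨(ξ, ρ), hp⟩ with hpdef
    set ζ : 𝓖.Dual β := ξ.act ρ hp with hζ
    have hζb : ζ.base = ρ.s := ξ.base_act ρ hp
    have hξb : ξ.base = ρ.r := hp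
    have hr : ∀ ζ : 𝓖.Dual β, ∀ᵐ q ∂(deltaProd β α ζ), q.1.1 = ζ := by
      intro ζ
      rw [deltaProd_eq_map hβ hα, ae_map_iff (measurable_pair h𝓖 ζ).aemeasurable
        (isClosed_eq Semidirect.continuous_fst continuous_const).measurableSet]
      exact ae_of_all _ fun ρ => fst_pair ζ ρ
    have hml : Measurable fun q => f ((𝓖.semidirect hab β).lmul p q) :=
      (map_continuous f).measurable.comp (measurable_lmul hS.isTopological p)
    have hmp : Measurable fun σ => f (pair ξ σ) :=
      (map_continuous f).measurable.comp (measurable_pair h𝓖 ξ)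
    have e1 : (∫ q, (open Classical in if h : (𝓖.semidirect hab β).s p = (𝓖.semidirect hab β).r q
        then f ((𝓖.semidirect hab β).mul p q h) else 0) ∂(deltaProd β α ((𝓖.semidirect hab β).s p)))
        = ∫ q, f ((𝓖.semidirect hab β).lmul p q) ∂(deltaProd β α ζ) := by
      refine integral_congr_ae ?_
      filter_upwards [hr ζ] with q hq
      have h : (𝓖.semidirect hab β).s p = (𝓖.semidirect hab β).r q := Eq.symm hq
      rw [dif_pos h, lmul_eq h]
    have e2 : ∫ q, f q ∂(deltaProd β α ((𝓖.semidirect hab β).r p))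
        = ∫ σ, f (pair ξ σ) ∂(α ρ.r) := by
      change ∫ q, f q ∂(deltaProd β α ξ) = _
      rw [deltaProd_eq_map hβ hα, integral_map (measurable_pair h𝓖 ξ).aemeasurable
        (map_continuous f).measurable.aestronglyMeasurable, hξb]
    rw [e1, e2, deltaProd_eq_map hβ hα, integral_map (measurable_pair h𝓖 ζ).aemeasurable
      hml.aestronglyMeasurable, hζb]
    -- Left multiplication by `(ξ, ρ)` sends `(ξ·ρ, σ)` to `(ξ, ρσ)`, so invariance reduces to that
    -- of `α`.
    have e3 : (α ρ.s).map (𝓖.quotient.lmul ρ) = α ρ.r := hα.map_lmul hQ.isTopological ρ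
    rw [← e3, integral_map (measurable_lmul hQ.isTopological ρ).aemeasurable
      hmp.aestronglyMeasurable]
    refine integral_congr_ae ?_
    filter_upwards [hs.ae_proj_eq ρ.s] with σ hσ
    have hσ' : ζ.base = σ.r := hζb.trans (Eq.symm hσ)
    have hρσ : 𝓖.quotient.s ρ = 𝓖.quotient.r σ := Eq.symm hσ
    congr 1
    have h5 : (𝓖.semidirect hab β).s p = (𝓖.semidirect hab β).r (pair ζ σ) :=
      (fst_pair ζ σ).symm
    have h6 : ξ.base = IsoQuotient.r (𝓖.quotient.lmul ρ σ) :=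
      hξb.trans (r_lmul (𝓗 := 𝓖.quotient) ρ σ).symm
    rw [lmul_eq h5, pair_eq h6]
    refine Subtype.ext (Prod.ext rfl ?_)
    exact (mul_congr (Semidirect.composable h5) rfl (congrArg (fun p : 𝓖.Semidirect β => p.1.2) (pair_eq hσ'))).trans
      (lmul_eq hρσ).symm

/-- For compact `M ⊆ 𝓐^` the measure of `s⁻¹(M)` at `ξ` is at most that of `s⁻¹(base M)` at
`ξ.base`. Conversely, for `M` the trivial characters over `N`, the arrows from `x ∈ N` into `N` all
lift to arrows ending in `M`. -/
theorem isIntegrable_quotient_iff (hab : 𝓖.HasAbelianIsotropy) (hβ : 𝓖.isotropy.IsHaarSystem β)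
    (hα : 𝓖.quotient.IsHaarSystem α) :
    𝓖.quotient.IsIntegrable α ↔ (𝓖.semidirect hab β).IsIntegrable (deltaProd β α) := by
  have := t2Space_units h𝓖
  have hS := semidirect_isLocallyCompactHausdorff hab hβ
  have := Dual.t2Space hβ
  have hs := quotient_continuousSystem hβ hα
  have key : ∀ (M : Set (𝓖.Dual β)), IsCompact M → ∀ ξ : 𝓖.Dual β,
      deltaProd β α ξ ((𝓖.semidirect hab β).s ⁻¹' M)
        = α ξ.base {ρ | ∃ h : ξ.base = ρ.r, ξ.act ρ h ∈ M} := by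
    intro M hM ξ
    rw [deltaProd_eq_map hβ hα, Measure.map_apply (measurable_pair h𝓖 ξ)
      (hM.isClosed.preimage hS.isTopological.continuous_s).measurableSet]
    refine measure_congr ?_
    filter_upwards [hs.ae_proj_eq ξ.base] with ρ hρ
    have hρ' : ξ.base = ρ.r := Eq.symm hρ
    have e : (𝓖.semidirect hab β).s (pair ξ ρ) = ξ.act ρ hρ' :=
      congrArg (𝓖.semidirect hab β).s (pair_eq hρ')
    refine propext ⟨fun h => ⟨hρ', Eq.subst (motive := (· ∈ M)) e h⟩, fun h => ?_⟩
    exact Eq.subst (motive := (· ∈ M)) e.symm h.2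
  constructor
  · intro h M hM
    refine lt_of_le_of_lt (iSup₂_le fun ξ hξ => ?_) (h _ (hM.image (Dual.continuous_base hβ)))
    refine le_trans ?_ (le_iSup₂ (f := fun x (_ : x ∈ Dual.base '' M) =>
      α x (𝓖.quotient.s ⁻¹' (Dual.base '' M))) ξ.base (mem_image_of_mem _ hξ))
    rw [key M hM]
    refine measure_mono ?_
    rintro ρ ⟨hρ, hρM⟩
    exact ⟨_, hρM, ξ.base_act ρ hρ⟩
  · intro h N hN
    refine lt_of_le_of_lt (iSup₂_le fun x hx => ?_) (h _ (hN.image (Dual.continuous_trivial hβ)))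
    refine le_trans ?_ (le_iSup₂ (f := fun ξ (_ : ξ ∈ Dual.trivial β '' N) =>
      deltaProd β α ξ ((𝓖.semidirect hab β).s ⁻¹' (Dual.trivial β '' N))) (Dual.trivial β x)
        (mem_image_of_mem _ hx))
    rw [key _ (hN.image (Dual.continuous_trivial hβ))]
    refine measure_mono_ae ?_
    filter_upwards [hs.ae_proj_eq x] with ρ hρ hρN
    exact ⟨Eq.symm hρ, ρ.s, hρN, (Dual.trivial_act ρ (Eq.symm hρ)).symm⟩

end Measure

end GroupoidOn
namespace GroupoidOn

/-! ### Averages over the isotropy groups -/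

section Algebra

variable {X G : Type*} {𝓖 : GroupoidOn X G}

theorem inv_lmul_eq {γ η : G} (h : 𝓖.s γ = 𝓖.r η) :
    𝓖.inv (𝓖.lmul γ η) = 𝓖.lmul (𝓖.inv η) (𝓖.inv γ) := by
  have h1 : 𝓖.s (𝓖.inv η) = 𝓖.r (𝓖.inv γ) := by rw [𝓖.s_inv, 𝓖.r_inv, h]
  have h2 : 𝓖.s γ = 𝓖.r (𝓖.lmul η (𝓖.lmul (𝓖.inv η) (𝓖.inv γ))) := by rw [r_lmul, h]
  have h3 : 𝓖.lmul (𝓖.lmul γ η) (𝓖.lmul (𝓖.inv η) (𝓖.inv γ)) = 𝓖.unit (𝓖.r γ) := by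
    rw [lmul_assoc h (by rw [r_lmul, 𝓖.r_inv]), ← lmul_assoc (𝓖.r_inv η).symm h1, lmul_inv,
      unit_lmul (by rw [𝓖.r_inv, h]), lmul_inv]
  have h4 := inv_lmul_lmul (𝓗 := 𝓖) (γ := 𝓖.lmul γ η) (η := 𝓖.lmul (𝓖.inv η) (𝓖.inv γ))
    (by rw [s_lmul h, r_lmul, 𝓖.r_inv])
  rw [h3] at h4
  have h5 : 𝓖.r γ = 𝓖.s (𝓖.inv (𝓖.lmul γ η)) := by rw [𝓖.s_inv, r_lmul]
  rw [← h4, h5, lmul_unit]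

theorem coe_isotropy_lmul (a b : 𝓖.Iso) : (𝓖.isotropy.lmul a b).1 = 𝓖.lmul a.1 b.1 := by
  by_cases h : 𝓖.s a.1 = 𝓖.r b.1
  · have e : 𝓖.isotropy.lmul a b = 𝓖.isotropy.mul a b h := lmul_eq (𝓗 := 𝓖.isotropy) h
    exact (congrArg Subtype.val e).trans (lmul_eq h).symm
  · have e : 𝓖.isotropy.lmul a b = a := dif_neg h
    have e' : 𝓖.lmul a.1 b.1 = a.1 := dif_neg h
    exact (congrArg Subtype.val e).trans e'.symm

theorem lmul_comm_of_isotropy (hab : 𝓖.HasAbelianIsotropy) {a b : 𝓖.Iso}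
    (h : 𝓖.r a.1 = 𝓖.r b.1) : 𝓖.lmul a.1 b.1 = 𝓖.lmul b.1 a.1 := by
  have h1 : 𝓖.s a.1 = 𝓖.r b.1 := a.2.symm.trans h
  have h2 : 𝓖.s b.1 = 𝓖.r a.1 := b.2.symm.trans h.symm
  rw [lmul_eq h1, lmul_eq h2]
  exact congrArg Subtype.val (hab (𝓖.r b.1) ⟨a.1, h, h1⟩ ⟨b.1, rfl, b.2.symm⟩)

/-- The isotropy arrow `γ⁻¹η`. -/
def isoLeft (γ η : G) (hr : 𝓖.r γ = 𝓖.r η) (hs : 𝓖.s γ = 𝓖.s η) : 𝓖.Iso :=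
  ⟨𝓖.lmul (𝓖.inv γ) η, by rw [r_lmul, s_lmul ((𝓖.s_inv γ).trans hr), 𝓖.r_inv, hs]⟩

/-- The isotropy arrow `ηγ⁻¹`. -/
def isoRight (γ η : G) (hr : 𝓖.r γ = 𝓖.r η) (hs : 𝓖.s γ = 𝓖.s η) : 𝓖.Iso :=
  ⟨𝓖.lmul η (𝓖.inv γ), by
    rw [r_lmul, s_lmul (hs.symm.trans (𝓖.r_inv γ).symm), 𝓖.s_inv, hr]⟩

end Algebra

variable {X G : Type*} [TopologicalSpace X] [TopologicalSpace G] {𝓖 : GroupoidOn X G}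
  {β : X → Measure 𝓖.Iso}

/-- The average `∫ F(γa) dβ^{s(γ)}(a)`. -/
def rightAvg (β : X → Measure 𝓖.Iso) (F : G → ENNReal) (γ : G) : ENNReal :=
  ∫⁻ a, F (𝓖.lmul γ a.1) ∂(β (𝓖.s γ))

/-- The average `∫ F(bγ) dβ^{r(γ)}(b)`. -/
def leftAvg (β : X → Measure 𝓖.Iso) (F : G → ENNReal) (γ : G) : ENNReal :=
  ∫⁻ b, F (𝓖.lmul b.1 γ) ∂(β (𝓖.r γ))

/-- The average `∫ F(b⁻¹γ) dβ^{r(γ)}(b)`. -/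
def leftAvgInv (β : X → Measure 𝓖.Iso) (F : G → ENNReal) (γ : G) : ENNReal :=
  ∫⁻ b, F (𝓖.lmul (𝓖.inv b.1) γ) ∂(β (𝓖.r γ))

variable [SecondCountableTopology G] [LocallyCompactSpace G] [T2Space G] [MeasurableSpace G]
  [BorelSpace G] [h𝓖 : 𝓖.IsTopological]

theorem measurable_lmul₂ : Measurable fun p : G × G => 𝓖.lmul p.1 p.2 := by
  classical
  have := t2Space_units h𝓖
  have hS : IsClosed {p : G × G | 𝓖.s p.1 = 𝓖.r p.2} :=
    isClosed_eq (h𝓖.continuous_s.comp continuous_fst) (h𝓖.continuous_r.comp continuous_snd)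
  have h1 := (continuousOn_lmul h𝓖).measurable_piecewise (g := fun p => p.1)
    continuous_fst.continuousOn hS.measurableSet
  refine (congrArg Measurable (funext fun p => ?_)).mp h1
  by_cases hp : 𝓖.s p.1 = 𝓖.r p.2
  · exact Set.piecewise_eq_of_mem _ _ _ hp
  · have e : 𝓖.lmul p.1 p.2 = p.1 := dif_neg hp
    rw [e]
    exact Set.piecewise_eq_of_notMem {p : G × G | 𝓖.s p.1 = 𝓖.r p.2} _ _ hp

theorem measurable_lmul_comp {Z : Type*} [MeasurableSpace Z] {f g : Z → G} (hf : Measurable f)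
    (hg : Measurable g) : Measurable fun z => 𝓖.lmul (f z) (g z) :=
  measurable_lmul₂.comp (hf.prodMk hg)

theorem measurable_iso_val : Measurable fun a : 𝓖.Iso => a.1 := continuous_iso_val.measurable

theorem measurable_inv_comp {Z : Type*} [MeasurableSpace Z] {f : Z → G} (hf : Measurable f) :
    Measurable fun z => 𝓖.inv (f z) :=
  h𝓖.continuous_inv.measurable.comp hf

section Averages

variable (hβ : 𝓖.isotropy.IsHaarSystem β)
include hβ

theorem sfinite_isotropy (u : X) : SFinite (β u) := by
  have := hβ.regular u
  infer_instance

theorem ae_r_isotropy (u : X) : ∀ᵐ a ∂(β u), 𝓖.r a.1 = u := (Dual.continuousSystem hβ).ae_proj_eq u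

/-- Left invariance of `β`, for nonnegative functions. -/
theorem lintegral_lmul_isotropy {f : 𝓖.Iso → ENNReal} (hf : Measurable f) (c : 𝓖.Iso) {u : X}
    (hc : 𝓖.r c.1 = u) : ∫⁻ a, f (𝓖.isotropy.lmul c a) ∂(β u) = ∫⁻ a, f a ∂(β u) := by
  have hH := isotropy_isTopological h𝓖
  have h1 := hβ.map_lmul hH c
  have h2 : 𝓖.isotropy.s c = u := c.2.symm.trans hc
  have h3 : 𝓖.isotropy.r c = u := hc
  rw [h2, h3] at h1
  conv_rhs => rw [← h1]
  rw [lintegral_map hf (measurable_lmul hH c)]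

/-- Since `η = γc` with `c = γ⁻¹η` isotropic, left invariance of `β` absorbs `c`. -/
theorem rightAvg_congr {F : G → ENNReal} (hF : Measurable F) {γ η : G} (hr : 𝓖.r γ = 𝓖.r η)
    (hs : 𝓖.s γ = 𝓖.s η) : rightAvg β F γ = rightAvg β F η := by
  have hc : 𝓖.r (isoLeft γ η hr hs).1 = 𝓖.s γ := (r_lmul _ _).trans (𝓖.r_inv γ)
  unfold rightAvg
  rw [← hs, ← lintegral_lmul_isotropy hβ (f := fun a => F (𝓖.lmul γ a.1))
    (hF.comp (measurable_lmul_comp measurable_const measurable_iso_val)) (isoLeft γ η hr hs) hc]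
  refine lintegral_congr_ae ?_
  filter_upwards [ae_r_isotropy hβ (𝓖.s γ)] with a ha
  have h1 : 𝓖.s (isoLeft γ η hr hs).1 = 𝓖.r a.1 :=
    (isoLeft γ η hr hs).2.symm.trans (hc.trans ha.symm)
  rw [coe_isotropy_lmul, ← lmul_assoc hc.symm h1]
  congr 2
  exact lmul_inv_lmul hr

/-- With `η = cγ`, the substitution `a ↦ ca` gives `caγ`, which is `aη` only because `c` and `a`
commute. -/
theorem leftAvg_congr (hab : 𝓖.HasAbelianIsotropy) {F : G → ENNReal} (hF : Measurable F) {γ η : G}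
    (hr : 𝓖.r γ = 𝓖.r η) (hs : 𝓖.s γ = 𝓖.s η) : leftAvg β F γ = leftAvg β F η := by
  have hc : 𝓖.r (isoRight γ η hr hs).1 = 𝓖.r γ := (r_lmul _ _).trans hr.symm
  have hc' : 𝓖.s (isoRight γ η hr hs).1 = 𝓖.r γ := (isoRight γ η hr hs).2.symm.trans hc
  unfold leftAvg
  rw [← hr, ← lintegral_lmul_isotropy hβ (f := fun a => F (𝓖.lmul a.1 γ))
    (hF.comp (measurable_lmul_comp measurable_iso_val measurable_const)) (isoRight γ η hr hs) hc]
  refine lintegral_congr_ae ?_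
  filter_upwards [ae_r_isotropy hβ (𝓖.r γ)] with a ha
  rw [coe_isotropy_lmul, lmul_comm_of_isotropy hab (hc.trans ha.symm),
    lmul_assoc (a.2.symm.trans (ha.trans hc.symm)) hc']
  congr 2
  exact lmul_lmul_inv' hs.symm

/-- Here `(ca)⁻¹η = a⁻¹c⁻¹η = a⁻¹γ`, so commutativity is not needed. -/
theorem leftAvgInv_congr {F : G → ENNReal} (hF : Measurable F) {γ η : G}
    (hr : 𝓖.r γ = 𝓖.r η) (hs : 𝓖.s γ = 𝓖.s η) : leftAvgInv β F γ = leftAvgInv β F η := by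
  have hc : 𝓖.r (isoRight γ η hr hs).1 = 𝓖.r γ := (r_lmul _ _).trans hr.symm
  have hc' : 𝓖.s (isoRight γ η hr hs).1 = 𝓖.r γ := (isoRight γ η hr hs).2.symm.trans hc
  have hη : 𝓖.lmul (isoRight γ η hr hs).1 γ = η := lmul_lmul_inv' hs.symm
  unfold leftAvgInv
  rw [← hr, ← lintegral_lmul_isotropy hβ (f := fun a => F (𝓖.lmul (𝓖.inv a.1) η))
    (hF.comp (measurable_lmul_comp (measurable_inv_comp measurable_iso_val) measurable_const))
    (isoRight γ η hr hs) hc]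
  refine lintegral_congr_ae ?_
  filter_upwards [ae_r_isotropy hβ (𝓖.r γ)] with a ha
  rw [coe_isotropy_lmul, inv_lmul_eq (hc'.trans ha.symm),
    lmul_assoc (by rw [𝓖.s_inv, 𝓖.r_inv, ha, hc']) (by rw [𝓖.s_inv, hc, hr])]
  have h5 : 𝓖.lmul (𝓖.inv (isoRight γ η hr hs).1) η = γ :=
    (congrArg (𝓖.lmul (𝓖.inv (isoRight γ η hr hs).1)) hη.symm).trans (inv_lmul_lmul hc')
  exact congrArg (fun x => F (𝓖.lmul (𝓖.inv a.1) x)) h5.symm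

/-- Both sides are double integrals over `γA`: write the left as `∫∫ F(x) H(bx)` with `x = γa`,
exchange the integrals, replace `x` by `b⁻¹x`, and exchange back. With inverses still present, this
is the classical proof of uniqueness of Haar measure. -/
theorem rightAvg_mul_leftAvg_aux (hab : 𝓖.HasAbelianIsotropy) {F H : G → ENNReal}
    (hF : Measurable F) (hH : Measurable H) (γ : G) :
    rightAvg β F γ * leftAvg β H γ = rightAvg β H γ * leftAvgInv β F γ := by
  have := sfinite_isotropy hβ
  have hγ : Measurable fun a : 𝓖.Iso => 𝓖.lmul γ a.1 :=
    measurable_lmul_comp measurable_const measurable_iso_val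
  have h1 : Measurable fun p : 𝓖.Iso × 𝓖.Iso => 𝓖.lmul γ p.1.1 := hγ.comp measurable_fst
  have h2 : Measurable fun p : 𝓖.Iso × 𝓖.Iso => p.2.1 := measurable_iso_val.comp measurable_snd
  calc rightAvg β F γ * leftAvg β H γ
      = ∫⁻ a, F (𝓖.lmul γ a.1) * leftAvg β H γ ∂(β (𝓖.s γ)) :=
        (lintegral_mul_const _ (hF.comp hγ)).symm
    _ = ∫⁻ a, ∫⁻ b, F (𝓖.lmul γ a.1) * H (𝓖.lmul b.1 (𝓖.lmul γ a.1)) ∂(β (𝓖.r γ))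
          ∂(β (𝓖.s γ)) := by
        refine lintegral_congr_ae ?_
        filter_upwards [ae_r_isotropy hβ (𝓖.s γ)] with a ha
        have m : Measurable fun b : 𝓖.Iso => H (𝓖.lmul b.1 (𝓖.lmul γ a.1)) :=
          hH.comp (measurable_lmul_comp measurable_iso_val measurable_const)
        rw [leftAvg_congr hβ hab hH (η := 𝓖.lmul γ a.1) (r_lmul _ _).symm
          (by rw [s_lmul ha.symm, ← a.2, ha]), leftAvg, r_lmul, lintegral_const_mul _ m]
    _ = ∫⁻ b, ∫⁻ a, F (𝓖.lmul γ a.1) * H (𝓖.lmul b.1 (𝓖.lmul γ a.1)) ∂(β (𝓖.s γ))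
          ∂(β (𝓖.r γ)) := lintegral_lintegral_swap
            ((hF.comp h1).mul (hH.comp (measurable_lmul_comp h2 h1))).aemeasurable
    _ = ∫⁻ b, ∫⁻ a, F (𝓖.lmul (𝓖.inv b.1) (𝓖.lmul γ a.1)) * H (𝓖.lmul γ a.1) ∂(β (𝓖.s γ))
          ∂(β (𝓖.r γ)) := by
        refine lintegral_congr_ae ?_
        filter_upwards [ae_r_isotropy hβ (𝓖.r γ)] with b hb
        have hb' : 𝓖.s (𝓖.inv b.1) = 𝓖.r γ := (𝓖.s_inv _).trans hb
        have hsb : 𝓖.s (𝓖.lmul (𝓖.inv b.1) γ) = 𝓖.s γ := s_lmul hb'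
        have h3 := rightAvg_congr hβ (F := fun x => F x * H (𝓖.lmul b.1 x))
          (hF.mul (hH.comp (measurable_lmul_comp measurable_const measurable_id)))
          (γ := γ) (η := 𝓖.lmul (𝓖.inv b.1) γ) (by rw [r_lmul, 𝓖.r_inv, ← b.2, hb]) hsb.symm
        refine h3.trans ?_
        unfold rightAvg
        rw [hsb]
        refine lintegral_congr_ae ?_
        filter_upwards [ae_r_isotropy hβ (𝓖.s γ)] with a ha
        rw [lmul_assoc hb' ha.symm, lmul_inv_lmul (by rw [r_lmul, hb])]
    _ = ∫⁻ a, ∫⁻ b, F (𝓖.lmul (𝓖.inv b.1) (𝓖.lmul γ a.1)) * H (𝓖.lmul γ a.1) ∂(β (𝓖.r γ))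
          ∂(β (𝓖.s γ)) := (lintegral_lintegral_swap
            ((hF.comp (measurable_lmul_comp (measurable_inv_comp h2) h1)).mul
              (hH.comp h1)).aemeasurable).symm
    _ = ∫⁻ a, H (𝓖.lmul γ a.1) * leftAvgInv β F γ ∂(β (𝓖.s γ)) := by
        refine lintegral_congr_ae ?_
        filter_upwards [ae_r_isotropy hβ (𝓖.s γ)] with a ha
        have m : Measurable fun b : 𝓖.Iso => F (𝓖.lmul (𝓖.inv b.1) (𝓖.lmul γ a.1)) :=
          hF.comp (measurable_lmul_comp (measurable_inv_comp measurable_iso_val) measurable_const)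
        rw [leftAvgInv_congr hβ hF (η := 𝓖.lmul γ a.1) (r_lmul _ _).symm
          (by rw [s_lmul ha.symm, ← a.2, ha]), leftAvgInv, r_lmul, lintegral_mul_const _ m,
          mul_comm]
    _ = _ := lintegral_mul_const _ (hH.comp hγ)

/-- There is a test function with finite nonzero integral over `A_u`. -/
theorem exists_lintegral_isotropy (u : X) : ∃ h : G → ENNReal, Measurable h ∧
    ∫⁻ a, h a.1 ∂(β u) ≠ 0 ∧ ∫⁻ a, h a.1 ∂(β u) ≠ ⊤ := by
  obtain ⟨K, hK, hKu⟩ := exists_compact_mem_nhds (𝓖.unit u)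
  have hv := measurable_iso_val (𝓖 := 𝓖)
  have hm : MeasurableSet ((fun a : 𝓖.Iso => a.1) ⁻¹' K) := hv hK.measurableSet
  have e : ∫⁻ a, K.indicator 1 (a.1 : G) ∂(β u) = β u ((fun a : 𝓖.Iso => a.1) ⁻¹' K) := by
    rw [← lintegral_indicator_one hm]
    rfl
  refine ⟨K.indicator 1, measurable_one.indicator hK.measurableSet, ?_, ?_⟩
  · rw [e]
    refine ne_of_gt (lt_of_lt_of_le (hβ.pos_of_isOpen (u := u)
      (isOpen_interior.preimage continuous_iso_val) (γ := 𝓖.isotropy.unit u) ?_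
      (𝓖.isotropy.r_unit u)) (measure_mono (preimage_mono interior_subset)))
    exact mem_interior_iff_mem_nhds.2 hKu
  · rw [e]
    have := hβ.regular u
    have hc : IsCompact ((fun a : 𝓖.Iso => a.1) ⁻¹' K) :=
      (isClosedEmbedding_iso_val h𝓖).isCompact_preimage hK
    exact hc.measure_lt_top.ne

/-- The abelian groups `A_u` are unimodular. -/
theorem lintegral_inv_isotropy (hab : 𝓖.HasAbelianIsotropy) {f : G → ENNReal} (hf : Measurable f)
    (u : X) : ∫⁻ b, f (𝓖.inv b.1) ∂(β u) = ∫⁻ b, f b.1 ∂(β u) := by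
  obtain ⟨h, hh, h0, htop⟩ := exists_lintegral_isotropy hβ u
  have e1 : ∀ F : G → ENNReal, rightAvg β F (𝓖.unit u) = ∫⁻ b, F b.1 ∂(β u) := fun F => by
    rw [rightAvg, 𝓖.s_unit]
    refine lintegral_congr_ae ?_
    filter_upwards [ae_r_isotropy hβ u] with a ha
    rw [unit_lmul ha.symm]
  have e2 : ∀ F : G → ENNReal, leftAvg β F (𝓖.unit u) = ∫⁻ b, F b.1 ∂(β u) := fun F => by
    rw [leftAvg, 𝓖.r_unit]
    refine lintegral_congr_ae ?_
    filter_upwards [ae_r_isotropy hβ u] with a ha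
    rw [← ha, a.2, lmul_unit]
  have e3 : leftAvgInv β f (𝓖.unit u) = ∫⁻ b, f (𝓖.inv b.1) ∂(β u) := by
    rw [leftAvgInv, 𝓖.r_unit]
    refine lintegral_congr_ae ?_
    filter_upwards [ae_r_isotropy hβ u] with a ha
    rw [← ha, ← 𝓖.s_inv, lmul_unit]
  -- At a unit all averages are integrals over `A_u`, and the identity compares `f` with its
  -- composite with inversion; the integral of `h` cancels.
  have h1 := rightAvg_mul_leftAvg_aux hβ hab hf hh (𝓖.unit u)
  rw [e1, e1, e2, e3, mul_comm] at h1
  exact ((ENNReal.mul_right_inj h0 htop).1 h1).symm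

theorem leftAvgInv_eq (hab : 𝓖.HasAbelianIsotropy) {F : G → ENNReal} (hF : Measurable F) (γ : G) :
    leftAvgInv β F γ = leftAvg β F γ :=
  lintegral_inv_isotropy hβ hab (f := fun x => F (𝓖.lmul x γ))
    (hF.comp (measurable_lmul_comp measurable_id measurable_const)) _

theorem rightAvg_mul_leftAvg (hab : 𝓖.HasAbelianIsotropy) {F H : G → ENNReal}
    (hF : Measurable F) (hH : Measurable H) (γ : G) :
    rightAvg β F γ * leftAvg β H γ = rightAvg β H γ * leftAvg β F γ := by
  rw [rightAvg_mul_leftAvg_aux hβ hab hF hH, leftAvgInv_eq hβ hab hF]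

theorem measurable_leftAvg_fibre {F : G → ENNReal} (hF : Measurable F) (v : X) :
    Measurable fun γ => ∫⁻ b, F (𝓖.lmul b.1 γ) ∂(β v) := by
  have := sfinite_isotropy hβ
  exact Measurable.lintegral_prod_right' (f := fun p : G × 𝓖.Iso => F (𝓖.lmul p.2.1 p.1))
    (hF.comp (measurable_lmul_comp (measurable_iso_val.comp measurable_snd) measurable_fst))

/-- Averaging over `A_v` is symmetric with respect to the left invariant measure on `r⁻¹(v)`. -/
theorem lintegral_mul_leftAvg (hab : 𝓖.HasAbelianIsotropy) {lam : X → Measure G}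
    (hlam : 𝓖.IsHaarSystem lam) {v : X} {ψ F H : G → ENNReal} (hψ : Measurable ψ)
    (hF : Measurable F) (hH : Measurable H)
    (hinv : ∀ γ η, 𝓖.r γ = v → 𝓖.r η = v → 𝓖.s γ = 𝓖.s η → ψ γ = ψ η) :
    ∫⁻ γ, ψ γ * F γ * leftAvg β H γ ∂(lam v) = ∫⁻ γ, ψ γ * leftAvg β F γ * H γ ∂(lam v) := by
  have := sfinite_isotropy hβ
  have hl := hlam.isContinuousSystem h𝓖
  have : SFinite (lam v) := by
    have := hlam.regular v
    infer_instance
  have h2 : Measurable fun p : G × 𝓖.Iso => p.2.1 := measurable_iso_val.comp measurable_snd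
  have h1 : Measurable fun p : G × 𝓖.Iso => p.1 := measurable_fst
  have hc : ∀ b : 𝓖.Iso, Measurable fun γ => 𝓖.lmul (𝓖.inv b.1) γ := fun b =>
    measurable_lmul_comp measurable_const measurable_id
  calc ∫⁻ γ, ψ γ * F γ * leftAvg β H γ ∂(lam v)
      = ∫⁻ γ, ∫⁻ b, ψ γ * F γ * H (𝓖.lmul b.1 γ) ∂(β v) ∂(lam v) := by
        refine lintegral_congr_ae ?_
        filter_upwards [hl.ae_proj_eq v] with γ hγ
        have m : Measurable fun b : 𝓖.Iso => H (𝓖.lmul b.1 γ) :=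
          hH.comp (measurable_lmul_comp measurable_iso_val measurable_const)
        rw [leftAvg, hγ, lintegral_const_mul _ m]
    _ = ∫⁻ b, ∫⁻ γ, ψ γ * F γ * H (𝓖.lmul b.1 γ) ∂(lam v) ∂(β v) := lintegral_lintegral_swap
          (((hψ.comp h1).mul (hF.comp h1)).mul (hH.comp (measurable_lmul_comp h2 h1))).aemeasurable
    _ = ∫⁻ b, ∫⁻ γ, ψ γ * F (𝓖.lmul (𝓖.inv b.1) γ) * H γ ∂(lam v) ∂(β v) := by
        refine lintegral_congr_ae ?_
        filter_upwards [ae_r_isotropy hβ v] with b hb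
        -- Left invariance of `lam` under `b⁻¹` moves the translation from `H` to `F`; the class
        -- function `ψ` is unaffected.
        have h3 := hlam.map_lmul h𝓖 (𝓖.inv b.1)
        rw [𝓖.s_inv, 𝓖.r_inv, ← b.2, hb] at h3
        conv_lhs => rw [← h3]
        have m : Measurable fun γ => ψ γ * F γ * H (𝓖.lmul b.1 γ) := (hψ.mul hF).mul
          (hH.comp (measurable_lmul_comp measurable_const measurable_id))
        refine (lintegral_map m (hc b)).trans (lintegral_congr_ae ?_)
        filter_upwards [hl.ae_proj_eq v] with γ hγ
        have hb' : 𝓖.s (𝓖.inv b.1) = 𝓖.r γ := (𝓖.s_inv _).trans (hb.trans hγ.symm)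
        have hψγ : ψ (𝓖.lmul (𝓖.inv b.1) γ) = ψ γ :=
          hinv _ _ (by rw [r_lmul, 𝓖.r_inv, ← b.2, hb]) hγ (s_lmul hb')
        rw [hψγ, lmul_inv_lmul (hb.trans hγ.symm)]
    _ = ∫⁻ γ, ∫⁻ b, ψ γ * F (𝓖.lmul (𝓖.inv b.1) γ) * H γ ∂(β v) ∂(lam v) :=
          (lintegral_lintegral_swap (((hψ.comp h1).mul
            (hF.comp (measurable_lmul_comp (measurable_inv_comp h2) h1))).mul
              (hH.comp h1)).aemeasurable).symm
    _ = _ := by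
        refine lintegral_congr_ae ?_
        filter_upwards [hl.ae_proj_eq v] with γ hγ
        have m : Measurable fun b : 𝓖.Iso => F (𝓖.lmul (𝓖.inv b.1) γ) :=
          hF.comp (measurable_lmul_comp (measurable_inv_comp measurable_iso_val) measurable_const)
        rw [← leftAvgInv_eq hβ hab hF, leftAvgInv, hγ, lintegral_mul_const _ (m.const_mul _),
          lintegral_const_mul _ m]

end Averages

end GroupoidOn
namespace GroupoidOn

/-! ### A Borel weight on `𝓖` with averages one -/

variable {X G : Type*} [TopologicalSpace X] [TopologicalSpace G] {𝓖 : GroupoidOn X G}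
  {β : X → Measure 𝓖.Iso} [SecondCountableTopology G] [LocallyCompactSpace G] [T2Space G]
  [MeasurableSpace G] [BorelSpace G] [h𝓖 : 𝓖.IsTopological]

theorem continuousOn_lmul_iso (γ : G) :
    ContinuousOn (fun a : 𝓖.Iso => 𝓖.lmul γ a.1) {a | 𝓖.isotropy.r a = 𝓖.s γ} :=
  (continuousOn_lmul_left h𝓖 γ).comp (f := fun a : 𝓖.Iso => a.1) continuous_iso_val.continuousOn
    fun _ ha => Eq.symm ha

/-- If `γ ∈ N` and `γa ∈ K`, then `a = γ⁻¹(γa)` lies in the compact set of products `N⁻¹K`. -/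
theorem exists_isCompact_iso {N K : Set G} (hN : IsCompact N) (hK : IsCompact K) :
    ∃ L : Set 𝓖.Iso, IsCompact L ∧ ∀ γ ∈ N, ∀ a : 𝓖.Iso, 𝓖.isotropy.r a = 𝓖.s γ → a ∉ L →
      𝓖.lmul γ a.1 ∉ K := by
  have := t2Space_units h𝓖
  set P : Set (G × G) := (N ×ˢ K) ∩ {p | 𝓖.r p.1 = 𝓖.r p.2}
  have hP : IsCompact P := (hN.prod hK).inter_right
    (isClosed_eq (h𝓖.continuous_r.comp continuous_fst) (h𝓖.continuous_r.comp continuous_snd))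
  have hc : ContinuousOn (fun p : G × G => 𝓖.lmul (𝓖.inv p.1) p.2) P :=
    (continuousOn_lmul h𝓖).comp (f := fun p : G × G => (𝓖.inv p.1, p.2))
      ((h𝓖.continuous_inv.comp continuous_fst).prodMk continuous_snd).continuousOn
      fun p hp => (𝓖.s_inv p.1).trans hp.2
  refine ⟨(fun a : 𝓖.Iso => a.1) ⁻¹' ((fun p : G × G => 𝓖.lmul (𝓖.inv p.1) p.2) '' P),
    (isClosedEmbedding_iso_val h𝓖).isCompact_preimage (hP.image_of_continuousOn hc), ?_⟩
  intro γ hγ a ha haL haK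
  exact haL ⟨(γ, 𝓖.lmul γ a.1), ⟨⟨hγ, haK⟩, (r_lmul _ _).symm⟩, inv_lmul_lmul (Eq.symm ha)⟩

section Averages

variable (hβ : 𝓖.isotropy.IsHaarSystem β)
include hβ

theorem integrable_lmul_iso (f : C_c(G, ℂ)) (γ : G) :
    Integrable (fun a : 𝓖.Iso => f (𝓖.lmul γ a.1)) (β (𝓖.s γ)) := by
  have := t2Space_units h𝓖
  obtain ⟨L, hL, h⟩ := exists_isCompact_iso (𝓖 := 𝓖) (isCompact_singleton (x := γ))
    f.hasCompactSupport.isCompact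
  exact (Dual.continuousSystem hβ).integrable_of_continuousOn
    (f.continuous.comp_continuousOn (continuousOn_lmul_iso γ)) hL
    fun a ha haL => image_eq_zero_of_notMem_tsupport (h γ rfl a ha haL)

theorem continuous_avg (f : C_c(G, ℂ)) :
    Continuous fun γ => ∫ a, f (𝓖.lmul γ a.1) ∂(β (𝓖.s γ)) := by
  have := t2Space_units h𝓖
  rw [continuous_iff_continuousAt]
  intro γ₀
  obtain ⟨N, hN, hNγ⟩ := exists_compact_mem_nhds γ₀
  obtain ⟨L, hL, h⟩ := exists_isCompact_iso (𝓖 := 𝓖) hN f.hasCompactSupport.isCompact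
  refine (Dual.continuousSystem hβ).tendsto_integral (l := 𝓝 γ₀) (u := 𝓖.s)
    h𝓖.continuous_s.continuousAt (F := fun γ a => f (𝓖.lmul γ a.1))
    (f.continuous.comp_continuousOn (continuousOn_lmul_iso γ₀))
    (Eventually.of_forall fun γ => f.continuous.comp_continuousOn (continuousOn_lmul_iso γ))
    (fun b hb => ?_) hL ?_ fun b hb hbL =>
      image_eq_zero_of_notMem_tsupport (h γ₀ (mem_of_mem_nhds hNγ) b hb hbL)
  · refine (f.continuous.tendsto _).comp (tendsto_lmul h𝓖 ?_ ?_ (Eq.symm hb) ?_)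
    · exact tendsto_fst.mono_left inf_le_left
    · exact (continuous_iso_val.tendsto b).comp (tendsto_snd.mono_left inf_le_left)
    · exact eventually_inf_principal.2 (Eventually.of_forall fun p hp => Eq.symm hp)
  · filter_upwards [hNγ] with γ hγ b hb hbL
    exact image_eq_zero_of_notMem_tsupport (h γ hγ b hb hbL)

/-- The average of a nonnegative test function is finite and continuous. -/
theorem exists_rightAvg_eq (φ : C(G, ℝ)) (hφ : HasCompactSupport φ) (h0 : ∀ γ, 0 ≤ φ γ) :
    ∃ q : G → ℝ, Continuous q ∧ (∀ γ, 0 ≤ q γ) ∧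
      ∀ γ, rightAvg β (fun η => ENNReal.ofReal (φ η)) γ = ENNReal.ofReal (q γ) := by
  refine ⟨fun γ => ∫ a, φ (𝓖.lmul γ a.1) ∂(β (𝓖.s γ)), ?_,
    fun γ => integral_nonneg fun a => h0 _, fun γ => ?_⟩
  · refine (Complex.continuous_re.comp (continuous_avg hβ (complexBump φ hφ))).congr fun γ => ?_
    simp only [Function.comp, complexBump_apply]
    rw [integral_complex_ofReal, Complex.ofReal_re]
  · have h1 : Integrable (fun a : 𝓖.Iso => φ (𝓖.lmul γ a.1)) (β (𝓖.s γ)) :=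
      (integrable_lmul_iso hβ (complexBump φ hφ) γ).re
    exact (ofReal_integral_eq_lintegral_ofReal h1 (Eventually.of_forall fun a => h0 _)).symm

/-- The integrand is nonzero at the unit `s γ`, hence on a relatively open part of the fibre, which
has positive measure. -/
theorem rightAvg_ne_zero {F : G → ENNReal} (hF : Continuous F) {γ : G} (h0 : F γ ≠ 0) :
    rightAvg β F γ ≠ 0 := by
  have hs := Dual.continuousSystem hβ
  have hm : Measurable fun a : 𝓖.Iso => F (𝓖.lmul γ a.1) :=
    hF.measurable.comp (measurable_lmul_comp measurable_const measurable_iso_val)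
  intro h
  obtain ⟨U, hU, hUe⟩ := (continuousOn_iff'.1
    (hF.comp_continuousOn (continuousOn_lmul_iso (𝓖 := 𝓖) γ))) {0}ᶜ isOpen_compl_singleton
  have hunit : 𝓖.isotropy.unit (𝓖.s γ) ∈ U := by
    have : 𝓖.isotropy.unit (𝓖.s γ) ∈ ((fun a : 𝓖.Iso => F (𝓖.lmul γ a.1)) ⁻¹' {0}ᶜ) ∩
        {a | 𝓖.isotropy.r a = 𝓖.s γ} := by
      refine ⟨?_, 𝓖.isotropy.r_unit _⟩
      change F (𝓖.lmul γ (𝓖.unit (𝓖.s γ))) ≠ 0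
      rwa [lmul_unit]
    exact (hUe.le this).1
  have hpos := hβ.pos_of_isOpen hU hunit (𝓖.isotropy.r_unit _)
  have h1 := (lintegral_eq_zero_iff hm).1 h
  refine hpos.ne' (measure_mono_null_ae ?_ (measure_empty (μ := β (𝓖.s γ))))
  filter_upwards [h1, hs.ae_proj_eq (𝓖.s γ)] with a ha hr haU
  exact (hUe.ge ⟨haU, hr⟩).1 ha

/-- A sequence of test functions, which are positive on a neighbourhood of any given compact set
from some point on, with their averages. -/
theorem exists_testFunctions : ∃ (φ : ℕ → C(G, ℝ)) (q : ℕ → G → ℝ),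
    (∀ n, HasCompactSupport (φ n)) ∧ (∀ n γ, 0 ≤ φ n γ) ∧ (∀ n, Continuous (q n)) ∧
    (∀ n γ, 0 ≤ q n γ) ∧
    (∀ n γ, rightAvg β (fun η => ENNReal.ofReal (φ n η)) γ = ENNReal.ofReal (q n γ)) ∧
    (∀ n γ η, 𝓖.r γ = 𝓖.r η → 𝓖.s γ = 𝓖.s η → q n γ = q n η) ∧
    ∀ K : Set G, IsCompact K → ∃ n, ∀ γ ∈ K, q n γ ≠ 0 := by
  have K := CompactExhaustion.choice G
  have h1 : ∀ n, ∃ φ : C(G, ℝ), HasCompactSupport φ ∧ EqOn φ 1 (K n) ∧ (∀ x, 0 ≤ φ x) := by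
    intro n
    obtain ⟨φ, hc, h1, -, hr⟩ := exists_bump (K.isCompact n) isOpen_univ (subset_univ _)
    exact ⟨φ, hc, h1, fun x => (hr x).1⟩
  choose φ hc h1 h0 using h1
  choose q hq hq0 hqφ using fun n => exists_rightAvg_eq hβ (φ n) (hc n) (h0 n)
  have hF : ∀ n, Continuous fun η => ENNReal.ofReal (φ n η) := fun n =>
    ENNReal.continuous_ofReal.comp (φ n).continuous
  refine ⟨φ, q, hc, h0, hq, hq0, hqφ, fun n γ η hr hs => ?_, fun L hL => ?_⟩
  · have h2 := rightAvg_congr hβ (hF n).measurable hr hs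
    rwa [hqφ, hqφ, ENNReal.ofReal_eq_ofReal_iff (hq0 _ _) (hq0 _ _)] at h2
  · obtain ⟨n, hn⟩ := K.exists_superset_of_isCompact hL
    refine ⟨n, fun γ hγ hz => ?_⟩
    refine rightAvg_ne_zero hβ (hF n) (γ := γ) ?_ ?_
    · rw [h1 n (hn hγ)]
      simp
    · rw [hqφ, hz, ENNReal.ofReal_zero]

/-- There is a Borel function on `𝓖` all of whose averages are one. -/
theorem exists_weight : ∃ w : G → ENNReal, Measurable w ∧ ∀ γ, rightAvg β w γ = 1 := by
  classical
  obtain ⟨φ, q, -, -, hq, hq0, hqφ, hinv, hK⟩ := exists_testFunctions hβ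
  have hex : ∀ γ, ∃ n, q n γ ≠ 0 := fun γ => by
    obtain ⟨n, hn⟩ := hK {γ} isCompact_singleton
    exact ⟨n, hn γ rfl⟩
  have hF : ∀ n, Measurable fun η => ENNReal.ofReal (φ n η) := fun n =>
    (ENNReal.continuous_ofReal.comp (φ n).continuous).measurable
  -- Use the first `φ n` whose average at `γ` is nonzero, divided by that average. Both the index
  -- and the divisor depend only on the class of `γ`, so they are constant along the averaging.
  refine ⟨fun γ => ENNReal.ofReal (φ (Nat.find (hex γ)) γ) /
    ENNReal.ofReal (q (Nat.find (hex γ)) γ), ?_, fun γ => ?_⟩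
  · exact Measurable.find (f := fun n γ => ENNReal.ofReal (φ n γ) / ENNReal.ofReal (q n γ))
      (fun n => (hF n).div (hq n).measurable.ennreal_ofReal)
      (fun n => (hq n).measurable (measurableSet_singleton 0).compl) hex
  · set n := Nat.find (hex γ) with hn
    have hne : ENNReal.ofReal (q n γ) ≠ 0 := by
      rw [Ne, ENNReal.ofReal_eq_zero, not_le]
      exact lt_of_le_of_ne (hq0 _ _) (Nat.find_spec (hex γ)).symm
    have m : Measurable fun a : 𝓖.Iso => ENNReal.ofReal (φ n (𝓖.lmul γ a.1)) :=
      (hF n).comp (measurable_lmul_comp measurable_const measurable_iso_val)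
    have h2 : rightAvg β (fun η => ENNReal.ofReal (φ n η)) γ * (ENNReal.ofReal (q n γ))⁻¹ = 1 := by
      rw [hqφ, ENNReal.mul_inv_cancel hne ENNReal.ofReal_ne_top]
    rw [← h2, rightAvg, rightAvg, ← lintegral_mul_const _ m]
    refine lintegral_congr_ae ?_
    filter_upwards [ae_r_isotropy hβ (𝓖.s γ)] with a ha
    have hqa : ∀ k, q k (𝓖.lmul γ a.1) = q k γ := fun k =>
      hinv k _ _ (r_lmul _ _) ((s_lmul ha.symm).trans (a.2.symm.trans ha))
    have hna : Nat.find (hex (𝓖.lmul γ a.1)) = n := by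
      rw [hn]
      congr 1
      ext k
      rw [hqa]
    rw [hna, hqa, div_eq_mul_inv]

end Averages

end GroupoidOn
namespace GroupoidOn

/-! ### The Haar system of the quotient groupoid -/

variable {X G : Type*} [TopologicalSpace X] [TopologicalSpace G] {𝓖 : GroupoidOn X G}
  {β : X → Measure 𝓖.Iso} [SecondCountableTopology G] [LocallyCompactSpace G] [T2Space G]
  [MeasurableSpace G] [BorelSpace G] [h𝓖 : 𝓖.IsTopological]

section Weight

variable (hab : 𝓖.HasAbelianIsotropy) (hβ : 𝓖.isotropy.IsHaarSystem β) {w : G → ENNReal}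
  (hw : Measurable w) (hw1 : ∀ γ, rightAvg β w γ = 1)
include hab hβ hw hw1

theorem leftAvg_eq_mul {H : G → ENNReal} (hH : Measurable H) (γ : G) :
    leftAvg β H γ = rightAvg β H γ * leftAvg β w γ := by
  rw [← rightAvg_mul_leftAvg hβ hab hw hH, hw1, one_mul]

/-- The right translate `x ↦ h(xγ⁻¹)` of a test function on `A_{r(γ)}` has left average in `(0, ∞)`
at `γ`; this average is a product with `leftAvg β w γ` as a factor. -/
theorem leftAvg_weight_ne (γ : G) : leftAvg β w γ ≠ 0 ∧ leftAvg β w γ ≠ ⊤ := by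
  obtain ⟨h, hh, h0, htop⟩ := exists_lintegral_isotropy hβ (𝓖.r γ)
  have hH : Measurable fun x => h (𝓖.lmul x (𝓖.inv γ)) :=
    hh.comp (measurable_lmul_comp measurable_id measurable_const)
  have e : leftAvg β (fun x => h (𝓖.lmul x (𝓖.inv γ))) γ = ∫⁻ a, h a.1 ∂(β (𝓖.r γ)) := by
    refine lintegral_congr_ae ?_
    filter_upwards [ae_r_isotropy hβ (𝓖.r γ)] with b hb
    rw [lmul_lmul_inv (b.2.symm.trans hb)]
  rw [leftAvg_eq_mul hab hβ hw hw1 hH] at e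
  rw [← e] at h0 htop
  refine ⟨right_ne_zero_of_mul h0, fun h => htop ?_⟩
  rw [h, ENNReal.mul_top (left_ne_zero_of_mul h0)]

/-- Right averages are symmetric with respect to a left Haar system. -/
theorem lintegral_mul_rightAvg {lam : X → Measure G} (hlam : 𝓖.IsHaarSystem lam) {v : X}
    {ψ F H : G → ENNReal} (hψ : Measurable ψ) (hF : Measurable F) (hH : Measurable H)
    (hinv : ∀ γ η, 𝓖.r γ = v → 𝓖.r η = v → 𝓖.s γ = 𝓖.s η → ψ γ = ψ η) :
    ∫⁻ γ, ψ γ * F γ * rightAvg β H γ ∂(lam v) = ∫⁻ γ, ψ γ * rightAvg β F γ * H γ ∂(lam v) := by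
  have hl := hlam.isContinuousSystem h𝓖
  -- This is `leftAvg β w` with the unit frozen at `v`, for which joint measurability is clear. The
  -- inverse of this proportionality factor goes into the invariant density `ψ`.
  set κ : G → ENNReal := fun γ => ∫⁻ b, w (𝓖.lmul b.1 γ) ∂(β v) with hκ
  have hκm : Measurable κ := measurable_leftAvg_fibre hβ hw v
  have hκe : ∀ γ, 𝓖.r γ = v → κ γ = leftAvg β w γ := fun γ hγ => by rw [leftAvg, hγ]
  have h1 := lintegral_mul_leftAvg hβ hab hlam (v := v) (ψ := fun γ => ψ γ * (κ γ)⁻¹)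
    (hψ.mul hκm.inv) hF hH fun γ η hγ hη hs => by
      rw [hinv γ η hγ hη hs, hκe γ hγ, hκe η hη, leftAvg_congr hβ hab hw (hγ.trans hη.symm) hs]
  refine Eq.trans (lintegral_congr_ae ?_) (h1.trans (lintegral_congr_ae ?_))
  · filter_upwards [hl.ae_proj_eq v] with γ hγ
    have hne := leftAvg_weight_ne hab hβ hw hw1 γ
    have hc : (leftAvg β w γ)⁻¹ * leftAvg β w γ = 1 := ENNReal.inv_mul_cancel hne.1 hne.2
    rw [leftAvg_eq_mul hab hβ hw hw1 hH, hκe γ hγ]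
    calc _ = ψ γ * F γ * rightAvg β H γ * ((leftAvg β w γ)⁻¹ * leftAvg β w γ) := by
          rw [hc, mul_one]
      _ = _ := by ring
  · filter_upwards [hl.ae_proj_eq v] with γ hγ
    have hne := leftAvg_weight_ne hab hβ hw hw1 γ
    have hc : (leftAvg β w γ)⁻¹ * leftAvg β w γ = 1 := ENNReal.inv_mul_cancel hne.1 hne.2
    rw [leftAvg_eq_mul hab hβ hw hw1 hF, hκe γ hγ]
    calc _ = ψ γ * rightAvg β F γ * H γ * ((leftAvg β w γ)⁻¹ * leftAvg β w γ) := by ring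
      _ = _ := by rw [hc, mul_one]

end Weight

/-- The image in `𝓡` of the system `lam` with density `w`. -/
def quotientMeasure (lam : X → Measure G) (w : G → ENNReal) (v : X) : Measure 𝓖.IsoQuotient :=
  ((lam v).withDensity w).map IsoQuotient.mk

theorem IsoQuotient.measurable_mk : Measurable (IsoQuotient.mk : G → 𝓖.IsoQuotient) :=
  IsoQuotient.continuous_mk.measurable

theorem lintegral_quotientMeasure (lam : X → Measure G) {w : G → ENNReal} (hw : Measurable w)
    (v : X) {f : 𝓖.IsoQuotient → ENNReal} (hf : Measurable f) :
    ∫⁻ ρ, f ρ ∂(quotientMeasure (𝓖 := 𝓖) lam w v) = ∫⁻ γ, w γ * f (.mk γ) ∂(lam v) := by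
  rw [quotientMeasure, lintegral_map hf IsoQuotient.measurable_mk]
  exact lintegral_withDensity_eq_lintegral_mul _ hw (hf.comp IsoQuotient.measurable_mk)

/-- The images of the interiors of a compact exhaustion of `𝓖` form an increasing open cover of `𝓡`.
-/
theorem exists_subset_image_mk (hβ : 𝓖.isotropy.IsHaarSystem β) {K : Set 𝓖.IsoQuotient}
    (hK : IsCompact K) : ∃ L : Set G, IsCompact L ∧ K ⊆ IsoQuotient.mk '' L := by
  have hA := hβ.isOpenMap_r (isotropy_isTopological h𝓖)
  have E := CompactExhaustion.choice G
  obtain ⟨n, hn⟩ := hK.elim_directed_cover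
    (fun n => (IsoQuotient.mk '' interior (E n) : Set 𝓖.IsoQuotient))
    (fun n => IsoQuotient.isOpenMap_mk h𝓖 hA _ isOpen_interior)
    (fun ρ _ => by
      obtain ⟨n, hn⟩ := E.exists_mem_nhds ρ.out
      exact mem_iUnion.2 ⟨n, ρ.out, mem_interior_iff_mem_nhds.2 hn, ρ.mk_out⟩)
    (Monotone.directed_le fun m n hmn => image_mono (interior_mono (E.subset hmn)))
  exact ⟨E n, E.isCompact n, hn.trans (image_mono interior_subset)⟩

/-- A test function on `𝓡` lifts to a test function on `𝓖` with the same averages. -/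
theorem exists_lift (hβ : 𝓖.isotropy.IsHaarSystem β) (f : C_c(𝓖.IsoQuotient, ℂ)) :
    ∃ (H : G → ENNReal) (g : C_c(G, ℂ)), Measurable H ∧ (∀ γ, H γ ≠ ⊤) ∧
      (∀ γ, g γ = (H γ).toReal • f (.mk γ)) ∧ ∀ γ, f (.mk γ) ≠ 0 → rightAvg β H γ = 1 := by
  obtain ⟨φ, q, hc, h0, hq, hq0, hqφ, hinv, hcov⟩ := exists_testFunctions hβ
  obtain ⟨L, hL, hfL⟩ := exists_subset_image_mk hβ f.hasCompactSupport.isCompact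
  obtain ⟨n, hn⟩ := hcov L hL
  have hqf : ∀ γ, (IsoQuotient.mk γ : 𝓖.IsoQuotient) ∈ tsupport f → q n γ ≠ 0 := by
    intro γ hγ
    obtain ⟨η, hη, e⟩ := hfL hγ
    obtain ⟨hr, hs⟩ := IsoQuotient.mk_eq_mk_iff.1 e
    rw [← hinv n η γ hr hs]
    exact hn η hη
  have hm : Measurable fun γ => φ n γ / q n γ := (φ n).continuous.measurable.div (hq n).measurable
  have hnn : ∀ γ, 0 ≤ φ n γ / q n γ := fun γ => div_nonneg (h0 n γ) (hq0 n γ)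
  -- The divisor `q n` is nonzero on the preimage of the support of `f`; off that preimage the
  -- product vanishes locally.
  have hcont : Continuous fun γ => (φ n γ / q n γ) • f (.mk γ : 𝓖.IsoQuotient) := by
    rw [continuous_iff_continuousAt]
    intro γ
    by_cases hγ : (IsoQuotient.mk γ : 𝓖.IsoQuotient) ∈ tsupport f
    · exact ((φ n).continuous.continuousAt.div (hq n).continuousAt (hqf γ hγ)).smul
        (f.continuous.comp IsoQuotient.continuous_mk).continuousAt
    · have h1 : ∀ᶠ η in 𝓝 γ, (IsoQuotient.mk η : 𝓖.IsoQuotient) ∉ tsupport f :=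
        IsoQuotient.continuous_mk.continuousAt.eventually
          ((isClosed_tsupport f).isOpen_compl.eventually_mem hγ)
      refine (continuousAt_const (y := (0 : ℂ))).congr ?_
      filter_upwards [h1] with η hη
      rw [image_eq_zero_of_notMem_tsupport hη, smul_zero]
  have hsupp : HasCompactSupport fun γ => (φ n γ / q n γ) • f (.mk γ : 𝓖.IsoQuotient) := by
    refine (hc n).mono fun γ hγ h => hγ ?_
    change (φ n γ / q n γ) • f (.mk γ) = 0
    rw [h, zero_div, zero_smul]
  refine ⟨fun γ => ENNReal.ofReal (φ n γ / q n γ), ⟨⟨_, hcont⟩, hsupp⟩, hm.ennreal_ofReal,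
    fun γ => ENNReal.ofReal_ne_top, fun γ => ?_, fun γ hγ => ?_⟩
  · rw [ENNReal.toReal_ofReal (hnn γ)]
    rfl
  · have hqγ : q n γ ≠ 0 := hqf γ (subset_tsupport f hγ)
    have hpos : 0 < q n γ := lt_of_le_of_ne (hq0 n γ) hqγ.symm
    have m : Measurable fun a : 𝓖.Iso => ENNReal.ofReal (φ n (𝓖.lmul γ a.1)) :=
      ((φ n).continuous.measurable.comp
        (measurable_lmul_comp measurable_const measurable_iso_val)).ennreal_ofReal
    have h2 : rightAvg β (fun η => ENNReal.ofReal (φ n η)) γ * (ENNReal.ofReal (q n γ))⁻¹ = 1 := by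
      rw [hqφ, ENNReal.mul_inv_cancel (ENNReal.ofReal_pos.2 hpos).ne' ENNReal.ofReal_ne_top]
    rw [← h2, rightAvg, rightAvg, ← lintegral_mul_const _ m]
    refine lintegral_congr_ae ?_
    filter_upwards [ae_r_isotropy hβ (𝓖.s γ)] with a ha
    rw [hinv n (𝓖.lmul γ a.1) γ (r_lmul _ _) ((s_lmul ha.symm).trans (a.2.symm.trans ha)),
      ENNReal.ofReal_div_of_pos hpos, div_eq_mul_inv]

section Haar

variable (hab : 𝓖.HasAbelianIsotropy) (hβ : 𝓖.isotropy.IsHaarSystem β) {lam : X → Measure G}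
  (hlam : 𝓖.IsHaarSystem lam) {w : G → ENNReal} (hw : Measurable w)
  (hw1 : ∀ γ, rightAvg β w γ = 1)
include hab hβ hlam hw hw1

/-- The weight may be replaced by any function with averages one on the support. -/
theorem lintegral_quotientMeasure_eq (v : X) {f : 𝓖.IsoQuotient → ENNReal} (hf : Measurable f)
    {H : G → ENNReal} (hH : Measurable H) (hH1 : ∀ γ, f (.mk γ) ≠ 0 → rightAvg β H γ = 1) :
    ∫⁻ ρ, f ρ ∂(quotientMeasure (𝓖 := 𝓖) lam w v) = ∫⁻ γ, f (.mk γ) * H γ ∂(lam v) := by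
  have h := lintegral_mul_rightAvg hab hβ hw hw1 hlam (v := v) (hf.comp IsoQuotient.measurable_mk)
    hw hH fun γ η hγ hη hs =>
      congrArg f (IsoQuotient.mk_eq_mk_iff.2 ⟨hγ.trans hη.symm, hs⟩)
  rw [lintegral_quotientMeasure lam hw v hf]
  refine (lintegral_congr fun γ => ?_).trans (h.trans (lintegral_congr fun γ => ?_))
  · simp only [Function.comp]
    by_cases h0 : f (.mk γ) = 0
    · rw [h0, mul_zero, zero_mul, zero_mul]
    · rw [hH1 γ h0, mul_one, mul_comm]
  · rw [hw1, mul_one]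
    rfl

/-- The image measures with densities `w` and `H` agree on the set where `f` is nonzero, by the
nonnegative case applied to indicators; no integrability is needed. -/
theorem integral_quotientMeasure_eq (v : X) {f : 𝓖.IsoQuotient → ℂ} (hf : Measurable f)
    {H : G → ENNReal} (hH : Measurable H) (htop : ∀ γ, H γ ≠ ⊤)
    (hH1 : ∀ γ, f (.mk γ) ≠ 0 → rightAvg β H γ = 1) :
    ∫ ρ, f ρ ∂(quotientMeasure (𝓖 := 𝓖) lam w v) = ∫ γ, (H γ).toReal • f (.mk γ) ∂(lam v) := by
  set S : Set 𝓖.IsoQuotient := {ρ | f ρ ≠ 0} with hS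
  have hSm : MeasurableSet S := hf (measurableSet_singleton 0).compl
  have hres : (quotientMeasure (𝓖 := 𝓖) lam w v).restrict S
      = (quotientMeasure (𝓖 := 𝓖) lam H v).restrict S := by
    ext T hT
    have hi : Measurable ((T ∩ S).indicator (1 : 𝓖.IsoQuotient → ENNReal)) :=
      measurable_one.indicator (hT.inter hSm)
    rw [Measure.restrict_apply hT, Measure.restrict_apply hT,
      ← lintegral_indicator_one (hT.inter hSm), ← lintegral_indicator_one (hT.inter hSm),
      lintegral_quotientMeasure lam hH v hi,
      lintegral_quotientMeasure_eq hab hβ hlam hw hw1 v hi hH fun γ hγ =>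
        hH1 γ (mem_of_indicator_ne_zero hγ).2]
    exact lintegral_congr fun γ => mul_comm _ _
  have h0 : ∀ ρ, ρ ∉ S → f ρ = 0 := fun ρ hρ => not_not.1 hρ
  rw [← setIntegral_eq_integral_of_forall_compl_eq_zero h0, hres,
    setIntegral_eq_integral_of_forall_compl_eq_zero h0, quotientMeasure,
    integral_map IsoQuotient.measurable_mk.aemeasurable hf.aestronglyMeasurable,
    integral_withDensity_eq_integral_toReal_smul hH
      (Eventually.of_forall fun γ => (htop γ).lt_top)]

theorem quotientMeasure_regular (v : X) : (quotientMeasure (𝓖 := 𝓖) lam w v).Regular := by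
  have hA := hβ.isOpenMap_r (isotropy_isTopological h𝓖)
  have hQ := quotient_isLocallyCompactHausdorff h𝓖 hA
  have := hQ.locallyCompactSpace
  have := hQ.t2Space
  have := IsoQuotient.secondCountableTopology h𝓖 hA
  have : IsFiniteMeasureOnCompacts (quotientMeasure (𝓖 := 𝓖) lam w v) := by
    refine ⟨fun K hK => ?_⟩
    obtain ⟨φ, hc, h1, -, hr⟩ := exists_bump hK isOpen_univ (subset_univ K)
    -- The mass of `K` is dominated by the integral of a bump, hence by `∫ |g| dλ^v` for its lift
    -- `g` to `𝓖`, which is finite.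
    obtain ⟨H, g, hH, htop, hg, hH1⟩ := exists_lift hβ (complexBump φ hc)
    have := (hlam.isContinuousSystem h𝓖).finite_compacts v
    have hgi : Integrable g (lam v) := g.continuous.integrable_of_hasCompactSupport g.hasCompactSupport
    have hm : Measurable fun ρ => ‖complexBump φ hc ρ‖ₑ :=
      (complexBump φ hc).continuous.measurable.enorm
    calc quotientMeasure (𝓖 := 𝓖) lam w v K
        = ∫⁻ ρ, K.indicator 1 ρ ∂(quotientMeasure (𝓖 := 𝓖) lam w v) :=
          (lintegral_indicator_one hK.measurableSet).symm
      _ ≤ ∫⁻ ρ, ‖complexBump φ hc ρ‖ₑ ∂(quotientMeasure (𝓖 := 𝓖) lam w v) := by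
          refine lintegral_mono fun ρ => ?_
          by_cases hρ : ρ ∈ K
          · rw [complexBump_apply, h1 hρ]
            simp [hρ]
          · simp [hρ]
      _ = ∫⁻ γ, ‖complexBump φ hc (.mk γ)‖ₑ * H γ ∂(lam v) :=
          lintegral_quotientMeasure_eq hab hβ hlam hw hw1 v hm hH fun γ hγ =>
            hH1 γ (enorm_ne_zero.1 hγ)
      _ = ∫⁻ γ, ‖g γ‖ₑ ∂(lam v) := by
          refine lintegral_congr fun γ => ?_
          rw [hg, enorm_smul, Real.enorm_of_nonneg ENNReal.toReal_nonneg,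
            ENNReal.ofReal_toReal (htop γ), mul_comm]
      _ < ⊤ := hgi.2
  infer_instance

theorem ae_r_quotientMeasure (v : X) :
    ∀ᵐ ρ ∂(quotientMeasure (𝓖 := 𝓖) lam w v), IsoQuotient.r ρ = v := by
  have := t2Space_units h𝓖
  have hm : MeasurableSet {ρ : 𝓖.IsoQuotient | IsoQuotient.r ρ = v} :=
    (isClosed_eq (IsoQuotient.continuous_r h𝓖) continuous_const).measurableSet
  rw [quotientMeasure, ae_map_iff IsoQuotient.measurable_mk.aemeasurable hm]
  exact (withDensity_absolutelyContinuous _ _).ae_le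
    ((hlam.isContinuousSystem h𝓖).ae_proj_eq v)

/-- For a representative `η`, invariance of `lam` replaces `w` by its translate `γ ↦ w(ηγ)`. That
translate again has right averages one on the fibre over `s η`, so symmetry of right averaging
exchanges it for `w`. -/
theorem map_lmul_quotientMeasure (ρ : 𝓖.IsoQuotient) :
    (quotientMeasure (𝓖 := 𝓖) lam w ρ.s).map (𝓖.quotient.lmul ρ)
      = quotientMeasure (𝓖 := 𝓖) lam w ρ.r := by
  have hA := hβ.isOpenMap_r (isotropy_isTopological h𝓖)
  have hQ := quotient_isLocallyCompactHausdorff h𝓖 hA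
  have := hQ.t2Space
  have hl := hlam.isContinuousSystem h𝓖
  obtain ⟨η, rfl⟩ := IsoQuotient.mk_surjective ρ
  have hηm : Measurable (𝓖.quotient.lmul (.mk η)) := measurable_lmul hQ.isTopological _
  refine Measure.ext_of_lintegral _ fun f hf => ?_
  have hml := measurable_lmul h𝓖 η
  have hw' : Measurable fun γ => w (𝓖.lmul η γ) := hw.comp hml
  have hψ : Measurable fun γ => f (.mk (𝓖.lmul η γ)) := hf.comp (IsoQuotient.measurable_mk.comp hml)
  have hfη : Measurable fun ρ => f (𝓖.quotient.lmul (.mk η) ρ) := hf.comp hηm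
  have hwf : Measurable fun γ => w γ * f (.mk γ) := hw.mul (hf.comp IsoQuotient.measurable_mk)
  rw [lintegral_map hf hηm, lintegral_quotientMeasure lam hw _ hfη,
    lintegral_quotientMeasure lam hw _ hf, IsoQuotient.r_mk, IsoQuotient.s_mk,
    ← hlam.map_lmul h𝓖 η, lintegral_map hwf hml]
  have h := lintegral_mul_rightAvg hab hβ hw hw1 hlam (v := 𝓖.s η) hψ hw hw'
    fun γ ζ hγ hζ hs => congrArg f (IsoQuotient.mk_eq_mk_iff.2
        ⟨by rw [r_lmul, r_lmul], by rw [s_lmul hγ.symm, s_lmul hζ.symm, hs]⟩)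
  refine Eq.trans (lintegral_congr_ae ?_) (h.trans (lintegral_congr fun γ => ?_))
  · filter_upwards [hl.ae_proj_eq (𝓖.s η)] with γ hγ
    have e : 𝓖.quotient.lmul (.mk η) (.mk γ) = .mk (𝓖.lmul η γ) := by
      have h1 : 𝓖.quotient.lmul (.mk η) (.mk γ) = 𝓖.quotient.mul (.mk η) (.mk γ) hγ.symm :=
        dif_pos _
      rw [h1, quotient_mul_mk, lmul_eq hγ.symm]
    have e2 : rightAvg β (fun γ => w (𝓖.lmul η γ)) γ = 1 := by
      rw [← hw1 (𝓖.lmul η γ), rightAvg, rightAvg, s_lmul hγ.symm]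
      refine lintegral_congr_ae ?_
      filter_upwards [ae_r_isotropy hβ (𝓖.s γ)] with a ha
      rw [lmul_assoc hγ.symm ha.symm]
    rw [e, e2, mul_one, mul_comm]
  · rw [hw1, mul_one, mul_comm]

theorem quotientMeasure_support (v : X) :
    (quotientMeasure (𝓖 := 𝓖) lam w v).support = {ρ | IsoQuotient.r ρ = v} := by
  have := t2Space_units h𝓖
  ext ρ
  rw [Measure.mem_support_iff_forall]
  constructor
  · intro h
    by_contra hρ
    have hU : IsOpen {ρ : 𝓖.IsoQuotient | IsoQuotient.r ρ ≠ v} :=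
      isOpen_ne_fun (IsoQuotient.continuous_r h𝓖) continuous_const
    exact (h _ (hU.mem_nhds hρ)).ne' (ae_r_quotientMeasure hab hβ hlam hw hw1 v)
  · intro hρ U hU
    obtain ⟨V, hVU, hV, hρV⟩ := mem_nhds_iff.1 hU
    refine lt_of_lt_of_le (pos_iff_ne_zero.2 fun h0 => ?_) (measure_mono hVU)
    have hf : Measurable (V.indicator (1 : 𝓖.IsoQuotient → ENNReal)) :=
      measurable_one.indicator hV.measurableSet
    have hf' := hf.comp (IsoQuotient.measurable_mk (𝓖 := 𝓖))
    rw [← lintegral_indicator_one hV.measurableSet, lintegral_quotientMeasure lam hw v hf] at h0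
    replace h0 := (lintegral_eq_zero_iff (hw.mul hf')).1 h0
    -- Symmetry with `H = 1`: if `w` vanished almost everywhere on the preimage of `V`, then that
    -- preimage would be `lam v`-null, contradicting full support. The average of `1` may be
    -- infinite, but it is multiplied by zero.
    have h := lintegral_mul_rightAvg hab hβ hw hw1 hlam (v := v) hf' hw
      (measurable_one (α := ENNReal) (β := G)) fun γ η hγ hη hs =>
        congrArg (V.indicator 1) (IsoQuotient.mk_eq_mk_iff.2 ⟨hγ.trans hη.symm, hs⟩)
    have hpos : 0 < lam v (IsoQuotient.mk ⁻¹' V : Set G) :=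
      hlam.pos_of_isOpen (hV.preimage IsoQuotient.continuous_mk) (γ := ρ.out)
        (by rw [mem_preimage, IsoQuotient.mk_out]; exact hρV) (ρ.r_out.trans hρ)
    rw [← lintegral_indicator_one
      (IsoQuotient.measurable_mk hV.measurableSet)] at hpos
    refine hpos.ne' (Eq.trans (lintegral_congr fun γ => ?_) (h.symm.trans ?_))
    · rw [hw1, mul_one, Pi.one_apply, mul_one]
      rfl
    · rw [← lintegral_zero (μ := lam v)]
      refine lintegral_congr_ae ?_
      filter_upwards [h0] with γ hγ
      have hγ' : (V.indicator (1 : 𝓖.IsoQuotient → ENNReal) ∘ IsoQuotient.mk) γ * w γ = 0 :=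
        (mul_comm _ _).trans hγ
      rw [hγ', zero_mul]

theorem quotientMeasure_isHaarSystem :
    𝓖.quotient.IsHaarSystem (quotientMeasure (𝓖 := 𝓖) lam w) where
  regular := quotientMeasure_regular hab hβ hlam hw hw1
  support_eq := quotientMeasure_support hab hβ hlam hw hw1
  continuous_integral f := by
    obtain ⟨H, g, hH, htop, hg, hH1⟩ := exists_lift hβ f
    refine (hlam.continuous_integral g).congr fun v => ?_
    exact (integral_congr_ae (Eventually.of_forall hg)).trans (integral_quotientMeasure_eq
      hab hβ hlam hw hw1 v (map_continuous f).measurable hH htop hH1).symm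
  left_invariant f ρ := by
    have hA := hβ.isOpenMap_r (isotropy_isTopological h𝓖)
    have hQ := quotient_isLocallyCompactHausdorff h𝓖 hA
    have := hQ.t2Space
    have hm : Measurable (𝓖.quotient.lmul ρ) := measurable_lmul hQ.isTopological _
    have h1 : (quotientMeasure (𝓖 := 𝓖) lam w (𝓖.quotient.s ρ)).map (𝓖.quotient.lmul ρ)
      = quotientMeasure (𝓖 := 𝓖) lam w (𝓖.quotient.r ρ) :=
        map_lmul_quotientMeasure hab hβ hlam hw hw1 ρ
    rw [← h1, integral_map hm.aemeasurable (map_continuous f).measurable.aestronglyMeasurable]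
    refine integral_congr_ae ?_
    filter_upwards [ae_r_quotientMeasure hab hβ hlam hw hw1 (𝓖.quotient.s ρ)] with σ hσ
    have hσ' : 𝓖.quotient.s ρ = 𝓖.quotient.r σ := Eq.symm hσ
    rw [dif_pos hσ', lmul_eq hσ']

end Haar

/-- If `𝓖` has a Haar system, so does `𝓖/𝓐`. -/
theorem exists_quotient_isHaarSystem (hab : 𝓖.HasAbelianIsotropy)
    (hβ : 𝓖.isotropy.IsHaarSystem β) {lam : X → Measure G} (hlam : 𝓖.IsHaarSystem lam) :
    ∃ α : X → Measure 𝓖.IsoQuotient, 𝓖.quotient.IsHaarSystem α := by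
  obtain ⟨w, hw, hw1⟩ := exists_weight hβ
  exact ⟨_, quotientMeasure_isHaarSystem hab hβ hlam hw hw1⟩

end GroupoidOn

end

/-! ### The main theorem -/

theorem mainTheorem10 {X G : Type*} [TopologicalSpace X] [TopologicalSpace G]
    [SecondCountableTopology G] [LocallyCompactSpace G] [T2Space G]
    [MeasurableSpace G] [BorelSpace G]
    (𝓖 : GroupoidOn X G) [𝓖.IsTopological] (hab : 𝓖.HasAbelianIsotropy)
    (β : X → Measure 𝓖.Iso) (hβ : 𝓖.isotropy.IsHaarSystem β) :
    (𝓖.quotient.IsLocallyCompactHausdorff ∧ (𝓖.semidirect hab β).IsLocallyCompactHausdorff) ∧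
    ((∃ lam : X → Measure G, 𝓖.IsHaarSystem lam) →
      (∃ α : X → Measure 𝓖.IsoQuotient, 𝓖.quotient.IsHaarSystem α) ∧
      ∀ α : X → Measure 𝓖.IsoQuotient, 𝓖.quotient.IsHaarSystem α →
        (𝓖.semidirect hab β).IsHaarSystem (GroupoidOn.deltaProd β α) ∧
        (𝓖.quotient.IsIntegrable α ↔
          (𝓖.semidirect hab β).IsIntegrable (GroupoidOn.deltaProd β α))) ∧
    (𝓖.quotient.IsCartan ↔ (𝓖.semidirect hab β).IsCartan) := by
  refine ⟨⟨GroupoidOn.quotient_isLocallyCompactHausdorff inferInstance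
      (hβ.isOpenMap_r (GroupoidOn.isotropy_isTopological inferInstance)),
    GroupoidOn.semidirect_isLocallyCompactHausdorff hab hβ⟩, ?_,
    GroupoidOn.isCartan_quotient_iff hab hβ⟩
  rintro ⟨lam, hlam⟩
  refine ⟨GroupoidOn.exists_quotient_isHaarSystem hab hβ hlam, fun α hα =>
    ⟨GroupoidOn.deltaProd_isHaarSystem hab hβ hα, GroupoidOn.isIntegrable_quotient_iff hab hβ hα⟩⟩
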